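/- Let $\Gamma$ be a nonempty closed (compact, without boundary) infinitely smooth manifold of dimension $n\ge 1$, equipped with a positive $C^\infty$-density $dx$. Let $\mathcal D'(\Gamma)$ be the space of distributions on $\Gamma$, i.e. of continuous antilinear functionals on $C^\infty(\Gamma)$; a continuous function $f$ is identified with the distribution $w\mapsto\int_\Gamma f\,\overline{w}\,dx$. Let $\mathcal M$ be the set of all Borel measurable functions $\varphi:[1,\infty)\to(0,\infty)$ such that $\varphi$ and $1/\varphi$ are bounded on every interval $[1,b]$, $1<b<\infty$, and $\lim_{t\to\infty}\varphi(\lambda t)/\varphi(t)=1$ for each $\lambda>0$. For $s\in\mathbb R$ and $\varphi\in\mathcal M$, let $H^{s,\varphi}(\mathbb R^n)$ be the space of all tempered distributions $u$ on $\mathbb R^n$ whose Fourier transform $\widehat u$ is a locally integrable function with $$\|u\|^2_{H^{s,\varphi}(\mathbb R^n)}:=\int_{\mathbb R^n}\langle\xi\rangle^{2s}\varphi^2(\langle\xi\rangle)\,|\widehat u(\xi)|^2\,d\xi<\infty,\qquad \langle\xi\rangle:=(1+|\xi|^2)^{1/2}.$$ Fix a finite atlas of $\Gamma$ from its $C^\infty$-structure,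 consisting of charts $\alpha_j:\mathbb R^n\leftrightarrow U_j$, $j=1,\dots,r$, and a $C^\infty$ partition of unity $\chi_1,\dots,\chi_r$ on $\Gamma$ with $\operatorname{supp}\chi_j\subset U_j$. Let $H^{s,\varphi}(\Gamma)$ be the space of all $h\in\mathcal D'(\Gamma)$ such that $(\chi_jh)\circ\alpha_j\in H^{s,\varphi}(\mathbb R^n)$ for every $j$, with the norm $\bigl(\sum_{j=1}^r\|(\chi_jh)\circ\alpha_j\|^2_{H^{s,\varphi}(\mathbb R^n)}\bigr)^{1/2}$, where $(\chi_jh)\circ\alpha_j$ is the representation of the distribution $\chi_jh$ in the chart $\alpha_j$. Let $\varphi\in\mathcal M$ and let $\rho\ge0$ be an integer. Then $$\int_1^\infty\frac{dt}{t\,\varphi^2(t)}<\infty$$ if and only if every $h\in H^{\rho+n/2,\varphi}(\Gamma)$ is a function in $C^\rho(\Gamma)$ and the resulting inclusion $H^{\rho+n/2,\varphi}(\Gamma)\hookrightarrow C^\rho(\Gamma)$ is continuous. Moreover, whenever this inclusion is defined and continuous, it is a compact operator. -/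

import Mathlib

open MeasureTheory Set Filter
open scoped Manifold ContDiff Topology SchwartzMap FourierTransform ComplexConjugate

noncomputable section

/-! ### The class of slowly varying parameters -/

/-- The class `𝓜`: Borel functions `φ : [1, ∞) → (0, ∞)` such that `φ` and `1/φ` are bounded on
every `[1, b]`, `1 < b < ∞`, and `φ` is slowly varying at `∞` in Karamata's sense.  Such a function
is represented by a function on `ℝ` of which only the values on `[1, ∞)` are ever used. -/
structure SlowlyVaryingClass (φ : ℝ → ℝ) : Prop where
  measurable : Measurable ((Ici (1 : ℝ)).domRestrict φ)
  pos : ∀ t, 1 ≤ t → 0 < φ t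
  bounded : ∀ b, 1 < b → ∃ C, ∀ t ∈ Icc 1 b, φ t ≤ C
  bounded_inv : ∀ b, 1 < b → ∃ C, ∀ t ∈ Icc 1 b, 1 / φ t ≤ C
  slowlyVarying : ∀ c : ℝ, 0 < c → Tendsto (fun t => φ (c * t) / φ t) atTop (𝓝 1)

/-! ### The spaces `H^{s,φ}(ℝⁿ)` -/

/-- The Euclidean space `ℝⁿ`. -/
abbrev EuclSp (n : ℕ) : Type := EuclideanSpace ℝ (Fin n)

/-- `⟨ξ⟩ = (1 + ξ₁² + … + ξₙ²)^{1/2}`. -/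
def japaneseBracket {n : ℕ} (ξ : EuclSp n) : ℝ := Real.sqrt (1 + ‖ξ‖ ^ 2)

/-- The weight `⟨ξ⟩^s φ(⟨ξ⟩)`. -/
def refinedWeight {n : ℕ} (s : ℝ) (φ : ℝ → ℝ) (ξ : EuclSp n) : ℝ :=
  japaneseBracket ξ ^ s * φ (japaneseBracket ξ)

/-- The Fourier transform of the tempered distribution `u` is the locally integrable function `f`
(as distributions, that is, tested against compactly supported smooth functions). -/
def HasFourierFunction {n : ℕ} (u : 𝓢'(EuclSp n, ℂ)) (f : EuclSp n → ℂ) : Prop :=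
  LocallyIntegrable f ∧
    ∀ g : 𝓢(EuclSp n, ℂ), HasCompactSupport g → (𝓕 u) g = ∫ ξ, g ξ * f ξ

theorem integrable_schwartz_mul {n : ℕ} {f : EuclSp n → ℂ} (hf : LocallyIntegrable f)
    (g : 𝓢(EuclSp n, ℂ)) (hg : HasCompactSupport g) : Integrable (fun ξ => g ξ * f ξ) := by
  simpa [smul_eq_mul] using hf.integrable_smul_left_of_hasCompactSupport g.continuous hg

theorem HasFourierFunction.add {n : ℕ} {u v : 𝓢'(EuclSp n, ℂ)} {f g : EuclSp n → ℂ}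
    (hu : HasFourierFunction u f) (hv : HasFourierFunction v g) :
    HasFourierFunction (u + v) (f + g) := by
  refine ⟨hu.1.add hv.1, fun w hw => ?_⟩
  have h1 : (𝓕 (u + v)) w = (𝓕 u) w + (𝓕 v) w := rfl
  rw [h1, hu.2 w hw, hv.2 w hw, ← integral_add (integrable_schwartz_mul hu.1 w hw)
    (integrable_schwartz_mul hv.1 w hw)]
  simp [mul_add]

theorem HasFourierFunction.smul {n : ℕ} {u : 𝓢'(EuclSp n, ℂ)} {f : EuclSp n → ℂ} (c : ℂ)
    (hu : HasFourierFunction u f) : HasFourierFunction (c • u) (c • f) := by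
  refine ⟨hu.1.smul c, fun w hw => ?_⟩
  have h1 : (𝓕 (c • u)) w = c * (𝓕 u) w := rfl
  rw [h1, hu.2 w hw, ← integral_const_mul]
  simp [mul_left_comm]

theorem HasFourierFunction.zero {n : ℕ} :
    HasFourierFunction (0 : 𝓢'(EuclSp n, ℂ)) (0 : EuclSp n → ℂ) := by
  refine ⟨locallyIntegrable_zero, fun w _ => ?_⟩
  simp

theorem HasFourierFunction.ae_eq {n : ℕ} {u : 𝓢'(EuclSp n, ℂ)} {f g : EuclSp n → ℂ}
    (hf : HasFourierFunction u f) (hg : HasFourierFunction u g) : f =ᵐ[volume] g := by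
  refine ae_eq_of_integral_contDiff_smul_eq hf.1 hg.1 fun w hw hw' => ?_
  have h1 : HasCompactSupport (Complex.ofRealCLM ∘ w) := hw'.comp_left rfl
  have h2 : ContDiff ℝ ∞ (Complex.ofRealCLM ∘ w) := by fun_prop
  have h3 : HasCompactSupport (h1.toSchwartzMap h2 : EuclSp n → ℂ) := h1
  simpa using (hf.2 (h1.toSchwartzMap h2) h3).symm.trans (hg.2 (h1.toSchwartzMap h2) h3)

/-- `H^{s,φ}(ℝⁿ)`: the tempered distributions `u` whose Fourier transform is a locally integrable
function `f` with `∫ ⟨ξ⟩^{2s} φ²(⟨ξ⟩) |f(ξ)|² dξ < ∞`. -/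
def refinedSubmodule (n : ℕ) (s : ℝ) (φ : ℝ → ℝ) : Submodule ℂ 𝓢'(EuclSp n, ℂ) where
  carrier := {u | ∃ f : EuclSp n → ℂ, HasFourierFunction u f ∧
    MemLp (fun ξ => (refinedWeight s φ ξ : ℂ) * f ξ) 2 volume}
  zero_mem' := ⟨0, .zero, by simp⟩
  add_mem' := by
    rintro u v ⟨f, hf, hf'⟩ ⟨g, hg, hg'⟩
    refine ⟨f + g, hf.add hg, ?_⟩
    convert hf'.add hg' using 1
    ext ξ
    simp [mul_add]
  smul_mem' := by
    rintro c u ⟨f, hf, hf'⟩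
    refine ⟨c • f, hf.smul c, ?_⟩
    convert hf'.const_mul c using 1
    ext ξ
    simp [mul_left_comm]

/-- The linear map `u ↦ ⟨ξ⟩^s φ(⟨ξ⟩) û(ξ)` from `H^{s,φ}(ℝⁿ)` to `L₂(ℝⁿ)`.  The inner product and
the norm of `H^{s,φ}(ℝⁿ)` are those of `L₂(ℝⁿ)` pulled back along this map. -/
def weightedFourier (n : ℕ) (s : ℝ) (φ : ℝ → ℝ) :
    refinedSubmodule n s φ →ₗ[ℂ] Lp ℂ 2 (volume : Measure (EuclSp n)) where
  toFun u := u.2.choose_spec.2.toLp _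
  map_add' u v := by
    rw [← MemLp.toLp_add]
    refine MemLp.toLp_congr _ _ ?_
    filter_upwards [(u + v).2.choose_spec.1.ae_eq
      (u.2.choose_spec.1.add v.2.choose_spec.1)] with ξ hξ
    simp only [Pi.add_apply] at hξ ⊢
    rw [hξ, mul_add]
  map_smul' c u := by
    rw [RingHom.id_apply, ← MemLp.toLp_const_smul]
    refine MemLp.toLp_congr _ _ ?_
    filter_upwards [(c • u).2.choose_spec.1.ae_eq (u.2.choose_spec.1.smul c)] with ξ hξ
    simp only [Pi.smul_apply, smul_eq_mul] at hξ ⊢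
    rw [hξ, mul_left_comm]

/-! ### `C^k` functions and distributions on a manifold -/

section Manifold

variable (n : ℕ) (Γ : Type*) [TopologicalSpace Γ] [ChartedSpace (EuclSp n) Γ]

/-- The complex vector space of `C^k` functions `Γ → ℂ`. -/
def ckSubmodule (k : ℕ∞) : Submodule ℂ (Γ → ℂ) where
  carrier := {u | ContMDiff (𝓡 n) 𝓘(ℝ, ℂ) k u}
  zero_mem' := contMDiff_const
  add_mem' := fun hu hv => hu.add hv
  smul_mem' := fun c u hu => by
    have h : ContMDiff (𝓡 n) 𝓘(ℝ, ℂ) k (fun x => c * u x) :=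
      (ContinuousLinearMap.mul ℝ ℂ c).contMDiff.comp hu
    exact h

/-- The space `C^k(Γ)` of complex-valued functions, `0 ≤ k ≤ ∞`; it is a copy of `ckSubmodule`
that carries the `C^k` topology instead of the topology of pointwise convergence. -/
def CkSpace (k : ℕ∞) : Type _ := ckSubmodule n Γ k

namespace CkSpace

variable {n Γ} {k : ℕ∞}

instance : AddCommGroup (CkSpace n Γ k) := inferInstanceAs (AddCommGroup (ckSubmodule n Γ k))

instance : Module ℂ (CkSpace n Γ k) := inferInstanceAs (Module ℂ (ckSubmodule n Γ k))

instance : CoeFun (CkSpace n Γ k) (fun _ => Γ → ℂ) := ⟨fun u => u.1⟩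

/-- The topology of `C^k(Γ)`: uniform convergence, on compact subsets of the range of every chart of
the `C^∞` structure, of all derivatives of order `i ≤ k` of the function in that chart. -/
instance : TopologicalSpace (CkSpace n Γ k) :=
  ⨅ (β : OpenPartialHomeomorph Γ (EuclSp n)) (_ : β ∈ IsManifold.maximalAtlas (𝓡 n) ∞ Γ)
    (i : ℕ) (_ : (i : ℕ∞) ≤ k),
    TopologicalSpace.induced
      (fun u : CkSpace n Γ k =>
        UniformOnFun.ofFun {K : Set (EuclSp n) | IsCompact K ∧ K ⊆ β.target}
          (iteratedFDeriv ℝ i ((u : Γ → ℂ) ∘ β.symm)))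
      inferInstance

end CkSpace

/-- `𝓓'(Γ)`: the continuous antilinear functionals on `C^∞(Γ)`. -/
abbrev DistributionOn : Type _ := CkSpace n Γ ⊤ →SL[starRingEnd ℂ] ℂ

/-- A positive `C^∞`-density `dx` on `Γ`: a Borel measure which, in every chart `β` of the `C^∞`
structure, is the Lebesgue measure times a positive `C^∞` function `dens β`. -/
structure SmoothDensity [MeasurableSpace Γ] where
  /-- the measure `dx` -/
  measure : Measure Γ
  /-- the density function of `dx` in the chart `β` -/
  dens : OpenPartialHomeomorph Γ (EuclSp n) → EuclSp n → ℝ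
  contDiffOn_dens : ∀ β ∈ IsManifold.maximalAtlas (𝓡 n) ∞ Γ, ContDiffOn ℝ ∞ (dens β) β.target
  dens_pos : ∀ β ∈ IsManifold.maximalAtlas (𝓡 n) ∞ Γ, ∀ x ∈ β.target, 0 < dens β x
  map_restrict : ∀ β ∈ IsManifold.maximalAtlas (𝓡 n) ∞ Γ,
    (measure.restrict β.source).map β =
      (volume.restrict β.target).withDensity (fun x => ENNReal.ofReal (dens β x))

/-- A finite atlas of charts `U_j ↔ ℝⁿ` from the `C^∞` structure of `Γ`, together with a `C^∞`
partition of unity `χ_j` with `supp χ_j ⊆ U_j`.  (The `chart j` maps `U_j` onto `ℝⁿ`.) -/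
structure AdaptedAtlas where
  /-- the number of charts -/
  r : ℕ
  /-- the charts -/
  chart : Fin r → OpenPartialHomeomorph Γ (EuclSp n)
  chart_mem : ∀ j, chart j ∈ IsManifold.maximalAtlas (𝓡 n) ∞ Γ
  chart_target : ∀ j, (chart j).target = univ
  chart_cover : (⋃ j, (chart j).source) = univ
  /-- the partition of unity -/
  χ : SmoothPartitionOfUnity (Fin r) (𝓡 n) Γ univ
  χ_subordinate : χ.IsSubordinate fun j => (chart j).source

end Manifold

/-! ### Distributions in local charts -/

section LocalRep

theorem exists_iteratedFDeriv_mul_comp_bound {n : ℕ} {O K : Set (EuclSp n)} (hO : IsOpen O)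
    (hK : IsCompact K) (hKO : K ⊆ O) {ψ : EuclSp n → ℂ} {τ : EuclSp n → EuclSp n}
    (hψ : ContDiffOn ℝ ∞ ψ O) (hτ : ContDiffOn ℝ ∞ τ O) (i : ℕ) :
    ∃ C : ℝ, 0 ≤ C ∧ ∀ g : 𝓢(EuclSp n, ℂ), ∀ x ∈ K,
      ‖iteratedFDeriv ℝ i (fun y => ψ y * conj (g (τ y))) x‖ ≤
        C * ∑ l ∈ Finset.range (i + 1), SchwartzMap.seminorm ℝ 0 l g := by
  have hbd : ∀ {F : Type} [NormedAddCommGroup F] [NormedSpace ℝ F] (f : EuclSp n → F),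
      ContDiffOn ℝ ∞ f O → ∃ B : ℝ, 1 ≤ B ∧ ∀ l ≤ i, ∀ x ∈ K,
        ‖iteratedFDerivWithin ℝ l f O x‖ ≤ B := by
    intro F _ _ f hf
    have h : ∀ l : ℕ, ∃ B : ℝ, ∀ x ∈ K, ‖iteratedFDerivWithin ℝ l f O x‖ ≤ B := fun l =>
      hK.exists_bound_of_continuousOn ((hf.continuousOn_iteratedFDerivWithin
        (mod_cast le_top) hO.uniqueDiffOn).mono hKO)
    choose B hB using h
    refine ⟨1 + ∑ l ∈ Finset.range (i + 1), |B l|, ?_, fun l hl x hx => ?_⟩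
    · have : 0 ≤ ∑ l ∈ Finset.range (i + 1), |B l| := Finset.sum_nonneg fun _ _ => abs_nonneg _
      linarith
    · have h1 : |B l| ≤ ∑ l ∈ Finset.range (i + 1), |B l| :=
        Finset.single_le_sum (f := fun l => |B l|) (fun _ _ => abs_nonneg _)
          (Finset.mem_range.2 (by omega))
      linarith [hB l x hx, le_abs_self (B l)]
  obtain ⟨A, hA1, hA⟩ := hbd ψ hψ
  obtain ⟨B, hB1, hB⟩ := hbd τ hτ
  refine ⟨∑ l ∈ Finset.range (i + 1), (i.choose l : ℝ) * A * ((i - l).factorial * B ^ (i - l)),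
    Finset.sum_nonneg fun _ _ => by positivity, fun g x hx => ?_⟩
  set p : ℝ := ∑ l ∈ Finset.range (i + 1), SchwartzMap.seminorm ℝ 0 l g with hp
  have hgs : ContDiff ℝ ∞ (fun y => conj (g y)) := Complex.conjCLE.contDiff.comp (g.smooth ⊤)
  have hxO := hKO hx
  have hg : ∀ m ≤ i, ‖iteratedFDerivWithin ℝ m (fun y => conj (g (τ y))) O x‖ ≤
      m.factorial * p * B ^ m := by
    intro m hm
    refine norm_iteratedFDerivWithin_comp_le (N := ∞) (g := fun y => conj (g y)) (t := univ)
      hgs.contDiffOn hτ (mod_cast le_top) uniqueDiffOn_univ hO.uniqueDiffOn (mapsTo_univ _ _) hxO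
      (fun l hl => ?_) (fun l hl1 hl => ?_)
    · rw [iteratedFDerivWithin_univ]
      have h1 : ‖iteratedFDeriv ℝ l (fun y => conj (g y)) (τ x)‖ =
          ‖iteratedFDeriv ℝ l g (τ x)‖ :=
        Complex.conjLIE.norm_iteratedFDeriv_comp_left (g : EuclSp n → ℂ) (τ x) l
      rw [h1]
      refine (SchwartzMap.norm_iteratedFDeriv_le_seminorm ℝ g l (τ x)).trans ?_
      exact Finset.single_le_sum (f := fun l => SchwartzMap.seminorm ℝ 0 l g)
        (fun _ _ => apply_nonneg _ _) (Finset.mem_range.2 (by omega))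
    · exact (hB l (by omega) x hx).trans (le_self_pow₀ hB1 (by omega))
  have hp0 : 0 ≤ p := Finset.sum_nonneg fun _ _ => apply_nonneg _ _
  rw [← iteratedFDerivWithin_of_isOpen i hO hxO, Finset.sum_mul]
  refine (norm_iteratedFDerivWithin_mul_le (N := ∞) hψ (hgs.comp_contDiffOn hτ) hO.uniqueDiffOn hxO
    (mod_cast le_top)).trans (Finset.sum_le_sum fun l hl => ?_)
  have hl' : l ≤ i := by have := Finset.mem_range.1 hl; omega
  calc _ ≤ (i.choose l : ℝ) * A * ((i - l).factorial * p * B ^ (i - l)) := by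
        gcongr
        · exact hA l hl' x hx
        · exact hg (i - l) (by omega)
    _ = _ := by ring

variable {n : ℕ} {Γ : Type*} [TopologicalSpace Γ] [ChartedSpace (EuclSp n) Γ]
  [MeasurableSpace Γ]

theorem contMDiffAt_chartTest (A : AdaptedAtlas n Γ) (d : SmoothDensity n Γ) (j : Fin A.r)
    {y : Γ} (hy : y ∈ (A.chart j).source) :
    ContMDiffAt (𝓡 n) 𝓘(ℝ, ℂ) ∞
      (fun y => ((A.χ j y * (d.dens (A.chart j) (A.chart j y))⁻¹ : ℝ) : ℂ)) y := by
  have hα : ContMDiffAt (𝓡 n) (𝓡 n) ∞ (A.chart j) y :=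
    (contMDiffOn_of_mem_maximalAtlas (A.chart_mem j)).contMDiffAt
      ((A.chart j).open_source.mem_nhds hy)
  have hyt := (A.chart j).map_source hy
  have hd : ContDiffAt ℝ ∞ (fun x => (d.dens (A.chart j) x)⁻¹) (A.chart j y) :=
    ((d.contDiffOn_dens _ (A.chart_mem j)).contDiffAt
      ((A.chart j).open_target.mem_nhds hyt)).inv (d.dens_pos _ (A.chart_mem j) _ hyt).ne'
  have h1 := (A.χ j).contMDiff.contMDiffAt (x := y) |>.mul (hd.contMDiffAt.comp y hα)
  exact (Complex.ofRealCLM.contDiff (n := ∞)).contMDiff.contMDiffAt.comp y h1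

/-- For a Schwartz function `g` on `ℝⁿ`, the `C^∞` function `χ_j · (conj g ∘ β) / (dens ∘ β)` on
`Γ`, where `β : U_j → ℝⁿ` is the `j`-th chart and `dens` the density of `dx` in it (the function
vanishes outside `U_j` since `χ_j` does). -/
def chartTest (A : AdaptedAtlas n Γ) (d : SmoothDensity n Γ) (j : Fin A.r)
    (g : 𝓢(EuclSp n, ℂ)) : CkSpace n Γ ⊤ :=
  ⟨fun y => ((A.χ j y * (d.dens (A.chart j) (A.chart j y))⁻¹ : ℝ) : ℂ) *
      conj (g (A.chart j y)), by
    refine contMDiff_of_tsupport fun y hy => ?_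
    have hy' : y ∈ (A.chart j).source := by
      refine A.χ_subordinate j (closure_mono ?_ hy)
      intro z hz hz'
      simp [hz'] at hz
    have hα : ContMDiffAt (𝓡 n) (𝓡 n) ∞ (A.chart j) y :=
      (contMDiffOn_of_mem_maximalAtlas (A.chart_mem j)).contMDiffAt
        ((A.chart j).open_source.mem_nhds hy')
    have hg : ContDiff ℝ ∞ (fun y => conj (g y)) := Complex.conjCLE.contDiff.comp (g.smooth ⊤)
    exact (contDiff_mul (𝕜 := ℝ) (n := ∞) (𝔸 := ℂ)).contMDiff.contMDiffAt.comp y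
      ((contMDiffAt_chartTest A d j hy').prodMk_space (hg.contMDiff.contMDiffAt.comp y hα))⟩

theorem chartTest_add (A : AdaptedAtlas n Γ) (d : SmoothDensity n Γ) (j : Fin A.r)
    (g g' : 𝓢(EuclSp n, ℂ)) : chartTest A d j (g + g') = chartTest A d j g + chartTest A d j g' :=
  Subtype.ext (funext fun y => by
    change _ * conj (g _ + g' _) = _ * conj (g _) + _ * conj (g' _)
    rw [map_add, mul_add])

theorem chartTest_smul (A : AdaptedAtlas n Γ) (d : SmoothDensity n Γ) (j : Fin A.r)
    (c : ℂ) (g : 𝓢(EuclSp n, ℂ)) : chartTest A d j (c • g) = conj c • chartTest A d j g :=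
  Subtype.ext (funext fun y => by
    change _ * conj (c * g _) = conj c * (_ * conj (g _))
    rw [map_mul, mul_left_comm])

theorem exists_chartTest_bound [IsManifold (𝓡 n) ∞ Γ] [T2Space Γ]
    (A : AdaptedAtlas n Γ) (d : SmoothDensity n Γ)
    (j : Fin A.r) {β : OpenPartialHomeomorph Γ (EuclSp n)}
    (hβ : β ∈ IsManifold.maximalAtlas (𝓡 n) ∞ Γ) {K : Set (EuclSp n)} (hK : IsCompact K)
    (hKβ : K ⊆ β.target) (i : ℕ) :
    ∃ C : ℝ, 0 ≤ C ∧ ∀ g : 𝓢(EuclSp n, ℂ), ∀ x ∈ K,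
      ‖iteratedFDeriv ℝ i ((chartTest A d j g : Γ → ℂ) ∘ β.symm) x‖ ≤
        C * ∑ l ∈ Finset.range (i + 1), SchwartzMap.seminorm ℝ 0 l g := by
  set α := A.chart j
  set O : Set (EuclSp n) := β.target ∩ β.symm ⁻¹' α.source
  have hO : IsOpen O := β.isOpen_inter_preimage_symm α.open_source
  set K' : Set (EuclSp n) := K ∩ β.symm ⁻¹' (tsupport (A.χ j))
  have hK' : IsCompact K' := by
    have h1 : IsClosed K' :=
      (β.continuousOn_symm.mono hKβ).preimage_isClosed_of_isClosed hK.isClosed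
        (isClosed_tsupport _)
    exact hK.of_isClosed_subset h1 inter_subset_left
  have hK'O : K' ⊆ O := fun x hx => ⟨hKβ hx.1, A.χ_subordinate j hx.2⟩
  have hsymm : ContMDiffOn (𝓡 n) (𝓡 n) ∞ β.symm O :=
    (contMDiffOn_symm_of_mem_maximalAtlas hβ).mono inter_subset_left
  have hψ : ContDiffOn ℝ ∞
      (fun x => ((A.χ j (β.symm x) * (d.dens α (α (β.symm x)))⁻¹ : ℝ) : ℂ)) O := by
    intro x hx
    have h1 := (contMDiffAt_chartTest A d j hx.2).comp_contMDiffWithinAt x (hsymm x hx)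
    exact h1.contDiffWithinAt
  have hτ : ContDiffOn ℝ ∞ (fun x => α (β.symm x)) O := by
    intro x hx
    have h1 := ((contMDiffOn_of_mem_maximalAtlas (A.chart_mem j)).contMDiffAt
      (α.open_source.mem_nhds hx.2)).comp_contMDiffWithinAt x (hsymm x hx)
    exact h1.contDiffWithinAt
  obtain ⟨C, hC0, hC⟩ := exists_iteratedFDeriv_mul_comp_bound hO hK' hK'O hψ hτ i
  refine ⟨C, hC0, fun g x hx => ?_⟩
  by_cases hxs : β.symm x ∈ tsupport (A.χ j)
  · exact hC g x ⟨hx, hxs⟩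
  · have h1 : ((chartTest A d j g : Γ → ℂ) ∘ β.symm) =ᶠ[𝓝 x] fun _ => 0 := by
      have h2 : ∀ᶠ z in 𝓝 x, β.symm z ∉ tsupport (A.χ j) :=
        (β.continuousAt_symm (hKβ hx)).eventually
          ((isClosed_tsupport _).isOpen_compl.mem_nhds hxs)
      filter_upwards [h2] with z hz
      have h3 : A.χ j (β.symm z) = 0 := image_eq_zero_of_notMem_tsupport hz
      simp [chartTest, h3]
    rw [(Filter.EventuallyEq.iteratedFDeriv ℝ h1 i).eq_of_nhds]
    have h4 : iteratedFDeriv ℝ i (fun _ : EuclSp n => (0 : ℂ)) x = 0 := by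
      simp
    rw [h4, norm_zero]
    exact mul_nonneg hC0 (Finset.sum_nonneg fun _ _ => apply_nonneg _ _)

theorem continuous_chartTest [IsManifold (𝓡 n) ∞ Γ] [T2Space Γ] (A : AdaptedAtlas n Γ)
    (d : SmoothDensity n Γ) (j : Fin A.r) : Continuous (chartTest A d j) := by
  refine continuous_iInf_rng.2 fun β => continuous_iInf_rng.2 fun hβ =>
    continuous_iInf_rng.2 fun i => continuous_iInf_rng.2 fun _ => continuous_induced_rng.2 ?_
  refine continuous_iff_continuousAt.2 fun g₀ => ?_
  rw [ContinuousAt, UniformOnFun.tendsto_iff_tendstoUniformlyOn]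
  rintro K ⟨hK, hKβ⟩
  obtain ⟨C, hC0, hC⟩ := exists_chartTest_bound A d j hβ hK hKβ i
  rw [Metric.tendstoUniformlyOn_iff]
  intro ε hε
  have hlim : Tendsto (fun g : 𝓢(EuclSp n, ℂ) => C * ∑ l ∈ Finset.range (i + 1),
      SchwartzMap.seminorm ℝ 0 l (g - g₀)) (𝓝 g₀) (𝓝 0) := by
    have hc : Continuous (fun g : 𝓢(EuclSp n, ℂ) => C * ∑ l ∈ Finset.range (i + 1),
        SchwartzMap.seminorm ℝ 0 l (g - g₀)) := by
      refine continuous_const.mul (continuous_finsetSum _ fun l _ => ?_)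
      exact ((schwartz_withSeminorms ℝ (EuclSp n) ℂ).continuous_seminorm (0, l)).comp
        (continuous_id.sub continuous_const)
    simpa using hc.tendsto g₀
  filter_upwards [hlim.eventually (gt_mem_nhds hε)] with g hg x hx
  refine lt_of_le_of_lt ?_ hg
  refine le_trans (le_of_eq ?_) (hC (g - g₀) x hx)
  have hsm : ∀ f : 𝓢(EuclSp n, ℂ),
      ContDiffAt ℝ i ((chartTest A d j f : Γ → ℂ) ∘ β.symm) x := by
    intro f
    have h1 : ContMDiff (𝓡 n) 𝓘(ℝ, ℂ) ∞ (chartTest A d j f : Γ → ℂ) := (chartTest A d j f).2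
    have h2 : ContMDiffAt (𝓡 n) (𝓡 n) ∞ β.symm x :=
      (contMDiffOn_symm_of_mem_maximalAtlas hβ).contMDiffAt
        (β.open_target.mem_nhds (hKβ hx))
    exact ((h1.contMDiffAt.comp x h2).contDiffAt).of_le (mod_cast le_top)
  have hadd : (chartTest A d j g : Γ → ℂ) ∘ β.symm =
      (chartTest A d j (g - g₀) : Γ → ℂ) ∘ β.symm + (chartTest A d j g₀ : Γ → ℂ) ∘ β.symm := by
    have h1 := chartTest_add A d j (g - g₀) g₀
    rw [sub_add_cancel] at h1
    rw [h1]
    rfl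
  rw [dist_comm, dist_eq_norm]
  change ‖iteratedFDeriv ℝ i ((chartTest A d j g : Γ → ℂ) ∘ β.symm) x -
    iteratedFDeriv ℝ i ((chartTest A d j g₀ : Γ → ℂ) ∘ β.symm) x‖ = _
  rw [hadd, iteratedFDeriv_add_apply (hsm _) (hsm _), add_sub_cancel_right]

/-- The representation `(χ_j h) ∘ α_j` of `χ_j h` in the `j`-th chart `α_j : ℝⁿ ↔ U_j`, a tempered
distribution on `ℝⁿ`.  If `h` is a function, i.e. `h(w) = ∫ h · conj w dx`, this is the function
`x ↦ (χ_j h)(α_j x)`, because `∫ (χ_j h)(α_j x) g(x) dx` over `ℝⁿ` (Lebesgue measure) is the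
integral of `h · χ_j · (g ∘ α_j⁻¹) / (dens ∘ α_j⁻¹)` over `Γ`. -/
def localRep [IsManifold (𝓡 n) ∞ Γ] [T2Space Γ] (A : AdaptedAtlas n Γ) (d : SmoothDensity n Γ)
    (j : Fin A.r) : DistributionOn n Γ →ₗ[ℂ] 𝓢'(EuclSp n, ℂ) where
  toFun h := ContinuousLinearMap.toPointwiseConvergenceCLM ℂ (RingHom.id ℂ) 𝓢(EuclSp n, ℂ) ℂ
    { toFun := fun g => h (chartTest A d j g)
      map_add' := fun g g' => by rw [chartTest_add, map_add]
      map_smul' := fun c g => by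
        rw [chartTest_smul, map_smulₛₗ, Complex.conj_conj, RingHom.id_apply]
      cont := h.continuous.comp (continuous_chartTest A d j) }
  map_add' _ _ := rfl
  map_smul' _ _ := rfl

end LocalRep

/-! ### The refined scale over a manifold -/

section RefinedSpace

variable {n : ℕ} {Γ : Type*} [TopologicalSpace Γ] [ChartedSpace (EuclSp n) Γ]
  [IsManifold (𝓡 n) ∞ Γ] [T2Space Γ] [MeasurableSpace Γ]

/-- The distributions `h ∈ 𝓓'(Γ)` such that `(χ_j h) ∘ α_j ∈ H^{s,φ}(ℝⁿ)` for every `j`. -/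
def refinedSubmoduleOn (A : AdaptedAtlas n Γ) (d : SmoothDensity n Γ) (s : ℝ) (φ : ℝ → ℝ) :
    Submodule ℂ (DistributionOn n Γ) where
  carrier := {h | ∀ j, localRep A d j h ∈ refinedSubmodule n s φ}
  zero_mem' := fun j => by rw [map_zero]; exact Submodule.zero_mem _
  add_mem' := fun hf hg j => by rw [map_add]; exact Submodule.add_mem _ (hf j) (hg j)
  smul_mem' := fun c _ hf j => by rw [map_smul]; exact Submodule.smul_mem _ c (hf j)

/-- The space `H^{s,φ}(Γ)`; it is a copy of `refinedSubmoduleOn` that carries its own norm instead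
of the topology of distributions. -/
def RefinedSpaceOn (A : AdaptedAtlas n Γ) (d : SmoothDensity n Γ) (s : ℝ) (φ : ℝ → ℝ) : Type _ :=
  refinedSubmoduleOn A d s φ

namespace RefinedSpaceOn

variable {A : AdaptedAtlas n Γ} {d : SmoothDensity n Γ} {s : ℝ} {φ : ℝ → ℝ}

instance : AddCommGroup (RefinedSpaceOn A d s φ) :=
  inferInstanceAs (AddCommGroup (refinedSubmoduleOn A d s φ))

instance : Module ℂ (RefinedSpaceOn A d s φ) :=
  inferInstanceAs (Module ℂ (refinedSubmoduleOn A d s φ))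

/-- The underlying distribution of an element of `H^{s,φ}(Γ)`. -/
def toDistribution (h : RefinedSpaceOn A d s φ) : DistributionOn n Γ := h.1

variable (A d s φ) in
/-- The linear map which sends `h` to the family of the functions
`⟨ξ⟩^s φ(⟨ξ⟩) û_j(ξ)`, `u_j = (χ_j h) ∘ α_j`, in the Hilbert sum of `r` copies of `L₂(ℝⁿ)`. -/
def toL2 : RefinedSpaceOn A d s φ →ₗ[ℂ]
    PiLp 2 (fun _ : Fin A.r => Lp ℂ 2 (volume : Measure (EuclSp n))) where
  toFun h := WithLp.toLp 2 fun j => weightedFourier n s φ ⟨localRep A d j h.1, h.2 j⟩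
  map_add' f g := by
    ext1 j
    exact ((weightedFourier n s φ).map_add ⟨localRep A d j f.1, f.2 j⟩
      ⟨localRep A d j g.1, g.2 j⟩ :)
  map_smul' c f := by
    ext1 j
    exact ((weightedFourier n s φ).map_smul c ⟨localRep A d j f.1, f.2 j⟩ :)

/-- The norm of `H^{s,φ}(Γ)`: its square is the sum over `j` of the squares of the norms of
`(χ_j h) ∘ α_j` in `H^{s,φ}(ℝⁿ)`. -/
instance : SeminormedAddCommGroup (RefinedSpaceOn A d s φ) :=
  SeminormedAddCommGroup.induced _ _ (toL2 A d s φ)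

/-- The inner product of `H^{s,φ}(Γ)`: the sum over `j` of the inner products of `(χ_j f) ∘ α_j` and
`(χ_j g) ∘ α_j` in `H^{s,φ}(ℝⁿ)`. -/
instance : InnerProductSpace ℂ (RefinedSpaceOn A d s φ) where
  norm_smul_le c f := by
    change ‖toL2 A d s φ (c • f)‖ ≤ ‖c‖ * ‖toL2 A d s φ f‖
    rw [map_smul, norm_smul]
  inner f g := inner ℂ (toL2 A d s φ f) (toL2 A d s φ g)
  norm_sq_eq_re_inner f := norm_sq_eq_re_inner (𝕜 := ℂ) (toL2 A d s φ f)
  conj_inner_symm f g := inner_conj_symm (toL2 A d s φ f) (toL2 A d s φ g)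
  add_left f g h := by rw [map_add, inner_add_left]
  smul_left f g c := by rw [map_smul, inner_smul_left]

/-- The map `T : H^{s,φ}(Γ) → C^k(Γ)` is the natural inclusion: for every `h`, the function `T h`
is `h`, i.e. `h(w) = ∫ (T h) · conj w dx` for all `w ∈ C^∞(Γ)`. -/
def IsInclusion {k : ℕ∞} (T : RefinedSpaceOn A d s φ → CkSpace n Γ k) : Prop :=
  ∀ (h : RefinedSpaceOn A d s φ) (w : CkSpace n Γ ⊤),
    h.toDistribution w = ∫ x, T h x * conj (w x) ∂d.measure

end RefinedSpaceOn

end RefinedSpace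

end

/-! A slowly varying function changes by at most a bounded factor on each block `[2^m, 2^(m+1))`, so
the integral condition says that `∑ φ(2^m)^(-2)` converges (`lintegral_lt_top_iff_tsum`). Both
implications are proved for this series.

Sufficiency. The exponent `ρ + n/2` is the borderline of the Sobolev embedding: the square of
`⟨ξ⟩^ρ` divided by the weight is `⟨ξ⟩^(-n) φ(⟨ξ⟩)^(-2)`, whose integral over the `m`-th dyadic shell
is at most a constant times `φ(2^m)^(-2)`. If the series converges, this quotient is in `L₂`. By
Cauchy–Schwarz `|ξ|^k û` is then integrable for `k ≤ ρ`, and Fourier inversion produces a `C^ρ`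
function. On `Γ` the pieces `χ_j h` are put back by means of cutoffs equal to one on the supports of
the `χ_j` (`synthesisOn`). A derivative of a piece at a point is an `L₂` pairing with a vector that
depends norm-continuously on the point. Hence synthesis is continuous into `C^ρ` even for the weak
topology on bounded sets (`continuous_synthesisOn_of_weak`). This gives continuity of the inclusion
and, since balls are weakly compact, its compactness.

Necessity. Suppose that the series diverges, with partial sums `σ_M`. Take a bump `ψ` whose `ρ`-th
derivative at the origin is nonzero, and place the sums `∑_{m<M} b_m ψ(2^m (x - x₀))` in a chart,
with `b_m = 2^(-mρ) φ(2^m)^(-2) / σ_M`. Their `ρ`-th derivative at `x₀` is that of `ψ` at the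
origin, whatever `M` is. The bumps are almost orthogonal: the squared norm of the sum is `O(∑ (b_m
2^(mρ) φ(2^m))^2) = O(1/σ_M)` (`exists_dyadic_sum_bound`, `exists_refinedSpaceOn_dyadic`). It tends
to zero, which contradicts continuity. Almost orthogonality rests on Potter's bounds for `φ`, on
Plancherel's formula for the derivatives of each bump, and on a Cauchy–Schwarz inequality with
weights that grow with the distance between the scales `2^m` and `⟨ξ⟩`.

A continuous function is determined by its distribution, so every inclusion is the synthesis map. A
continuous inclusion forces the series to converge by necessity, and is therefore compact. -/

/-! ### Slowly varying functions -/

/-- The uniform convergence theorem of Karamata's theory, in additive form. -/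
theorem eventually_forall_Icc_abs_sub_lt {f : ℝ → ℝ} (hf : Measurable f)
    (h : ∀ u, Tendsto (fun x => f (x + u) - f x) atTop (𝓝 0)) {ε : ℝ} (hε : 0 < ε) :
    ∀ᶠ x in atTop, ∀ u ∈ Icc (0 : ℝ) 1, |f (x + u) - f x| < ε := by
  by_contra hcon
  obtain ⟨x, hx, hxu⟩ := exists_seq_forall_of_frequently (not_eventually.1 hcon)
  push Not at hxu
  choose u hu hfu using hxu
  have hxu' : Tendsto (fun k => x k + u k) atTop atTop :=
    tendsto_atTop_mono (fun k => le_add_of_nonneg_right (hu k).1) hx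
  -- Pointwise convergence on a space of finite measure implies convergence in measure, so along any
  -- sequence tending to infinity the set of bad shifts becomes small. This is used for `x k` and
  -- for `x k + u k`.
  have key : ∀ y : ℕ → ℝ, Tendsto y atTop atTop →
      ∀ᶠ k in atTop, volume {v ∈ Icc (0 : ℝ) 2 | ε / 2 ≤ |f (y k + v) - f (y k)|} <
        ENNReal.ofReal (1 / 2) := by
    intro y hy
    have h1 : TendstoInMeasure (volume.restrict (Icc (0 : ℝ) 2))
        (fun k v => f (y k + v) - f (y k)) atTop (fun _ => (0 : ℝ)) := by
      refine tendstoInMeasure_of_tendsto_ae (fun k => ?_) (ae_of_all _ fun v => (h v).comp hy)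
      exact ((hf.comp (measurable_const_add _)).sub_const _).aestronglyMeasurable
    have h2 := (tendstoInMeasure_iff_norm.1 h1) (ε / 2) (by positivity)
    filter_upwards [h2.eventually (gt_mem_nhds (show (0 : ENNReal) < ENNReal.ofReal (1 / 2) by
      simp))] with k hk
    refine lt_of_le_of_lt ?_ hk
    refine le_trans (measure_mono ?_) (Measure.le_restrict_apply _ _)
    rintro v ⟨hv, hv'⟩
    exact ⟨by simpa using hv', hv⟩
  obtain ⟨k, hk1, hk2⟩ := ((key x hx).and (key _ hxu')).exists
  -- If `v` were a good shift for `x k` and `v - u k` a good one for `x k + u k`, the triangle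
  -- inequality through `f (x k + v)` would contradict the choice of `u k`. Hence two sets of
  -- measure less than `1 / 2` would cover an interval of length one.
  have hsub : Icc (1 : ℝ) 2 ⊆ {v ∈ Icc (0 : ℝ) 2 | ε / 2 ≤ |f (x k + v) - f (x k)|} ∪
      (fun v => v - u k) ⁻¹'
        {v ∈ Icc (0 : ℝ) 2 | ε / 2 ≤ |f (x k + u k + v) - f (x k + u k)|} := by
    intro v hv
    have huk := hu k
    by_contra hv'
    simp only [mem_union, mem_preimage, mem_ofPred_eq, mem_Icc, not_or, not_and, not_le] at hv'
    have h1 := hv'.1 ⟨by linarith [hv.1], hv.2⟩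
    have h2 := hv'.2 ⟨by linarith [hv.1, huk.2], by linarith [hv.2, huk.1]⟩
    rw [show x k + u k + (v - u k) = x k + v by ring] at h2
    have h3 := hfu k
    rw [abs_lt] at h1 h2
    rcases le_abs.1 h3 with h | h <;> linarith
  have hvol := (measure_mono hsub (μ := volume)).trans (measure_union_le _ _)
  have htr : volume ((fun v => v - u k) ⁻¹'
        {v ∈ Icc (0 : ℝ) 2 | ε / 2 ≤ |f (x k + u k + v) - f (x k + u k)|}) =
      volume {v ∈ Icc (0 : ℝ) 2 | ε / 2 ≤ |f (x k + u k + v) - f (x k + u k)|} := by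
    simp only [sub_eq_add_neg]
    exact measure_preimage_add_right _ _ _
  rw [htr, Real.volume_Icc] at hvol
  have h4 := hvol.trans_lt (ENNReal.add_lt_add hk1 hk2)
  rw [← ENNReal.ofReal_add (by norm_num) (by norm_num)] at h4
  norm_num at h4

namespace SlowlyVaryingClass

variable {φ : ℝ → ℝ}

theorem inv (hφ : SlowlyVaryingClass φ) : SlowlyVaryingClass fun t => (φ t)⁻¹ where
  measurable := hφ.measurable.inv
  pos t ht := inv_pos.2 (hφ.pos t ht)
  bounded b hb := by simpa using hφ.bounded_inv b hb
  bounded_inv b hb := by simpa using hφ.bounded b hb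
  slowlyVarying c hc := by
    have h := (hφ.slowlyVarying c hc).inv₀ one_ne_zero
    simpa [div_eq_mul_inv, mul_comm] using h

theorem measurable_comp (hφ : SlowlyVaryingClass φ) {α : Type*} [MeasurableSpace α] {f : α → ℝ}
    (hf : Measurable f) (h1 : ∀ x, 1 ≤ f x) : Measurable fun x => φ (f x) :=
  hφ.measurable.comp (hf.subtype_mk (p := fun t => t ∈ Ici (1 : ℝ)) (h := h1))

/-- Uniform convergence applied to `log ∘ φ ∘ exp`, for which dilations become translations; `log c
≤ c - 1 ≤ 1` keeps the translations in `[0, 1]`. -/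
theorem eventually_le_mul (hφ : SlowlyVaryingClass φ) {q : ℝ} (hq : 1 < q) :
    ∃ X, 1 ≤ X ∧ ∀ t, X ≤ t → ∀ c ∈ Icc (1 : ℝ) 2, φ (c * t) ≤ q * φ t := by
  -- The truncation keeps the argument of `φ` in `[1, ∞)`, the only set on which `φ` is known to be
  -- measurable and positive.
  set f : ℝ → ℝ := fun x => Real.log (φ (Real.exp (max x 0)))
  have hf : Measurable f := Real.measurable_log.comp
    (hφ.measurable_comp (by fun_prop) fun x => Real.one_le_exp (le_max_right _ _))
  have hlim : ∀ u, Tendsto (fun x => f (x + u) - f x) atTop (𝓝 0) := by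
    intro u
    have h1 := (hφ.slowlyVarying (Real.exp u) (Real.exp_pos u)).comp Real.tendsto_exp_atTop
    have h2 := (Real.continuousAt_log one_ne_zero).tendsto.comp h1
    rw [Real.log_one] at h2
    refine h2.congr' ?_
    filter_upwards [eventually_ge_atTop 0, eventually_ge_atTop (-u)] with x hx hx'
    have hxu : 0 ≤ x + u := by linarith
    simp only [Function.comp, f, max_eq_left hx, max_eq_left hxu]
    rw [← Real.exp_add, add_comm u x, Real.log_div
      (hφ.pos _ (Real.one_le_exp hxu)).ne' (hφ.pos _ (Real.one_le_exp hx)).ne']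
  obtain ⟨X, hX⟩ := eventually_atTop.1
    (eventually_forall_Icc_abs_sub_lt hf hlim (Real.log_pos hq))
  refine ⟨Real.exp (max X 0), Real.one_le_exp (le_max_right _ _), fun t ht c hc => ?_⟩
  have ht0 : 0 < t := (Real.exp_pos _).trans_le ht
  have hc0 : 0 < c := by linarith [hc.1]
  have hlt : max X 0 ≤ Real.log t := (Real.le_log_iff_exp_le ht0).2 ht
  have hlc : 0 ≤ Real.log c := Real.log_nonneg hc.1
  have hlc1 : Real.log c ≤ 1 := by
    have := Real.log_le_sub_one_of_pos hc0
    linarith [hc.2]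
  have h := hX _ ((le_max_left _ _).trans hlt) _ ⟨hlc, hlc1⟩
  have hlt0 : 0 ≤ Real.log t := (le_max_right _ _).trans hlt
  simp only [f, max_eq_left hlt0, max_eq_left (add_nonneg hlt0 hlc)] at h
  rw [Real.exp_add, Real.exp_log ht0, Real.exp_log hc0, mul_comm t c] at h
  have ht1 : 1 ≤ t := (Real.one_le_exp (le_max_right _ _)).trans ht
  have p1 := hφ.pos t ht1
  have p2 := hφ.pos (c * t) (by nlinarith [hc.1])
  have h3 : Real.log (φ (c * t)) ≤ Real.log (q * φ t) := by
    rw [Real.log_mul (by positivity) p1.ne']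
    linarith [(abs_lt.1 h).2]
  exact (Real.log_le_log_iff p2 (by positivity)).1 h3

theorem exists_le_mul (hφ : SlowlyVaryingClass φ) :
    ∃ C, 1 ≤ C ∧ ∀ t, 1 ≤ t → ∀ c ∈ Icc (1 : ℝ) 2, φ (c * t) ≤ C * φ t := by
  obtain ⟨X, hX1, hX⟩ := hφ.eventually_le_mul one_lt_two
  -- For `t ≤ X` both `t` and `c * t` stay in `[1, 2 * X]`, where the local bounds on `φ` and `1 /
  -- φ` apply.
  obtain ⟨B, hB⟩ := hφ.bounded (2 * X) (by linarith)
  obtain ⟨D, hD⟩ := hφ.bounded_inv (2 * X) (by linarith)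
  refine ⟨max 2 (B * D), le_max_of_le_left one_le_two, fun t ht c hc => ?_⟩
  have p1 := hφ.pos t ht
  rcases le_total X t with h | h
  · exact (hX t h c hc).trans (by gcongr; exact le_max_left _ _)
  · have h1 := hB (c * t) ⟨by nlinarith [hc.1], by nlinarith [hc.1, hc.2]⟩
    have h2 := hD t ⟨ht, by linarith⟩
    have p2 := hφ.pos (c * t) (by nlinarith [hc.1])
    rw [div_le_iff₀ p1] at h2
    calc φ (c * t) ≤ B * 1 := by linarith
      _ ≤ B * (D * φ t) := by gcongr; linarith
      _ = B * D * φ t := by ring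
      _ ≤ _ := by gcongr; exact le_max_right _ _

/-- A doubling costs the factor `q` beyond `X` and the factor `C` before it. As `X < 2 ^ K`, at most
`K` doublings are of the second kind, whatever `t` and `k` are. -/
theorem exists_le_mul_pow (hφ : SlowlyVaryingClass φ) {q : ℝ} (hq : 1 < q) :
    ∃ C, 1 ≤ C ∧ ∀ t, 1 ≤ t → ∀ k : ℕ, φ (2 ^ k * t) ≤ C * q ^ k * φ t := by
  obtain ⟨X, hX1, hX⟩ := hφ.eventually_le_mul hq
  obtain ⟨C, hC1, hC⟩ := hφ.exists_le_mul
  obtain ⟨K, hK⟩ := pow_unbounded_of_one_lt X one_lt_two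
  refine ⟨C ^ K, one_le_pow₀ hC1, fun t ht k => ?_⟩
  -- The exponent `min k K` counts the expensive doublings and stops growing once `2 ^ k * t` is
  -- certain to exceed `X`.
  have h : φ (2 ^ k * t) ≤ C ^ (min k K) * q ^ k * φ t := by
    induction k with
    | zero => simp
    | succ k ih =>
      have h1 : (1 : ℝ) ≤ 2 ^ k * t := by
        have : (1 : ℝ) ≤ 2 ^ k := one_le_pow₀ one_le_two
        nlinarith
      have p1 := hφ.pos t ht
      rw [pow_succ', mul_assoc]
      rcases lt_or_ge k K with hkK | hkK
      · calc φ (2 * (2 ^ k * t)) ≤ C * φ (2 ^ k * t) := hC _ h1 2 ⟨one_le_two, le_rfl⟩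
          _ ≤ C * (C ^ (min k K) * q ^ k * φ t) := by gcongr
          _ = C ^ (min (k + 1) K) * (1 * q ^ k) * φ t := by
            rw [min_eq_left hkK.le, min_eq_left (by omega : k + 1 ≤ K), pow_succ]; ring
          _ ≤ C ^ (min (k + 1) K) * (q * q ^ k) * φ t := by gcongr
          _ = _ := by rw [pow_succ']
      · have h2 : X ≤ 2 ^ k * t := by
          have h3 : (2 : ℝ) ^ K ≤ 2 ^ k := pow_le_pow_right₀ one_le_two hkK
          have : (2 : ℝ) ^ k ≤ 2 ^ k * t := le_mul_of_one_le_right (by positivity) ht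
          linarith
        calc φ (2 * (2 ^ k * t)) ≤ q * φ (2 ^ k * t) := hX _ h2 2 ⟨one_le_two, le_rfl⟩
          _ ≤ q * (C ^ (min k K) * q ^ k * φ t) := by gcongr
          _ = _ := by
            rw [min_eq_right hkK, min_eq_right (by omega : K ≤ k + 1), pow_succ]; ring
  have p1 := hφ.pos t ht
  refine h.trans ?_
  gcongr
  exact min_le_right _ _

/-- Write `y / x = c * 2 ^ k` with `c ∈ [1, 2]` and take `2 ^ ε` as the price of a doubling: `k`
doublings cost `(2 ^ k) ^ ε ≤ (y / x) ^ ε`. -/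
theorem exists_le_mul_rpow (hφ : SlowlyVaryingClass φ) {ε : ℝ} (hε : 0 < ε) :
    ∃ C, 1 ≤ C ∧ ∀ x y, 1 ≤ x → x ≤ y → φ y ≤ C * (y / x) ^ ε * φ x := by
  obtain ⟨C, hC1, hC⟩ := hφ.exists_le_mul
  obtain ⟨D, hD1, hD⟩ := hφ.exists_le_mul_pow (Real.one_lt_rpow one_lt_two hε)
  refine ⟨C * D, by nlinarith, fun x y hx hxy => ?_⟩
  have hx0 : 0 < x := by linarith
  have p1 := hφ.pos x hx
  obtain ⟨k, hk1, hk2⟩ := exists_nat_pow_near ((one_le_div hx0).2 hxy) one_lt_two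
  have h2k : (1 : ℝ) ≤ 2 ^ k := one_le_pow₀ one_le_two
  have hc : y / x / 2 ^ k ∈ Icc (1 : ℝ) 2 := by
    refine ⟨(one_le_div (by positivity)).2 hk1, (div_le_iff₀ (by positivity)).2 ?_⟩
    rw [pow_succ'] at hk2
    exact hk2.le
  have h1 := hC (2 ^ k * x) (by nlinarith) _ hc
  rw [show y / x / 2 ^ k * (2 ^ k * x) = y by field_simp] at h1
  calc φ y ≤ C * φ (2 ^ k * x) := h1
    _ ≤ C * (D * ((2 : ℝ) ^ ε) ^ k * φ x) := by gcongr; exact hD x hx k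
    _ = C * D * ((2 : ℝ) ^ k) ^ ε * φ x := by
      rw [← Real.rpow_natCast, ← Real.rpow_natCast, ← Real.rpow_mul (by norm_num),
        ← Real.rpow_mul (by norm_num), mul_comm ε]
      ring
    _ ≤ _ := by gcongr

/-- Potter's bounds. -/
theorem potter (hφ : SlowlyVaryingClass φ) {ε : ℝ} (hε : 0 < ε) :
    ∃ C, 1 ≤ C ∧ ∀ x y, 1 ≤ x → 1 ≤ y → φ y ≤ C * ((y / x) ^ ε + (x / y) ^ ε) * φ x := by
  obtain ⟨C, hC1, hC⟩ := hφ.exists_le_mul_rpow hε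
  obtain ⟨D, hD1, hD⟩ := hφ.inv.exists_le_mul_rpow hε
  refine ⟨max C D, le_max_of_le_left hC1, fun x y hx hy => ?_⟩
  have px := hφ.pos x hx
  have py := hφ.pos y hy
  rcases le_total x y with h | h
  · refine (hC x y hx h).trans ?_
    gcongr
    · exact le_max_left _ _
    · exact le_add_of_nonneg_right (by positivity)
  · have h1 := hD y x hy h
    rw [← div_eq_mul_inv, le_div_iff₀ py, inv_mul_le_iff₀ px] at h1
    rw [mul_comm (φ x)] at h1
    refine h1.trans ?_
    gcongr
    · exact le_max_right _ _
    · exact le_add_of_nonneg_left (by positivity)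

/-- On dyadic blocks a function of the class is comparable with its value at the left endpoint. -/
theorem exists_dyadic_comparable (hφ : SlowlyVaryingClass φ) :
    ∃ C, 1 ≤ C ∧ ∀ m : ℕ, ∀ t ∈ Ico ((2 : ℝ) ^ m) (2 ^ (m + 1)),
      φ t ≤ C * φ (2 ^ m) ∧ φ (2 ^ m) ≤ C * φ t := by
  obtain ⟨C, hC1, hC⟩ := hφ.exists_le_mul
  obtain ⟨D, hD1, hD⟩ := hφ.inv.exists_le_mul
  refine ⟨max C D, le_max_of_le_left hC1, fun m t ht => ?_⟩
  have h2m : (1 : ℝ) ≤ 2 ^ m := one_le_pow₀ one_le_two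
  have hc : t / 2 ^ m ∈ Icc (1 : ℝ) 2 := by
    refine ⟨(one_le_div (by positivity)).2 ht.1, (div_le_iff₀ (by positivity)).2 ?_⟩
    rw [← pow_succ']
    exact ht.2.le
  have ht1 : 1 ≤ t := h2m.trans ht.1
  have p1 := hφ.pos _ h2m
  have p2 := hφ.pos _ ht1
  have h1 := hC _ h2m _ hc
  have h2 := hD _ h2m _ hc
  rw [div_mul_cancel₀ _ (by positivity)] at h1 h2
  rw [← div_eq_mul_inv, le_div_iff₀ p1, inv_mul_le_iff₀ p2, mul_comm (φ t)] at h2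
  exact ⟨h1.trans (by gcongr; exact le_max_left _ _), h2.trans (by gcongr; exact le_max_right _ _)⟩

end SlowlyVaryingClass

/-! ### Dyadic blocks and the series form of the integral condition -/

theorem iUnion_Ico_two_pow : ⋃ m : ℕ, Ico ((2 : ℝ) ^ m) (2 ^ (m + 1)) = Ici 1 := by
  ext t
  simp only [mem_iUnion, mem_Ici]
  constructor
  · rintro ⟨m, hm⟩
    exact (one_le_pow₀ one_le_two).trans hm.1
  · intro ht
    obtain ⟨k, hk⟩ := exists_nat_pow_near ht one_lt_two
    exact ⟨k, hk⟩

theorem pairwise_disjoint_Ico_two_pow :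
    Pairwise (Function.onFun Disjoint fun m : ℕ => Ico ((2 : ℝ) ^ m) (2 ^ (m + 1))) :=
  (pow_right_mono₀ one_le_two).pairwise_disjoint_on_Ico_succ

namespace SlowlyVaryingClass

variable {φ : ℝ → ℝ}

/-- The integral criterion is equivalent to the convergence of the series `∑ φ(2^m)^{-2}`. -/
theorem lintegral_lt_top_iff_tsum (hφ : SlowlyVaryingClass φ) :
    (∫⁻ t in Ici (1 : ℝ), ENNReal.ofReal (1 / (t * φ t ^ 2)) < ⊤) ↔
      ∑' m : ℕ, ENNReal.ofReal (1 / φ (2 ^ m) ^ 2) < ⊤ := by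
  obtain ⟨C, hC1, hC⟩ := hφ.exists_dyadic_comparable
  have hsplit : ∫⁻ t in Ici (1 : ℝ), ENNReal.ofReal (1 / (t * φ t ^ 2)) =
      ∑' m : ℕ, ∫⁻ t in Ico ((2 : ℝ) ^ m) (2 ^ (m + 1)), ENNReal.ofReal (1 / (t * φ t ^ 2)) := by
    rw [← iUnion_Ico_two_pow]
    exact lintegral_iUnion (fun m => measurableSet_Ico) pairwise_disjoint_Ico_two_pow _
  have hvol : ∀ m : ℕ, volume (Ico ((2 : ℝ) ^ m) (2 ^ (m + 1))) = ENNReal.ofReal (2 ^ m) := by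
    intro m
    rw [Real.volume_Ico, pow_succ']
    congr 1
    ring
  -- On the block, `t` is comparable with the length `2 ^ m` of the block and `φ t` with `φ (2 ^
  -- m)`, so the integral is `φ(2^m)^(-2)` up to constants; `hup` and `hlow` are the two halves.
  have hup : ∀ m : ℕ, ∫⁻ t in Ico ((2 : ℝ) ^ m) (2 ^ (m + 1)),
      ENNReal.ofReal (1 / (t * φ t ^ 2)) ≤
        ENNReal.ofReal (C ^ 2) * ENNReal.ofReal (1 / φ (2 ^ m) ^ 2) := by
    intro m
    have pm := hφ.pos _ (one_le_pow₀ one_le_two : (1 : ℝ) ≤ 2 ^ m)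
    calc _ ≤ ∫⁻ _ in Ico ((2 : ℝ) ^ m) (2 ^ (m + 1)),
          ENNReal.ofReal (1 / (2 ^ m * (φ (2 ^ m) / C) ^ 2)) := by
          refine setLIntegral_mono' measurableSet_Ico fun t ht => ENNReal.ofReal_le_ofReal ?_
          have ht0 : (0 : ℝ) ≤ t := le_trans (by positivity) ht.1
          gcongr
          · exact ht.1
          · rw [div_le_iff₀ (by positivity), mul_comm]
            exact (hC m t ht).2
      _ = _ := by
          rw [setLIntegral_const, hvol, ← ENNReal.ofReal_mul (by positivity),
            ← ENNReal.ofReal_mul (by positivity)]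
          congr 1
          field_simp
  have hlow : ∀ m : ℕ, ENNReal.ofReal (1 / φ (2 ^ m) ^ 2) ≤ ENNReal.ofReal (2 * C ^ 2) *
      ∫⁻ t in Ico ((2 : ℝ) ^ m) (2 ^ (m + 1)), ENNReal.ofReal (1 / (t * φ t ^ 2)) := by
    intro m
    have pm := hφ.pos _ (one_le_pow₀ one_le_two : (1 : ℝ) ≤ 2 ^ m)
    calc _ = ENNReal.ofReal (2 * C ^ 2) * ∫⁻ _ in Ico ((2 : ℝ) ^ m) (2 ^ (m + 1)),
          ENNReal.ofReal (1 / (2 ^ (m + 1) * (C * φ (2 ^ m)) ^ 2)) := by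
          rw [setLIntegral_const, hvol, ← ENNReal.ofReal_mul (by positivity),
            ← ENNReal.ofReal_mul (by positivity)]
          congr 1
          field_simp
          ring
      _ ≤ _ := by
          refine mul_le_mul_right ?_ _
          refine setLIntegral_mono' measurableSet_Ico fun t ht => ENNReal.ofReal_le_ofReal ?_
          have ht1 : 1 ≤ t := (one_le_pow₀ one_le_two : (1 : ℝ) ≤ 2 ^ m).trans ht.1
          have pt := hφ.pos t ht1
          gcongr
          · exact ht.2.le
          · exact (hC m t ht).1
  rw [hsplit]
  constructor
  · intro h
    refine (ENNReal.tsum_le_tsum hlow).trans_lt ?_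
    rw [ENNReal.tsum_mul_left]
    exact ENNReal.mul_lt_top ENNReal.ofReal_lt_top h
  · intro h
    refine (ENNReal.tsum_le_tsum hup).trans_lt ?_
    rw [ENNReal.tsum_mul_left]
    exact ENNReal.mul_lt_top ENNReal.ofReal_lt_top h

end SlowlyVaryingClass

/-! ### The weight -/

section Weight

variable {n : ℕ}

theorem one_le_japaneseBracket (ξ : EuclSp n) : 1 ≤ japaneseBracket ξ :=
  Real.one_le_sqrt.2 (by nlinarith [sq_nonneg ‖ξ‖])

theorem japaneseBracket_pos (ξ : EuclSp n) : 0 < japaneseBracket ξ :=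
  one_pos.trans_le (one_le_japaneseBracket ξ)

theorem norm_le_japaneseBracket (ξ : EuclSp n) : ‖ξ‖ ≤ japaneseBracket ξ :=
  Real.le_sqrt_of_sq_le (by linarith)

theorem japaneseBracket_sq (ξ : EuclSp n) : japaneseBracket ξ ^ 2 = 1 + ‖ξ‖ ^ 2 :=
  Real.sq_sqrt (by positivity)

theorem continuous_japaneseBracket : Continuous (japaneseBracket : EuclSp n → ℝ) := by
  unfold japaneseBracket
  fun_prop

theorem SlowlyVaryingClass.measurable_refinedWeight {φ : ℝ → ℝ} (hφ : SlowlyVaryingClass φ)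
    (s : ℝ) : Measurable (refinedWeight s φ : EuclSp n → ℝ) :=
  (continuous_japaneseBracket.measurable.pow_const s).mul
    (hφ.measurable_comp continuous_japaneseBracket.measurable one_le_japaneseBracket)

theorem SlowlyVaryingClass.refinedWeight_pos {φ : ℝ → ℝ} (hφ : SlowlyVaryingClass φ)
    (s : ℝ) (ξ : EuclSp n) : 0 < refinedWeight s φ ξ :=
  mul_pos (Real.rpow_pos_of_pos (japaneseBracket_pos ξ) s)
    (hφ.pos _ (one_le_japaneseBracket ξ))

/-- If `∑ φ(2^m)^{-2}` converges, then `⟨ξ⟩^{-n/2} / φ(⟨ξ⟩)` is square integrable over `ℝⁿ`. -/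
theorem SlowlyVaryingClass.memLp_pow_div_refinedWeight {φ : ℝ → ℝ} (hφ : SlowlyVaryingClass φ)
    (hsum : ∑' m : ℕ, ENNReal.ofReal (1 / φ (2 ^ m) ^ 2) < ⊤) (ρ : ℕ) :
    MemLp (fun ξ : EuclSp n => japaneseBracket ξ ^ ρ / refinedWeight ((ρ : ℝ) + (n : ℝ) / 2) φ ξ)
      2 volume := by
  have hmeas : Measurable (fun ξ : EuclSp n =>
      japaneseBracket ξ ^ ρ / refinedWeight ((ρ : ℝ) + (n : ℝ) / 2) φ ξ) :=
    (continuous_japaneseBracket.measurable.pow_const ρ).div (hφ.measurable_refinedWeight _)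
  rw [memLp_two_iff_integrable_sq hmeas.aestronglyMeasurable]
  -- The surplus `n / 2` in the exponent leaves exactly `⟨ξ⟩^(-n)`, the critical power in dimension
  -- `n`, so that integrability is decided by `φ` alone.
  have hval : ∀ ξ : EuclSp n,
      (japaneseBracket ξ ^ ρ / refinedWeight ((ρ : ℝ) + (n : ℝ) / 2) φ ξ) ^ 2 =
        1 / (japaneseBracket ξ ^ n * φ (japaneseBracket ξ) ^ 2) := by
    intro ξ
    have h0 := japaneseBracket_pos ξ
    have h1 := hφ.pos _ (one_le_japaneseBracket ξ)
    have h2 : (japaneseBracket ξ ^ ((n : ℝ) / 2)) ^ 2 = japaneseBracket ξ ^ n := by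
      rw [← Real.rpow_natCast, ← Real.rpow_mul h0.le, ← Real.rpow_natCast]
      congr 1
      push_cast
      ring
    rw [refinedWeight, Real.rpow_add h0, Real.rpow_natCast, div_pow, mul_pow, mul_pow, h2]
    field_simp
  simp_rw [hval]
  refine ⟨(hmeas.pow_const 2).aestronglyMeasurable.congr (ae_of_all _ hval), ?_⟩
  rw [hasFiniteIntegral_iff_ofReal (ae_of_all _ fun ξ => by
    have := japaneseBracket_pos ξ
    positivity)]
  obtain ⟨C, hC1, hC⟩ := hφ.exists_dyadic_comparable
  set B : ℕ → Set (EuclSp n) := fun m => japaneseBracket ⁻¹' Ico ((2 : ℝ) ^ m) (2 ^ (m + 1))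
  have hBm : ∀ m, MeasurableSet (B m) := fun m =>
    continuous_japaneseBracket.measurable measurableSet_Ico
  have hBu : ⋃ m, B m = univ := by
    rw [← preimage_iUnion, iUnion_Ico_two_pow]
    exact eq_univ_of_forall one_le_japaneseBracket
  have hBd : Pairwise (Function.onFun Disjoint B) := fun i j hij =>
    (pairwise_disjoint_Ico_two_pow hij).preimage _
  rw [← setLIntegral_univ, ← hBu, lintegral_iUnion hBm hBd]
  -- The shell lies in a ball of radius `2 ^ (m + 1)`; its volume cancels `(2 ^ m) ^ n` up to the
  -- factor `2 ^ n` and the volume of the unit ball.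
  have hblock : ∀ m, ∫⁻ ξ in B m,
      ENNReal.ofReal (1 / (japaneseBracket ξ ^ n * φ (japaneseBracket ξ) ^ 2)) ≤
        ENNReal.ofReal (2 ^ n * C ^ 2) * volume (Metric.ball (0 : EuclSp n) 1) *
          ENNReal.ofReal (1 / φ (2 ^ m) ^ 2) := by
    intro m
    have pm := hφ.pos _ (one_le_pow₀ one_le_two : (1 : ℝ) ≤ 2 ^ m)
    calc _ ≤ ∫⁻ _ in B m, ENNReal.ofReal (1 / ((2 ^ m) ^ n * (φ (2 ^ m) / C) ^ 2)) := by
          refine setLIntegral_mono' (hBm m) fun ξ hξ => ENNReal.ofReal_le_ofReal ?_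
          have h0 := (japaneseBracket_pos ξ).le
          gcongr
          · exact hξ.1
          · rw [div_le_iff₀ (by positivity), mul_comm]
            exact (hC m _ hξ).2
      _ ≤ ENNReal.ofReal (1 / ((2 ^ m) ^ n * (φ (2 ^ m) / C) ^ 2)) *
          (ENNReal.ofReal ((2 ^ (m + 1)) ^ n) * volume (Metric.ball (0 : EuclSp n) 1)) := by
          rw [setLIntegral_const]
          refine mul_le_mul_right ?_ _
          have h1 : B m ⊆ Metric.ball 0 (2 ^ (m + 1)) := fun ξ hξ => by
            rw [mem_ball_zero_iff]
            exact (norm_le_japaneseBracket ξ).trans_lt hξ.2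
          refine (measure_mono h1).trans ?_
          rw [Measure.addHaar_ball_of_pos _ _ (by positivity), finrank_euclideanSpace_fin]
      _ = _ := by
          rw [← mul_assoc, ← ENNReal.ofReal_mul (by positivity), mul_right_comm,
            ← ENNReal.ofReal_mul (by positivity)]
          congr 2
          rw [pow_succ (2 : ℝ) m, mul_pow]
          field_simp
  refine (ENNReal.tsum_le_tsum hblock).trans_lt ?_
  rw [ENNReal.tsum_mul_left]
  exact ENNReal.mul_lt_top (ENNReal.mul_lt_top ENNReal.ofReal_lt_top measure_ball_lt_top) hsum

end Weight

/-! ### Compactly supported functions are dense in the Schwartz space -/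

theorem norm_iteratedFDeriv_comp_smul {E F : Type*} [NormedAddCommGroup E] [NormedSpace ℝ E]
    [NormedAddCommGroup F] [NormedSpace ℝ F] {f : E → F} {i : ℕ} (hf : ContDiff ℝ i f) (c : ℝ)
    (x : E) : ‖iteratedFDeriv ℝ i (fun y => f (c • y)) x‖ =
      |c| ^ i * ‖iteratedFDeriv ℝ i f (c • x)‖ := by
  rw [iteratedFDeriv_comp_const_smul c hf, norm_smul, norm_pow, Real.norm_eq_abs]

theorem exists_norm_iteratedFDeriv_le_of_hasCompactSupport {E F : Type*} [NormedAddCommGroup E]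
    [NormedSpace ℝ E] [NormedAddCommGroup F] [NormedSpace ℝ F] {f : E → F}
    (hf : ContDiff ℝ ∞ f) (hs : HasCompactSupport f) (i : ℕ) :
    ∃ B, 0 ≤ B ∧ ∀ l ≤ i, ∀ x, ‖iteratedFDeriv ℝ l f x‖ ≤ B := by
  have h : ∀ l : ℕ, ∃ B : ℝ, ∀ x, ‖iteratedFDeriv ℝ l f x‖ ≤ B := fun l =>
    (hs.iteratedFDeriv l).exists_bound_of_continuous
      (hf.of_le (mod_cast le_top)).continuous_iteratedFDeriv'
  choose B hB using h
  refine ⟨∑ l ∈ Finset.range (i + 1), |B l|, Finset.sum_nonneg fun _ _ => abs_nonneg _,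
    fun l hl x => ?_⟩
  exact (hB l x).trans ((le_abs_self _).trans (Finset.single_le_sum (f := fun l => |B l|)
    (fun _ _ => abs_nonneg _) (Finset.mem_range.2 (by omega))))

/-- Continuous functions on the Schwartz space that agree on compactly supported functions agree. -/
theorem SchwartzMap.funext_of_hasCompactSupport {E : Type*} [NormedAddCommGroup E]
    [InnerProductSpace ℝ E] [FiniteDimensional ℝ E] {X : Type*} [TopologicalSpace X] [T2Space X]
    {a b : 𝓢(E, ℂ) → X} (ha : Continuous a) (hb : Continuous b)
    (h : ∀ g : 𝓢(E, ℂ), HasCompactSupport g → a g = b g) (g : 𝓢(E, ℂ)) : a g = b g := by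
  let χ : ContDiffBump (0 : E) := ⟨1, 2, one_pos, one_lt_two⟩
  -- The error of the truncation at scale `c k` is `θ (c k • x) * g x`, and `θ` vanishes on the unit
  -- ball. Elsewhere `1 ≤ c k * ‖x‖`, so one more power of `‖x‖`, absorbed by a higher seminorm of
  -- `g`, buys the factor `c k`, which tends to zero.
  let θ : E → ℂ := fun x => (χ x : ℂ) - 1
  have hχ : ContDiff ℝ ∞ (fun x => (χ x : ℂ)) := Complex.ofRealCLM.contDiff.comp χ.contDiff
  have hθ : ContDiff ℝ ∞ θ := hχ.sub contDiff_const
  have hχs : HasCompactSupport (fun x => (χ x : ℂ)) :=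
    χ.hasCompactSupport.comp_left (g := fun t : ℝ => (t : ℂ)) (by simp)
  let c : ℕ → ℝ := fun k => ((k : ℝ) + 1)⁻¹
  have hc0 : ∀ k, 0 < c k := fun k => by positivity
  have hc1 : ∀ k, c k ≤ 1 := fun k => inv_le_one_of_one_le₀ (by linarith [k.cast_nonneg (α := ℝ)])
  have hcs : ∀ k, HasCompactSupport (fun x => (χ (c k • x) : ℂ) * g x) := fun k =>
    (hχs.comp_smul (hc0 k).ne').mul_right
  have hcd : ∀ k, ContDiff ℝ ∞ (fun x => (χ (c k • x) : ℂ) * g x) := fun k =>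
    (hχ.comp (contDiff_const_smul (c k))).mul (g.smooth ⊤)
  let G : ℕ → 𝓢(E, ℂ) := fun k => (hcs k).toSchwartzMap (hcd k)
  have hG : Tendsto G atTop (𝓝 g) := by
    rw [(schwartz_withSeminorms ℝ E ℂ).tendsto_nhds]
    rintro ⟨p, q⟩ ε hε
    have hbound : ∃ B, 0 ≤ B ∧ ∀ l ≤ q, ∀ x, ‖iteratedFDeriv ℝ l θ x‖ ≤ B := by
      obtain ⟨B, hB0, hB⟩ := exists_norm_iteratedFDeriv_le_of_hasCompactSupport hχ hχs q
      refine ⟨B + 1, by linarith, fun l hl x => ?_⟩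
      have h1 : iteratedFDeriv ℝ l θ x = iteratedFDeriv ℝ l (fun x => (χ x : ℂ)) x -
          iteratedFDeriv ℝ l (fun _ => (1 : ℂ)) x :=
        iteratedFDeriv_sub_apply ((hχ.of_le (mod_cast le_top)).contDiffAt) contDiffAt_const
      rw [h1]
      refine (norm_sub_le _ _).trans (add_le_add (hB l hl x) ?_)
      rcases Nat.eq_zero_or_pos l with rfl | hl0
      · simp
      · rw [iteratedFDeriv_const_of_ne hl0.ne']
        simp
    obtain ⟨B, hB0, hB⟩ := hbound
    set D : ℝ := ∑ i ∈ Finset.range (q + 1), (q.choose i : ℝ) * B *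
      SchwartzMap.seminorm ℝ (p + 1) (q - i) g with hD
    have hD0 : 0 ≤ D := Finset.sum_nonneg fun _ _ => by positivity
    have hle : ∀ k, SchwartzMap.seminorm ℝ p q (G k - g) ≤ c k * D := by
      intro k
      refine SchwartzMap.seminorm_le_bound ℝ p q _ (by have := hc0 k; positivity) fun x => ?_
      have hfun : (⇑(G k - g) : E → ℂ) = fun x => θ (c k • x) * g x := by
        ext y
        change (χ (c k • y) : ℂ) * g y - g y = _
        simp only [θ]
        ring
      rw [hfun]
      rcases lt_or_ge ‖c k • x‖ 1 with hx | hx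
      · have hev : (fun x => θ (c k • x) * g x) =ᶠ[𝓝 x] fun _ => 0 := by
          have hcont : ContinuousAt (fun y : E => ‖c k • y‖) x := by fun_prop
          filter_upwards [hcont.eventually (gt_mem_nhds hx)] with y hy
          have : χ (c k • y) = 1 := χ.one_of_mem_closedBall (by
            rw [mem_closedBall_zero_iff]
            exact le_of_lt hy)
          simp [θ, this]
        rw [(Filter.EventuallyEq.iteratedFDeriv ℝ hev q).eq_of_nhds]
        have h0 : iteratedFDeriv ℝ q (fun _ : E => (0 : ℂ)) x = 0 := by simp
        rw [h0, norm_zero, mul_zero]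
        have := hc0 k
        positivity
      · have hx' : 1 ≤ c k * ‖x‖ := by
          rwa [norm_smul, Real.norm_of_nonneg (hc0 k).le] at hx
        have hθk : ContDiff ℝ ∞ (fun x => θ (c k • x)) := hθ.comp (contDiff_const_smul (c k))
        calc ‖x‖ ^ p * ‖iteratedFDeriv ℝ q (fun x => θ (c k • x) * g x) x‖
            ≤ (c k * ‖x‖) * ‖x‖ ^ p * ∑ i ∈ Finset.range (q + 1), (q.choose i : ℝ) *
                ‖iteratedFDeriv ℝ i (fun x => θ (c k • x)) x‖ *
                ‖iteratedFDeriv ℝ (q - i) g x‖ := by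
              gcongr
              · exact le_mul_of_one_le_left (by positivity) hx'
              · exact norm_iteratedFDeriv_mul_le hθk (g.smooth ⊤) x (mod_cast le_top)
          _ = c k * ∑ i ∈ Finset.range (q + 1), (q.choose i : ℝ) *
                ‖iteratedFDeriv ℝ i (fun x => θ (c k • x)) x‖ *
                (‖x‖ ^ (p + 1) * ‖iteratedFDeriv ℝ (q - i) g x‖) := by
              rw [mul_assoc, mul_assoc, Finset.mul_sum, Finset.mul_sum]
              congr 1
              refine Finset.sum_congr rfl fun i _ => ?_
              ring
          _ ≤ c k * D := by
              refine mul_le_mul_of_nonneg_left (Finset.sum_le_sum fun i hi => ?_) (hc0 k).le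
              have hi' : i ≤ q := by have := Finset.mem_range.1 hi; omega
              gcongr
              · rw [norm_iteratedFDeriv_comp_smul (hθ.of_le (mod_cast le_top)),
                  abs_of_pos (hc0 k)]
                calc _ ≤ 1 * B := mul_le_mul (pow_le_one₀ (hc0 k).le (hc1 k)) (hB i hi' _)
                      (norm_nonneg _) zero_le_one
                  _ = B := one_mul _
              · exact SchwartzMap.le_seminorm ℝ (p + 1) (q - i) g x
    have hlim : Tendsto (fun k => c k * D) atTop (𝓝 0) := by
      simpa [c, one_div] using (tendsto_one_div_add_atTop_nhds_zero_nat (𝕜 := ℝ)).mul_const D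
    filter_upwards [hlim.eventually (gt_mem_nhds hε)] with k hk
    exact (hle k).trans_lt hk
  have h1 := (ha.tendsto g).comp hG
  have h2 := (hb.tendsto g).comp hG
  exact tendsto_nhds_unique h1 (h2.congr fun k => (h (G k) (hcs k)).symm)

theorem MeasureTheory.L2.norm_sq_eq_integral {α : Type*} [MeasurableSpace α] {μ : Measure α}
    (f : Lp ℂ 2 μ) : ‖f‖ ^ 2 = ∫ a, ‖f a‖ ^ 2 ∂μ := by
  have h := inner_self_eq_norm_sq_to_K (𝕜 := ℂ) f
  rw [L2.inner_def] at h
  simp only [inner_self_eq_norm_sq_to_K] at h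
  have h2 : ∫ a, ((‖f a‖ : ℂ)) ^ 2 ∂μ = ((∫ a, ‖f a‖ ^ 2 ∂μ : ℝ) : ℂ) := by
    rw [← integral_complex_ofReal]
    simp
  have h3 := h2.symm.trans h
  exact Complex.ofReal_injective (by rw [h3]; simp)

/-! ### Fourier inversion for functions with a weight -/

section Synthesis

variable {n : ℕ}

theorem measurable_fourierChar_inner (x : EuclSp n) :
    Measurable fun ξ : EuclSp n => ((𝐞 (inner ℝ ξ x) : Circle) : ℂ) := by
  have h : Continuous fun ξ : EuclSp n => ((𝐞 (inner ℝ ξ x) : Circle) : ℂ) :=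
    continuous_subtype_val.comp (Real.continuous_fourierChar.comp (by fun_prop))
  exact h.measurable

theorem memLp_conj_fourierChar_mul {p : EuclSp n → ℂ} (hp : MemLp p 2 volume) (x : EuclSp n) :
    MemLp (fun ξ => conj (((𝐞 (inner ℝ ξ x) : Circle) : ℂ) * p ξ)) 2 volume := by
  refine hp.of_le ?_ (ae_of_all _ fun ξ => by
    rw [RCLike.norm_conj, norm_mul, Circle.norm_coe, one_mul])
  exact (Complex.continuous_conj.comp_aestronglyMeasurable
    ((measurable_fourierChar_inner x).aestronglyMeasurable.mul hp.1))

/-- Dominated convergence: the characters converge pointwise and two of them differ by at most `2`,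
which gives the majorant `4 * ‖p ξ‖ ^ 2`. -/
theorem continuous_toLp_conj_fourierChar_mul {p : EuclSp n → ℂ} (hp : MemLp p 2 volume) :
    Continuous fun x : EuclSp n => (memLp_conj_fourierChar_mul hp x).toLp _ := by
  refine continuous_iff_continuousAt.2 fun x₀ => ?_
  refine tendsto_iff_norm_sub_tendsto_zero.2 ?_
  have hsq : Tendsto (fun x => ‖(memLp_conj_fourierChar_mul hp x).toLp _ -
      (memLp_conj_fourierChar_mul hp x₀).toLp _‖ ^ 2) (𝓝 x₀) (𝓝 0) := by
    have heq : ∀ x, ‖(memLp_conj_fourierChar_mul hp x).toLp _ -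
        (memLp_conj_fourierChar_mul hp x₀).toLp _‖ ^ 2 = ∫ ξ, ‖((𝐞 (inner ℝ ξ x) : Circle) : ℂ) -
          ((𝐞 (inner ℝ ξ x₀) : Circle) : ℂ)‖ ^ 2 * ‖p ξ‖ ^ 2 := by
      intro x
      rw [← MemLp.toLp_sub, L2.norm_sq_eq_integral]
      refine integral_congr_ae ?_
      filter_upwards [((memLp_conj_fourierChar_mul hp x).sub
        (memLp_conj_fourierChar_mul hp x₀)).coeFn_toLp] with ξ hξ
      rw [hξ, Pi.sub_apply, ← map_sub, ← sub_mul, RCLike.norm_conj, norm_mul, mul_pow]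
    simp_rw [heq]
    have h0 : (0 : ℝ) = ∫ ξ, ‖((𝐞 (inner ℝ ξ x₀) : Circle) : ℂ) -
          ((𝐞 (inner ℝ ξ x₀) : Circle) : ℂ)‖ ^ 2 * ‖p ξ‖ ^ 2 := by simp
    rw [h0]
    refine tendsto_integral_filter_of_dominated_convergence (fun ξ => 4 * ‖p ξ‖ ^ 2) ?_ ?_ ?_ ?_
    · refine Eventually.of_forall fun x => ?_
      exact (((measurable_fourierChar_inner x).sub
        (measurable_fourierChar_inner x₀)).norm.pow_const 2).aestronglyMeasurable.mul
        (hp.1.norm.pow 2)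
    · refine Eventually.of_forall fun x => ae_of_all _ fun ξ => ?_
      rw [Real.norm_of_nonneg (by positivity)]
      gcongr
      have h1 : ‖((𝐞 (inner ℝ ξ x) : Circle) : ℂ) - ((𝐞 (inner ℝ ξ x₀) : Circle) : ℂ)‖ ≤ 2 := by
        refine (norm_sub_le _ _).trans ?_
        simp only [Circle.norm_coe]
        norm_num
      calc _ ≤ (2 : ℝ) ^ 2 := by gcongr
        _ = 4 := by norm_num
    · exact hp.norm.integrable_sq.const_mul 4
    · refine ae_of_all _ fun ξ => ?_
      have hc : Continuous fun x : EuclSp n => ‖((𝐞 (inner ℝ ξ x) : Circle) : ℂ) -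
          ((𝐞 (inner ℝ ξ x₀) : Circle) : ℂ)‖ ^ 2 * ‖p ξ‖ ^ 2 := by
        have h : Continuous fun x : EuclSp n => ((𝐞 (inner ℝ ξ x) : Circle) : ℂ) :=
          continuous_subtype_val.comp (Real.continuous_fourierChar.comp (by fun_prop))
        fun_prop
      exact hc.tendsto x₀
  have := (Real.continuous_sqrt.tendsto 0).comp hsq
  simpa [Function.comp_def, Real.sqrt_sq (norm_nonneg _)] using this

/-- Joint continuity of `(x, y) ↦ ∫ e^{2πi⟨ξ,x⟩} p(ξ) γ(y)(ξ) dξ` for `p ∈ L₂` and a bounded weakly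
continuous family `γ` in `L₂`. -/
theorem continuous_integral_fourierChar_mul {p : EuclSp n → ℂ} (hp : MemLp p 2 volume)
    {Y : Type*} [TopologicalSpace Y] {γ : Y → Lp ℂ 2 (volume : Measure (EuclSp n))} {R : ℝ}
    (hR : ∀ y, ‖γ y‖ ≤ R) (hγ : ∀ a, Continuous fun y => inner ℂ a (γ y)) :
    Continuous fun q : EuclSp n × Y =>
      ∫ ξ, 𝐞 (inner ℝ ξ q.1) • (p ξ * γ q.2 ξ) := by
  set κ : EuclSp n → Lp ℂ 2 (volume : Measure (EuclSp n)) :=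
    fun x => (memLp_conj_fourierChar_mul hp x).toLp _ with hκ
  have hInt : ∀ q : EuclSp n × Y, ∫ ξ, 𝐞 (inner ℝ ξ q.1) • (p ξ * γ q.2 ξ) =
      inner ℂ (κ q.1) (γ q.2) := by
    intro q
    rw [L2.inner_def]
    refine integral_congr_ae ?_
    filter_upwards [(memLp_conj_fourierChar_mul hp q.1).coeFn_toLp] with ξ hξ
    rw [hκ, hξ, RCLike.inner_apply, Complex.conj_conj, Circle.smul_def, smul_eq_mul]
    ring
  simp_rw [hInt]
  have hκc : Continuous κ := continuous_toLp_conj_fourierChar_mul hp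
  refine continuous_iff_continuousAt.2 fun q₀ => ?_
  -- A pairing of a norm-continuous family with a bounded weakly continuous one is jointly
  -- continuous: the change of `κ` is controlled by the bound `R`, and for fixed `κ q₀.1` weak
  -- continuity is enough.
  have h1 : Tendsto (fun q : EuclSp n × Y => inner ℂ (κ q.1 - κ q₀.1) (γ q.2)) (𝓝 q₀) (𝓝 0) := by
    refine squeeze_zero_norm (a := fun q => ‖κ q.1 - κ q₀.1‖ * R) (fun q => ?_) ?_
    · exact (norm_inner_le_norm _ _).trans (by gcongr; exact hR _)
    · have : Continuous fun q : EuclSp n × Y => ‖κ q.1 - κ q₀.1‖ * R := by fun_prop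
      simpa using this.tendsto q₀
  have h2 : Tendsto (fun q : EuclSp n × Y => inner ℂ (κ q₀.1) (γ q.2)) (𝓝 q₀)
      (𝓝 (inner ℂ (κ q₀.1) (γ q₀.2))) := ((hγ (κ q₀.1)).comp continuous_snd).tendsto q₀
  have h3 := h1.add h2
  rw [zero_add] at h3
  refine h3.congr fun q => ?_
  rw [← inner_add_left, sub_add_cancel]

/-- The inverse Fourier transform of `g / (⟨ξ⟩^s φ(⟨ξ⟩))`. -/
noncomputable def weightedSynthesis (s : ℝ) (φ : ℝ → ℝ) (g : EuclSp n → ℂ) : EuclSp n → ℂ :=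
  𝓕⁻ fun ξ => (((refinedWeight s φ ξ)⁻¹ : ℝ) : ℂ) * g ξ

/-- The sign in the pairing turns the Fourier kernel into the inverse one; in this form the
differentiation theorems for `VectorFourier.fourierIntegral` apply. -/
theorem weightedSynthesis_eq (s : ℝ) (φ : ℝ → ℝ) (g : EuclSp n → ℂ) :
    weightedSynthesis s φ g = VectorFourier.fourierIntegral 𝐞 volume
      (-(innerSL ℝ : EuclSp n →L[ℝ] EuclSp n →L[ℝ] ℝ)).toLinearMap₁₂
      fun ξ => (((refinedWeight s φ ξ)⁻¹ : ℝ) : ℂ) * g ξ := rfl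

theorem weightedSynthesis_congr_ae (s : ℝ) (φ : ℝ → ℝ) {g g' : EuclSp n → ℂ}
    (h : g =ᵐ[volume] g') : weightedSynthesis s φ g = weightedSynthesis s φ g' := by
  rw [weightedSynthesis_eq, weightedSynthesis_eq]
  refine VectorFourier.fourierIntegral_congr_ae _ _ _ ?_
  filter_upwards [h] with ξ hξ
  rw [hξ]

variable {φ : ℝ → ℝ} {ρ : ℕ} {s : ℝ}

theorem norm_pow_le_japaneseBracket_pow {k : ℕ} (hk : k ≤ ρ) (ξ : EuclSp n) :
    ‖ξ‖ ^ k ≤ japaneseBracket ξ ^ ρ :=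
  (pow_le_pow_left₀ (norm_nonneg _) (norm_le_japaneseBracket ξ) k).trans
    (pow_le_pow_right₀ (one_le_japaneseBracket ξ) hk)

/-- Cauchy–Schwarz: after `‖ξ‖ ^ k ≤ ⟨ξ⟩ ^ ρ` the integrand is dominated by the product of the `L₂`
function in `hK` and `‖g‖`. This integrability is what yields `ρ` derivatives. -/
theorem integrable_pow_mul_weight_inv_mul (hφ : SlowlyVaryingClass φ)
    (hK : MemLp (fun ξ : EuclSp n => japaneseBracket ξ ^ ρ / refinedWeight s φ ξ) 2 volume)
    {g : EuclSp n → ℂ} (hg : MemLp g 2 volume) {k : ℕ} (hk : k ≤ ρ) :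
    Integrable (fun ξ => ‖ξ‖ ^ k * ‖(((refinedWeight s φ ξ)⁻¹ : ℝ) : ℂ) * g ξ‖) := by
  refine (hK.integrable_mul hg.norm).mono' ?_ (ae_of_all _ fun ξ => ?_)
  · refine (by fun_prop : AEStronglyMeasurable (fun ξ : EuclSp n => ‖ξ‖ ^ k) volume).mul ?_
    exact ((Complex.measurable_ofReal.comp
      (hφ.measurable_refinedWeight s).inv).aestronglyMeasurable.mul hg.1).norm
  · have hw := hφ.refinedWeight_pos s ξ
    rw [Real.norm_of_nonneg (by positivity), norm_mul, Complex.norm_real,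
      Real.norm_of_nonneg (by positivity), Pi.mul_apply, div_eq_mul_inv, mul_assoc, ← mul_assoc]
    rw [← mul_assoc]
    gcongr
    exact norm_pow_le_japaneseBracket_pow hk ξ

theorem aestronglyMeasurable_weight_inv_mul (hφ : SlowlyVaryingClass φ) {g : EuclSp n → ℂ}
    (hg : AEStronglyMeasurable g volume) :
    AEStronglyMeasurable (fun ξ => (((refinedWeight s φ ξ)⁻¹ : ℝ) : ℂ) * g ξ) volume :=
  (Complex.measurable_ofReal.comp
      (hφ.measurable_refinedWeight s).inv).aestronglyMeasurable.mul hg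

theorem integrable_weight_inv_mul (hφ : SlowlyVaryingClass φ)
    (hK : MemLp (fun ξ : EuclSp n => japaneseBracket ξ ^ ρ / refinedWeight s φ ξ) 2 volume)
    {g : EuclSp n → ℂ} (hg : MemLp g 2 volume) :
    Integrable (fun ξ => (((refinedWeight s φ ξ)⁻¹ : ℝ) : ℂ) * g ξ) := by
  rw [← integrable_norm_iff (aestronglyMeasurable_weight_inv_mul hφ hg.1)]
  simpa using integrable_pow_mul_weight_inv_mul hφ hK hg (Nat.zero_le ρ)

theorem contDiff_weightedSynthesis (hφ : SlowlyVaryingClass φ)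
    (hK : MemLp (fun ξ : EuclSp n => japaneseBracket ξ ^ ρ / refinedWeight s φ ξ) 2 volume)
    {g : EuclSp n → ℂ} (hg : MemLp g 2 volume) : ContDiff ℝ ρ (weightedSynthesis s φ g) := by
  rw [weightedSynthesis_eq]
  exact VectorFourier.contDiff_fourierIntegral (N := (ρ : ℕ∞)) _ fun k hk =>
    integrable_pow_mul_weight_inv_mul hφ hK hg (mod_cast hk)

theorem weightedSynthesis_add (hφ : SlowlyVaryingClass φ)
    (hK : MemLp (fun ξ : EuclSp n => japaneseBracket ξ ^ ρ / refinedWeight s φ ξ) 2 volume)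
    {g g' : EuclSp n → ℂ} (hg : MemLp g 2 volume) (hg' : MemLp g' 2 volume) :
    weightedSynthesis s φ (g + g') = weightedSynthesis s φ g + weightedSynthesis s φ g' := by
  simp only [weightedSynthesis_eq]
  rw [← VectorFourier.fourierIntegral_add Real.continuous_fourierChar
    ((-(innerSL ℝ : EuclSp n →L[ℝ] EuclSp n →L[ℝ] ℝ)).continuous₂)
    (integrable_weight_inv_mul hφ hK hg)
    (integrable_weight_inv_mul hφ hK hg')]
  congr 1
  ext ξ
  simp [mul_add]

theorem weightedSynthesis_smul (c : ℂ) (g : EuclSp n → ℂ) :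
    weightedSynthesis s φ (c • g) = c • weightedSynthesis s φ g := by
  simp only [weightedSynthesis_eq]
  rw [← VectorFourier.fourierIntegral_const_smul]
  congr 1
  ext ξ
  simp [mul_left_comm]

/-- A map into the continuous multilinear maps on `ℝⁿ` is continuous if it is so pointwise. -/
theorem continuous_multilinear_of_pointwise {Z : Type*} [TopologicalSpace Z] {k : ℕ}
    {D : Z → (EuclSp n) [×k]→L[ℝ] ℂ} (h : ∀ m, Continuous fun z => D z m) : Continuous D := by
  -- The source is finite-dimensional, so this injective linear map is a closed embedding and the
  -- norm topology is that of pointwise convergence.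
  let ev : ((EuclSp n) [×k]→L[ℝ] ℂ) →ₗ[ℝ] ((Fin k → EuclSp n) → ℂ) :=
    { toFun := fun D m => D m
      map_add' := fun _ _ => rfl
      map_smul' := fun _ _ => rfl }
  have : FiniteDimensional ℝ ((EuclSp n) [×k]→L[ℝ] ℂ) :=
    Module.Finite.of_injective
      (ContinuousMultilinearMap.toMultilinearMapLinear :
        ((EuclSp n) [×k]→L[ℝ] ℂ) →ₗ[ℝ] MultilinearMap ℝ (fun _ : Fin k => EuclSp n) ℂ)
      ContinuousMultilinearMap.toMultilinearMap_injective
  have hev : LinearMap.ker ev = ⊥ := LinearMap.ker_eq_bot.2 fun D D' hD =>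
    ContinuousMultilinearMap.ext fun m => congrFun hD m
  exact (LinearMap.isClosedEmbedding_of_injective hev).isInducing.continuous_iff.2
    (continuous_pi h)

/-- The derivatives of the synthesis operator are jointly continuous in the point and, in the weak
topology of bounded sets of `L₂`, in the function. -/
theorem continuous_iteratedFDeriv_weightedSynthesis (hφ : SlowlyVaryingClass φ)
    (hK : MemLp (fun ξ : EuclSp n => japaneseBracket ξ ^ ρ / refinedWeight s φ ξ) 2 volume)
    {Y : Type*} [TopologicalSpace Y] {γ : Y → Lp ℂ 2 (volume : Measure (EuclSp n))} {R : ℝ}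
    (hR : ∀ y, ‖γ y‖ ≤ R) (hγ : ∀ a, Continuous fun y => inner ℂ a (γ y)) {k : ℕ} (hk : k ≤ ρ) :
    Continuous fun q : EuclSp n × Y => iteratedFDeriv ℝ k (weightedSynthesis s φ (γ q.2)) q.1 := by
  refine continuous_multilinear_of_pointwise fun m => ?_
  set L : EuclSp n →L[ℝ] EuclSp n →L[ℝ] ℝ := -(innerSL ℝ : EuclSp n →L[ℝ] EuclSp n →L[ℝ] ℝ)
  -- The Fourier multiplier of the derivative in the directions `m`, divided by the weight. It is in
  -- `L₂` by `hK`, so this derivative is a pairing of the kind treated in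
  -- `continuous_integral_fourierChar_mul`.
  set p : EuclSp n → ℂ := fun ξ => (-(2 * Real.pi * Complex.I)) ^ k *
    ((∏ i, L ξ (m i) : ℝ) : ℂ) * (((refinedWeight s φ ξ)⁻¹ : ℝ) : ℂ) with hp
  have hpL : MemLp p 2 volume := by
    refine hK.of_le_mul (c := (2 * Real.pi) ^ k * ∏ i, ‖m i‖) ?_ (ae_of_all _ fun ξ => ?_)
    · refine ((Continuous.aestronglyMeasurable ?_).const_mul _).mul
        (Complex.measurable_ofReal.comp
          (hφ.measurable_refinedWeight s).inv).aestronglyMeasurable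
      exact Complex.continuous_ofReal.comp (by fun_prop)
    · have hw := hφ.refinedWeight_pos s ξ
      have hj := japaneseBracket_pos ξ
      rw [hp]
      simp only [norm_mul, norm_pow, norm_neg, Complex.norm_real, Complex.norm_I, norm_div,
        norm_inv, Complex.norm_ofNat, mul_one]
      rw [Real.norm_of_nonneg Real.pi_pos.le, Real.norm_of_nonneg hw.le, Real.norm_of_nonneg hj.le]
      have h1 : ‖∏ i, L ξ (m i)‖ ≤ ‖ξ‖ ^ k * ∏ i, ‖m i‖ := by
        rw [norm_prod]
        calc _ ≤ ∏ i, ‖ξ‖ * ‖m i‖ := Finset.prod_le_prod (fun _ _ => norm_nonneg _) fun i _ => by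
              have h2 : L ξ (m i) = -inner ℝ ξ (m i) := rfl
              rw [h2, norm_neg]
              exact norm_inner_le_norm ξ (m i)
          _ = _ := by simp [Finset.prod_mul_distrib]
      calc _ ≤ (2 * Real.pi) ^ k * (‖ξ‖ ^ k * ∏ i, ‖m i‖) * (refinedWeight s φ ξ)⁻¹ := by gcongr
        _ ≤ (2 * Real.pi) ^ k * (japaneseBracket ξ ^ ρ * ∏ i, ‖m i‖) *
            (refinedWeight s φ ξ)⁻¹ := by
              gcongr
              exact norm_pow_le_japaneseBracket_pow hk ξ
        _ = _ := by rw [div_eq_mul_inv]; ring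
  refine (continuous_integral_fourierChar_mul hpL hR hγ).congr fun q => ?_
  have hg := Lp.memLp (γ q.2)
  rw [weightedSynthesis_eq, VectorFourier.iteratedFDeriv_fourierIntegral (N := (ρ : ℕ∞)) L
    (fun j hj => integrable_pow_mul_weight_inv_mul hφ hK hg (mod_cast hj))
    (aestronglyMeasurable_weight_inv_mul hφ hg.1) (mod_cast hk),
    Real.fourierIntegral_continuousMultilinearMap_apply'
      (VectorFourier.integrable_fourierPowSMulRight L
        (integrable_pow_mul_weight_inv_mul hφ hK hg hk)
        (aestronglyMeasurable_weight_inv_mul hφ hg.1))]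
  refine integral_congr_ae (ae_of_all _ fun ξ => ?_)
  have h1 : -(L ξ q.1) = inner ℝ ξ q.1 := neg_neg (inner ℝ ξ q.1)
  change 𝐞 (inner ℝ ξ q.1) • (p ξ * γ q.2 ξ) = 𝐞 (-(L ξ q.1)) •
    (VectorFourier.fourierPowSMulRight L _ ξ k : (EuclSp n) [×k]→L[ℝ] ℂ) m
  rw [h1]
  congr 1
  refine Eq.trans ?_ (VectorFourier.fourierPowSMulRight_apply L).symm
  rw [hp]
  simp only [smul_eq_mul, Complex.real_smul]
  ring

theorem continuous_schwartz_integral_mul {f : EuclSp n → ℂ} (hf : Integrable f) :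
    Continuous fun g : 𝓢(EuclSp n, ℂ) => ∫ ξ, g ξ * f ξ := by
  have hInt : ∀ g : BoundedContinuousFunction (EuclSp n) ℂ, Integrable fun ξ => g ξ * f ξ :=
    fun g => hf.bdd_mul g.continuous.aestronglyMeasurable (ae_of_all _ g.norm_coe_le_norm)
  let ℓ : BoundedContinuousFunction (EuclSp n) ℂ →ₗ[ℂ] ℂ :=
    { toFun := fun g => ∫ ξ, g ξ * f ξ
      map_add' := fun g g' => by
        rw [← integral_add (hInt g) (hInt g')]
        simp [add_mul]
      map_smul' := fun c g => by
        rw [RingHom.id_apply, smul_eq_mul, ← integral_const_mul]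
        simp [mul_assoc] }
  have hℓ : Continuous ℓ := AddMonoidHomClass.continuous_of_bound ℓ (∫ ξ, ‖f ξ‖) fun g => by
    refine (norm_integral_le_integral_norm _).trans ?_
    rw [mul_comm, ← integral_const_mul]
    refine integral_mono (hInt g).norm (hf.norm.const_mul _) fun ξ => ?_
    simp only [norm_mul]
    gcongr
    exact g.norm_coe_le_norm ξ
  exact hℓ.comp (SchwartzMap.toBoundedContinuousFunctionCLM ℂ (EuclSp n) ℂ).continuous

theorem weight_inv_mul_weightedFourier_ae_eq (hφ : SlowlyVaryingClass φ) {u : 𝓢'(EuclSp n, ℂ)}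
    (hu : u ∈ refinedSubmodule n s φ) {f : EuclSp n → ℂ} (hf : HasFourierFunction u f) :
    (fun ξ => (((refinedWeight s φ ξ)⁻¹ : ℝ) : ℂ) * weightedFourier n s φ ⟨u, hu⟩ ξ)
      =ᵐ[volume] f := by
  filter_upwards [hu.choose_spec.2.coeFn_toLp, hu.choose_spec.1.ae_eq hf] with ξ h1 h2
  change _ * (hu.choose_spec.2.toLp _) ξ = _
  have hw : (refinedWeight s φ ξ : ℂ) ≠ 0 :=
    Complex.ofReal_ne_zero.2 (hφ.refinedWeight_pos s ξ).ne'
  rw [h1, h2, Complex.ofReal_inv, inv_mul_cancel_left₀ hw]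

/-- An element of `H^{s,φ}(ℝⁿ)` is a function, given by the Fourier inversion formula. -/
theorem apply_eq_integral_weightedSynthesis (hφ : SlowlyVaryingClass φ)
    (hK : MemLp (fun ξ : EuclSp n => japaneseBracket ξ ^ ρ / refinedWeight s φ ξ) 2 volume)
    {u : 𝓢'(EuclSp n, ℂ)} (hu : u ∈ refinedSubmodule n s φ) (g : 𝓢(EuclSp n, ℂ)) :
    u g = ∫ x, g x * weightedSynthesis s φ (weightedFourier n s φ ⟨u, hu⟩) x := by
  obtain ⟨f, hf, -⟩ := id hu
  have hae := weight_inv_mul_weightedFourier_ae_eq hφ hu hf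
  have hfi : Integrable f :=
    (integrable_weight_inv_mul hφ hK (Lp.memLp (weightedFourier n s φ ⟨u, hu⟩))).congr hae
  -- `HasFourierFunction` only tests against compactly supported functions, and `𝓕⁻ g` need not be
  -- one. Since `f` is integrable here, both sides are continuous in the test function and density
  -- extends the identity.
  have h1 : (𝓕 u) (𝓕⁻ g) = ∫ ξ, (𝓕⁻ g) ξ * f ξ :=
    SchwartzMap.funext_of_hasCompactSupport (map_continuous (𝓕 u))
      (continuous_schwartz_integral_mul hfi) hf.2 _
  have h2 : (𝓕 u) (𝓕⁻ g) = u g := by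
    rw [TemperedDistribution.fourier_apply, FourierTransform.fourier_fourierInv_eq]
  rw [← h2, h1]
  have h3 := VectorFourier.integral_fourierIntegral_smul_eq_flip (μ := volume) (ν := volume)
    (L := -innerₗ (EuclSp n)) (f := g) (g := f) Real.continuous_fourierChar
    (by simpa using (by fun_prop : Continuous fun p : EuclSp n × EuclSp n => -inner ℝ p.1 p.2))
    g.integrable hfi
  have hflip : (-innerₗ (EuclSp n)).flip = -innerₗ (EuclSp n) := by
    ext x y
    simp [real_inner_comm]
  rw [hflip] at h3
  rw [SchwartzMap.fourierInv_coe]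
  refine h3.trans ?_
  congr 1
  ext x
  rw [smul_eq_mul]
  congr 1
  exact congrFun (VectorFourier.fourierIntegral_congr_ae 𝐞 volume (-innerₗ (EuclSp n)) hae.symm) x

end Synthesis

/-! ### Positive smooth densities -/

namespace SmoothDensity

theorem aemeasurable_chart {n : ℕ} {Γ : Type*} [TopologicalSpace Γ] [MeasurableSpace Γ]
    [BorelSpace Γ] (μ : Measure Γ) (β : OpenPartialHomeomorph Γ (EuclSp n)) :
    AEMeasurable β (μ.restrict β.source) :=
  β.continuousOn.aemeasurable β.open_source.measurableSet

variable {n : ℕ} {Γ : Type*} [TopologicalSpace Γ] [ChartedSpace (EuclSp n) Γ]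
  [MeasurableSpace Γ] (d : SmoothDensity n Γ) {β : OpenPartialHomeomorph Γ (EuclSp n)}

theorem aemeasurable_dens (hβ : β ∈ IsManifold.maximalAtlas (𝓡 n) ∞ Γ) :
    AEMeasurable (fun x => ENNReal.ofReal (d.dens β x)) (volume.restrict β.target) :=
  ((d.contDiffOn_dens β hβ).continuousOn.aemeasurable β.open_target.measurableSet).ennreal_ofReal

theorem exists_dens_le (hβ : β ∈ IsManifold.maximalAtlas (𝓡 n) ∞ Γ) {K : Set (EuclSp n)}
    (hK : IsCompact K) (hKβ : K ⊆ β.target) : ∃ C, ∀ x ∈ K, d.dens β x ≤ C := by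
  obtain ⟨C, hC⟩ := hK.bddAbove_image ((d.contDiffOn_dens β hβ).continuousOn.mono hKβ)
  exact ⟨C, fun x hx => hC (mem_image_of_mem _ hx)⟩

theorem exists_le_dens (hβ : β ∈ IsManifold.maximalAtlas (𝓡 n) ∞ Γ) {K : Set (EuclSp n)}
    (hK : IsCompact K) (hKβ : K ⊆ β.target) : ∃ c, 0 < c ∧ ∀ x ∈ K, c ≤ d.dens β x := by
  rcases K.eq_empty_or_nonempty with rfl | hne
  · exact ⟨1, one_pos, by simp⟩
  · obtain ⟨x, hx, hmin⟩ := hK.exists_isMinOn hne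
      ((d.contDiffOn_dens β hβ).continuousOn.mono hKβ)
    exact ⟨d.dens β x, d.dens_pos β hβ x (hKβ hx), fun y hy => hmin hy⟩

variable [BorelSpace Γ]

/-- Integration in a chart. -/
theorem integral_eq_integral_chart (hβ : β ∈ IsManifold.maximalAtlas (𝓡 n) ∞ Γ) {F : Γ → ℂ}
    (hF : ContinuousOn F β.source) (hF0 : ∀ y, y ∉ β.source → F y = 0) :
    ∫ y, F y ∂d.measure = ∫ x in β.target, (d.dens β x : ℂ) * F (β.symm x) := by
  rw [← setIntegral_eq_integral_of_forall_compl_eq_zero hF0]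
  have h1 : ∫ y in β.source, F y ∂d.measure = ∫ y in β.source, F (β.symm (β y)) ∂d.measure :=
    setIntegral_congr_fun β.open_source.measurableSet fun y hy => by
      simp only [β.left_inv hy]
  have hac : AEStronglyMeasurable (fun x => F (β.symm x)) (volume.restrict β.target) :=
    (hF.comp β.continuousOn_symm β.mapsTo_symm).aestronglyMeasurable β.open_target.measurableSet
  rw [h1, ← integral_map (f := fun x => F (β.symm x)) (aemeasurable_chart d.measure β) ?_,
    d.map_restrict β hβ,
    integral_withDensity_eq_integral_toReal_smul₀ (d.aemeasurable_dens hβ)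
      (ae_of_all _ fun _ => ENNReal.ofReal_lt_top)]
  · refine setIntegral_congr_fun β.open_target.measurableSet fun x hx => ?_
    simp only [ENNReal.toReal_ofReal (d.dens_pos β hβ x hx).le, Complex.real_smul]
  · rw [d.map_restrict β hβ]
    exact hac.mono_ac (withDensity_absolutelyContinuous _ _)

/-- The measure of a set in a chart. -/
theorem measure_source_inter_preimage (hβ : β ∈ IsManifold.maximalAtlas (𝓡 n) ∞ Γ)
    {S : Set (EuclSp n)} (hS : MeasurableSet S) :
    d.measure (β.source ∩ β ⁻¹' S) =
      ∫⁻ x in S ∩ β.target, ENNReal.ofReal (d.dens β x) := by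
  have h1 := congrArg (fun μ => μ S) (d.map_restrict β hβ)
  simp only [Measure.map_apply_of_aemeasurable (aemeasurable_chart d.measure β) hS,
    withDensity_apply _ hS, Measure.restrict_restrict hS] at h1
  rw [← h1, Measure.restrict_apply' β.open_source.measurableSet, inter_comm]

variable [IsManifold (𝓡 n) ∞ Γ]

theorem isLocallyFiniteMeasure : IsLocallyFiniteMeasure d.measure := by
  refine ⟨fun p => ?_⟩
  set β := chartAt (EuclSp n) p
  have hβ : β ∈ IsManifold.maximalAtlas (𝓡 n) ∞ Γ := IsManifold.chart_mem_maximalAtlas p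
  have hp : p ∈ β.source := mem_chart_source _ p
  obtain ⟨K, hK, hpK, hKβ⟩ := exists_compact_subset β.open_target (β.map_source hp)
  refine ⟨β.source ∩ β ⁻¹' K, ?_, ?_⟩
  · exact inter_mem (β.open_source.mem_nhds hp)
      ((β.continuousAt hp).preimage_mem_nhds (mem_interior_iff_mem_nhds.1 hpK))
  · rw [d.measure_source_inter_preimage hβ hK.measurableSet, inter_eq_left.2 hKβ]
    obtain ⟨C, hC⟩ := d.exists_dens_le hβ hK hKβ
    refine (setLIntegral_mono' hK.measurableSet fun x hx =>
      ENNReal.ofReal_le_ofReal (hC x hx)).trans_lt ?_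
    rw [setLIntegral_const]
    exact ENNReal.mul_lt_top ENNReal.ofReal_lt_top hK.measure_lt_top

theorem isOpenPosMeasure : d.measure.IsOpenPosMeasure := by
  refine ⟨fun U hU ⟨p, hpU⟩ => ?_⟩
  set β := chartAt (EuclSp n) p
  have hβ : β ∈ IsManifold.maximalAtlas (𝓡 n) ∞ Γ := IsManifold.chart_mem_maximalAtlas p
  have hp : p ∈ β.source := mem_chart_source _ p
  set V : Set (EuclSp n) := β.target ∩ β.symm ⁻¹' U
  have hV : IsOpen V := β.isOpen_inter_preimage_symm hU
  have hpV : β p ∈ V := ⟨β.map_source hp, by simpa [β.left_inv hp] using hpU⟩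
  have hsub : β.source ∩ β ⁻¹' V ⊆ U := fun y hy => by
    have := hy.2.2
    simpa [β.left_inv hy.1] using this
  refine (lt_of_lt_of_le ?_ (measure_mono hsub)).ne'
  rw [d.measure_source_inter_preimage hβ hV.measurableSet, inter_eq_left.2 inter_subset_left]
  obtain ⟨K, hK, hpK, hKV⟩ := exists_compact_subset hV hpV
  obtain ⟨c, hc, hcK⟩ := d.exists_le_dens hβ hK (hKV.trans inter_subset_left)
  calc (0 : ENNReal) < ENNReal.ofReal c * volume K := by
        refine ENNReal.mul_pos (ENNReal.ofReal_pos.2 hc).ne' ?_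
        exact ((isOpen_interior.measure_pos volume ⟨_, hpK⟩).trans_le
          (measure_mono interior_subset)).ne'
    _ = ∫⁻ _ in K, ENNReal.ofReal c := (setLIntegral_const _ _).symm
    _ ≤ ∫⁻ x in K, ENNReal.ofReal (d.dens β x) :=
        setLIntegral_mono' hK.measurableSet fun x hx => ENNReal.ofReal_le_ofReal (hcK x hx)
    _ ≤ _ := lintegral_mono_set hKV

variable [CompactSpace Γ]

theorem isFiniteMeasure : IsFiniteMeasure d.measure :=
  have := d.isLocallyFiniteMeasure
  CompactSpace.isFiniteMeasure

/-- A continuous function is determined by the distribution which it defines. -/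
theorem eq_of_forall_integral_eq [T2Space Γ] {f g : Γ → ℂ} (hf : Continuous f) (hg : Continuous g)
    (h : ∀ w : CkSpace n Γ ⊤, ∫ x, f x * conj (w x) ∂d.measure =
      ∫ x, g x * conj (w x) ∂d.measure) : f = g := by
  have := d.isFiniteMeasure
  have := d.isOpenPosMeasure
  have hInt : ∀ {f : Γ → ℂ}, Continuous f → Integrable f d.measure := fun hf =>
    hf.integrable_of_hasCompactSupport (HasCompactSupport.of_compactSpace _)
  refine (hf.ae_eq_iff_eq d.measure hg).1 ?_
  refine ae_eq_of_integral_contMDiff_smul_eq (𝓡 n) (hInt hf).locallyIntegrable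
    (hInt hg).locallyIntegrable fun w hw _ => ?_
  have hw' : ContMDiff (𝓡 n) 𝓘(ℝ, ℂ) ∞ fun x => (w x : ℂ) :=
    Complex.ofRealCLM.contDiff.contMDiff.comp hw
  simpa [mul_comm] using h ⟨fun x => (w x : ℂ), hw'⟩

end SmoothDensity

/-! ### Functions supported in a chart -/

section CutoffComp

/-- The Leibniz rule and the bound for derivatives of a composition. Only the derivatives of `F` at
`τ x` enter, so later it is enough to control functions on a compact set. -/
theorem exists_iteratedFDeriv_cutoff_bound {n : ℕ} {O K : Set (EuclSp n)} (hO : IsOpen O)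
    (hK : IsCompact K) (hKO : K ⊆ O) {ψ : EuclSp n → ℂ} {τ : EuclSp n → EuclSp n}
    (hψ : ContDiffOn ℝ ∞ ψ O) (hτ : ContDiffOn ℝ ∞ τ O) (i : ℕ) :
    ∃ C : ℝ, 0 ≤ C ∧ ∀ F : EuclSp n → ℂ, ContDiff ℝ i F → ∀ p : ℝ, ∀ x ∈ K,
      (∀ l ≤ i, ‖iteratedFDeriv ℝ l F (τ x)‖ ≤ p) →
      ‖iteratedFDeriv ℝ i (fun y => ψ y * F (τ y)) x‖ ≤ C * p := by
  have hbd : ∀ {F : Type} [NormedAddCommGroup F] [NormedSpace ℝ F] (f : EuclSp n → F),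
      ContDiffOn ℝ ∞ f O → ∃ B : ℝ, 1 ≤ B ∧ ∀ l ≤ i, ∀ x ∈ K,
        ‖iteratedFDerivWithin ℝ l f O x‖ ≤ B := by
    intro F _ _ f hf
    have h : ∀ l : ℕ, ∃ B : ℝ, ∀ x ∈ K, ‖iteratedFDerivWithin ℝ l f O x‖ ≤ B := fun l =>
      hK.exists_bound_of_continuousOn ((hf.continuousOn_iteratedFDerivWithin
        (mod_cast le_top) hO.uniqueDiffOn).mono hKO)
    choose B hB using h
    refine ⟨1 + ∑ l ∈ Finset.range (i + 1), |B l|, ?_, fun l hl x hx => ?_⟩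
    · have : 0 ≤ ∑ l ∈ Finset.range (i + 1), |B l| := Finset.sum_nonneg fun _ _ => abs_nonneg _
      linarith
    · have h1 : |B l| ≤ ∑ l ∈ Finset.range (i + 1), |B l| :=
        Finset.single_le_sum (f := fun l => |B l|) (fun _ _ => abs_nonneg _)
          (Finset.mem_range.2 (by omega))
      linarith [hB l x hx, le_abs_self (B l)]
  obtain ⟨A, hA1, hA⟩ := hbd ψ hψ
  obtain ⟨B, hB1, hB⟩ := hbd τ hτ
  refine ⟨∑ l ∈ Finset.range (i + 1), (i.choose l : ℝ) * A * ((i - l).factorial * B ^ (i - l)),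
    Finset.sum_nonneg fun _ _ => by positivity, fun F hF p x hx hFp => ?_⟩
  have hxO := hKO hx
  have hp0 : 0 ≤ p := (norm_nonneg _).trans (hFp 0 (Nat.zero_le _))
  have hg : ∀ m ≤ i, ‖iteratedFDerivWithin ℝ m (fun y => F (τ y)) O x‖ ≤
      m.factorial * p * B ^ m := by
    intro m hm
    refine norm_iteratedFDerivWithin_comp_le (N := i) (g := F) (t := univ)
      hF.contDiffOn (hτ.of_le (mod_cast le_top)) (mod_cast hm) uniqueDiffOn_univ hO.uniqueDiffOn
      (mapsTo_univ _ _) hxO (fun l hl => ?_) (fun l hl1 hl => ?_)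
    · rw [iteratedFDerivWithin_univ]
      exact hFp l (hl.trans hm)
    · exact (hB l (by omega) x hx).trans (le_self_pow₀ hB1 (by omega))
  rw [← iteratedFDerivWithin_of_isOpen i hO hxO, Finset.sum_mul]
  refine (norm_iteratedFDerivWithin_mul_le (N := i) (hψ.of_le (mod_cast le_top))
    (hF.comp_contDiffOn (hτ.of_le (mod_cast le_top))) hO.uniqueDiffOn hxO le_rfl).trans
    (Finset.sum_le_sum fun l hl => ?_)
  have hl' : l ≤ i := by have := Finset.mem_range.1 hl; omega
  calc _ ≤ (i.choose l : ℝ) * A * ((i - l).factorial * p * B ^ (i - l)) := by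
        gcongr
        · exact hA l hl' x hx
        · exact hg (i - l) (by omega)
    _ = _ := by ring

variable {n : ℕ} {Γ : Type*} [TopologicalSpace Γ]

/-- The function `η · (F ∘ α)` on `Γ` obtained from a function `F` on `ℝⁿ`, a chart `α` and a
cutoff function `η` supported in the domain of the chart. -/
def cutoffComp (η : Γ → ℝ) (α : OpenPartialHomeomorph Γ (EuclSp n)) (F : EuclSp n → ℂ) : Γ → ℂ :=
  fun y => (η y : ℂ) * F (α y)

variable [ChartedSpace (EuclSp n) Γ]

theorem contMDiff_cutoffComp {η : Γ → ℝ} (hη : ContMDiff (𝓡 n) 𝓘(ℝ, ℝ) ∞ η)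
    {α : OpenPartialHomeomorph Γ (EuclSp n)} (hα : α ∈ IsManifold.maximalAtlas (𝓡 n) ∞ Γ)
    (hs : tsupport η ⊆ α.source) {k : ℕ∞} {F : EuclSp n → ℂ} (hF : ContDiff ℝ k F) :
    ContMDiff (𝓡 n) 𝓘(ℝ, ℂ) k (cutoffComp η α F) := by
  refine contMDiff_of_tsupport fun y hy => ?_
  have hy' : y ∈ α.source := by
    refine hs (closure_mono ?_ hy)
    intro z hz hz'
    simp [cutoffComp, hz'] at hz
  have hαy : ContMDiffAt (𝓡 n) (𝓡 n) k α y :=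
    ((contMDiffOn_of_mem_maximalAtlas hα).contMDiffAt (α.open_source.mem_nhds hy')).of_le
      (mod_cast le_top)
  have hηy : ContMDiffAt (𝓡 n) 𝓘(ℝ, ℂ) k (fun y => (η y : ℂ)) y :=
    ((Complex.ofRealCLM.contDiff (n := ∞)).contMDiff.comp hη).contMDiffAt.of_le (mod_cast le_top)
  exact (contDiff_mul (𝕜 := ℝ) (n := k) (𝔸 := ℂ)).contMDiff.contMDiffAt.comp y
    (hηy.prodMk_space (hF.contMDiff.contMDiffAt.comp y hαy))

theorem contDiffAt_comp_chart_symm {β : OpenPartialHomeomorph Γ (EuclSp n)}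
    (hβ : β ∈ IsManifold.maximalAtlas (𝓡 n) ∞ Γ) {k : ℕ∞} {f : Γ → ℂ}
    (hf : ContMDiff (𝓡 n) 𝓘(ℝ, ℂ) k f) {x : EuclSp n} (hx : x ∈ β.target) :
    ContDiffAt ℝ k (f ∘ β.symm) x := by
  have h2 : ContMDiffAt (𝓡 n) (𝓡 n) k β.symm x :=
    ((contMDiffOn_symm_of_mem_maximalAtlas hβ).contMDiffAt
      (β.open_target.mem_nhds hx)).of_le (mod_cast le_top)
  exact (hf.contMDiffAt.comp x h2).contDiffAt

/-- The derivatives of `η · (F ∘ α)` in another chart are bounded by those of `F`. -/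
theorem exists_cutoffComp_bound {η : Γ → ℝ}
    (hη : ContMDiff (𝓡 n) 𝓘(ℝ, ℝ) ∞ η)
    {α : OpenPartialHomeomorph Γ (EuclSp n)} (hα : α ∈ IsManifold.maximalAtlas (𝓡 n) ∞ Γ)
    (hs : tsupport η ⊆ α.source) {β : OpenPartialHomeomorph Γ (EuclSp n)}
    (hβ : β ∈ IsManifold.maximalAtlas (𝓡 n) ∞ Γ) {K : Set (EuclSp n)} (hK : IsCompact K)
    (hKβ : K ⊆ β.target) (i : ℕ) :
    ∃ C : ℝ, 0 ≤ C ∧ ∀ F : EuclSp n → ℂ, ContDiff ℝ i F → ∀ p : ℝ,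
      0 ≤ p → (∀ l ≤ i, ∀ z ∈ α '' tsupport η, ‖iteratedFDeriv ℝ l F z‖ ≤ p) →
      ∀ x ∈ K, ‖iteratedFDeriv ℝ i (cutoffComp η α F ∘ β.symm) x‖ ≤ C * p := by
  set O : Set (EuclSp n) := β.target ∩ β.symm ⁻¹' α.source
  have hO : IsOpen O := β.isOpen_inter_preimage_symm α.open_source
  set K' : Set (EuclSp n) := K ∩ β.symm ⁻¹' (tsupport η)
  have hK' : IsCompact K' := by
    have h1 : IsClosed K' :=
      (β.continuousOn_symm.mono hKβ).preimage_isClosed_of_isClosed hK.isClosed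
        (isClosed_tsupport _)
    exact hK.of_isClosed_subset h1 inter_subset_left
  have hK'O : K' ⊆ O := fun x hx => ⟨hKβ hx.1, hs hx.2⟩
  have hsymm : ContMDiffOn (𝓡 n) (𝓡 n) ∞ β.symm O :=
    (contMDiffOn_symm_of_mem_maximalAtlas hβ).mono inter_subset_left
  have hψ : ContDiffOn ℝ ∞ (fun x => (η (β.symm x) : ℂ)) O := by
    intro x hx
    have h0 : ContMDiff (𝓡 n) 𝓘(ℝ, ℂ) ∞ (fun y => (η y : ℂ)) :=
      (Complex.ofRealCLM.contDiff (n := ∞)).contMDiff.comp hη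
    have h1 := h0.contMDiffAt.comp_contMDiffWithinAt x (hsymm x hx)
    exact h1.contDiffWithinAt
  have hτ : ContDiffOn ℝ ∞ (fun x => α (β.symm x)) O := by
    intro x hx
    have h1 := ((contMDiffOn_of_mem_maximalAtlas hα).contMDiffAt
      (α.open_source.mem_nhds hx.2)).comp_contMDiffWithinAt x (hsymm x hx)
    exact h1.contDiffWithinAt
  obtain ⟨C, hC0, hC⟩ := exists_iteratedFDeriv_cutoff_bound hO hK' hK'O hψ hτ i
  refine ⟨C, hC0, fun F hF p hp hFp x hx => ?_⟩
  by_cases hxs : β.symm x ∈ tsupport η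
  · exact hC F hF p x ⟨hx, hxs⟩ fun l hl => hFp l hl _ (mem_image_of_mem _ hxs)
  · have h1 : (cutoffComp η α F ∘ β.symm) =ᶠ[𝓝 x] fun _ => 0 := by
      have h2 : ∀ᶠ z in 𝓝 x, β.symm z ∉ tsupport η :=
        (β.continuousAt_symm (hKβ hx)).eventually
          ((isClosed_tsupport _).isOpen_compl.mem_nhds hxs)
      filter_upwards [h2] with z hz
      have h3 : η (β.symm z) = 0 := image_eq_zero_of_notMem_tsupport hz
      simp [cutoffComp, h3]
    rw [(Filter.EventuallyEq.iteratedFDeriv ℝ h1 i).eq_of_nhds]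
    have h4 : iteratedFDeriv ℝ i (fun _ : EuclSp n => (0 : ℂ)) x = 0 := by
      simp
    rw [h4, norm_zero]
    exact mul_nonneg hC0 hp

theorem exists_smooth_cutoff [T2Space Γ] [CompactSpace Γ] [IsManifold (𝓡 n) ∞ Γ] {C U : Set Γ}
    (hC : IsClosed C) (hU : IsOpen U) (hCU : C ⊆ U) :
    ∃ η : Γ → ℝ, ContMDiff (𝓡 n) 𝓘(ℝ, ℝ) ∞ η ∧ tsupport η ⊆ U ∧ ∀ᶠ y in 𝓝ˢ C, η y = 1 := by
  obtain ⟨f, h0, h1, -⟩ := exists_contMDiffMap_zero_one_nhds_of_isClosed (𝓡 n) (n := ⊤)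
    hU.isClosed_compl hC (disjoint_compl_left_iff_subset.2 hCU)
  refine ⟨f, f.contMDiff, fun y hy => ?_, h1⟩
  by_contra hyU
  have h2 : (f : Γ → ℝ) =ᶠ[𝓝 y] 0 := h0.filter_mono (nhds_le_nhdsSet (mem_compl hyU))
  exact (notMem_tsupport_iff_eventuallyEq.2 h2) hy

end CutoffComp

/-! ### The inclusion of `H^{s,φ}(Γ)` into `C^ρ(Γ)` -/

section Inclusion

variable {n : ℕ} {Γ : Type*} [TopologicalSpace Γ] [ChartedSpace (EuclSp n) Γ]

/-- Cutoff functions adapted to an atlas with a partition of unity: each is supported in the domain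
of its chart and equal to one on the support of the corresponding function of the partition. -/
structure AdaptedAtlas.Cutoffs (A : AdaptedAtlas n Γ) where
  /-- the cutoff functions -/
  η : Fin A.r → Γ → ℝ
  contMDiff : ∀ j, ContMDiff (𝓡 n) 𝓘(ℝ, ℝ) ∞ (η j)
  tsupport_subset : ∀ j, tsupport (η j) ⊆ (A.chart j).source
  eq_one : ∀ j, ∀ y ∈ tsupport (A.χ j), η j y = 1

theorem AdaptedAtlas.nonempty_cutoffs [T2Space Γ] [CompactSpace Γ] [IsManifold (𝓡 n) ∞ Γ]
    (A : AdaptedAtlas n Γ) : Nonempty A.Cutoffs := by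
  choose η h1 h2 h3 using fun j => exists_smooth_cutoff (n := n) (isClosed_tsupport (A.χ j))
    (A.chart j).open_source (A.χ_subordinate j)
  exact ⟨⟨η, h1, h2, fun j y hy => (h3 j).self_of_nhdsSet y hy⟩⟩

/-- The Hilbert sum of the spaces `L₂(ℝⁿ)` over the charts of an atlas. -/
abbrev AdaptedAtlas.L2Sum (A : AdaptedAtlas n Γ) : Type :=
  PiLp 2 (fun _ : Fin A.r => Lp ℂ 2 (volume : Measure (EuclSp n)))

variable {A : AdaptedAtlas n Γ} {s : ℝ} {φ : ℝ → ℝ} {ρ : ℕ}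

theorem contMDiff_sum_cutoffComp (c : A.Cutoffs) {k : ℕ∞} {F : Fin A.r → EuclSp n → ℂ}
    (hF : ∀ j, ContDiff ℝ k (F j)) : ContMDiff (𝓡 n) 𝓘(ℝ, ℂ) k
      (∑ j, cutoffComp (c.η j) (A.chart j) (F j)) :=
  Submodule.sum_mem (ckSubmodule n Γ k) fun j _ =>
    contMDiff_cutoffComp (c.contMDiff j) (A.chart_mem j) (c.tsupport_subset j) (hF j)

/-- The map which recovers a `C^ρ` function on `Γ` from the weighted Fourier transforms of its local
representations. -/
noncomputable def synthesisOn (hφ : SlowlyVaryingClass φ)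
    (hK : MemLp (fun ξ : EuclSp n => japaneseBracket ξ ^ ρ / refinedWeight s φ ξ) 2 volume)
    (c : A.Cutoffs) : A.L2Sum →ₗ[ℂ] CkSpace n Γ (ρ : ℕ∞) where
  toFun g := ⟨∑ j, cutoffComp (c.η j) (A.chart j) (weightedSynthesis s φ (g j)),
    contMDiff_sum_cutoffComp c fun j => contDiff_weightedSynthesis hφ hK (Lp.memLp (g j))⟩
  map_add' g g' := Subtype.ext <| by
    change (∑ j, cutoffComp (c.η j) (A.chart j) (weightedSynthesis s φ ((g + g') j)) : Γ → ℂ) =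
      (∑ j, cutoffComp (c.η j) (A.chart j) (weightedSynthesis s φ (g j))) +
        ∑ j, cutoffComp (c.η j) (A.chart j) (weightedSynthesis s φ (g' j))
    rw [← Finset.sum_add_distrib]
    refine Finset.sum_congr rfl fun j _ => ?_
    have h : weightedSynthesis s φ ((g + g') j) =
        weightedSynthesis s φ (g j) + weightedSynthesis s φ (g' j) := by
      rw [← weightedSynthesis_add hφ hK (Lp.memLp (g j)) (Lp.memLp (g' j))]
      exact weightedSynthesis_congr_ae s φ (Lp.coeFn_add (g j) (g' j))
    rw [h]
    ext y
    simp [cutoffComp, mul_add]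
  map_smul' a g := Subtype.ext <| by
    change (∑ j, cutoffComp (c.η j) (A.chart j) (weightedSynthesis s φ ((a • g) j)) : Γ → ℂ) =
      a • ∑ j, cutoffComp (c.η j) (A.chart j) (weightedSynthesis s φ (g j))
    rw [Finset.smul_sum]
    refine Finset.sum_congr rfl fun j _ => ?_
    have h : weightedSynthesis s φ ((a • g) j) = a • weightedSynthesis s φ (g j) := by
      rw [← weightedSynthesis_smul]
      exact weightedSynthesis_congr_ae s φ (Lp.coeFn_smul a (g j))
    rw [h]
    ext y
    simp [cutoffComp, mul_left_comm]

theorem synthesisOn_apply (hφ : SlowlyVaryingClass φ)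
    (hK : MemLp (fun ξ : EuclSp n => japaneseBracket ξ ^ ρ / refinedWeight s φ ξ) 2 volume)
    (c : A.Cutoffs) (g : A.L2Sum) (y : Γ) : synthesisOn hφ hK c g y =
      ∑ j, cutoffComp (c.η j) (A.chart j) (weightedSynthesis s φ (g j)) y := by
  change (∑ j, cutoffComp (c.η j) (A.chart j) (weightedSynthesis s φ (g j))) y = _
  rw [Finset.sum_apply]

/-- The synthesis map is continuous on bounded sets in the weak topology. -/
theorem continuous_synthesisOn_of_weak [CompactSpace Γ] (hφ : SlowlyVaryingClass φ)
    (hK : MemLp (fun ξ : EuclSp n => japaneseBracket ξ ^ ρ / refinedWeight s φ ξ) 2 volume)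
    (c : A.Cutoffs) {Y : Type*} [TopologicalSpace Y] {γ : Y → A.L2Sum} {R : ℝ}
    (hR : ∀ y, ‖γ y‖ ≤ R) (hγ : ∀ a, Continuous fun y => inner ℂ a (γ y)) :
    Continuous fun y => synthesisOn hφ hK c (γ y) := by
  have hRj : ∀ j y, ‖γ y j‖ ≤ R := fun j y => (PiLp.norm_apply_le _ j).trans (hR y)
  have hγj : ∀ j a, Continuous fun y => inner ℂ a (γ y j) := by
    intro j a
    set P := PiLp.proj (𝕜 := ℂ) 2 (fun _ : Fin A.r => Lp ℂ 2 (volume : Measure (EuclSp n))) j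
    -- Weak continuity passes to each component by testing against the adjoint of the coordinate
    -- projection.
    refine (hγ (ContinuousLinearMap.adjoint P a)).congr fun y => ?_
    rw [ContinuousLinearMap.adjoint_inner_left]
    rfl
  refine continuous_iInf_rng.2 fun β => continuous_iInf_rng.2 fun hβ =>
    continuous_iInf_rng.2 fun i => continuous_iInf_rng.2 fun hi => continuous_induced_rng.2 ?_
  have hi' : i ≤ ρ := by exact_mod_cast hi
  refine continuous_iff_continuousAt.2 fun y₀ => ?_
  rw [ContinuousAt, UniformOnFun.tendsto_iff_tendstoUniformlyOn]
  rintro K ⟨hKc, hKβ⟩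
  choose C hC0 hC using fun j => exists_cutoffComp_bound (c.contMDiff j) (A.chart_mem j)
    (c.tsupport_subset j) hβ hKc hKβ i
  rw [Metric.tendstoUniformlyOn_iff]
  intro ε hε
  -- The `j`-th chart will contribute at most `C j * δ`; the summand `1` keeps the denominator
  -- positive and the final inequality strict.
  set δ : ℝ := ε / (1 + ∑ j, C j)
  have hsum0 : 0 ≤ ∑ j, C j := Finset.sum_nonneg fun j _ => hC0 j
  have hδ : 0 < δ := by positivity
  have hS : ∀ y j, ContDiff ℝ ρ (weightedSynthesis s φ (γ y j)) := fun y j =>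
    contDiff_weightedSynthesis hφ hK (Lp.memLp _)
  have hev : ∀ᶠ y in 𝓝 y₀, ∀ j, ∀ l ∈ Finset.range (i + 1),
      ∀ z ∈ A.chart j '' tsupport (c.η j),
        ‖iteratedFDeriv ℝ l (weightedSynthesis s φ (γ y j)) z -
          iteratedFDeriv ℝ l (weightedSynthesis s φ (γ y₀ j)) z‖ < δ := by
    refine eventually_all.2 fun j => (Finset.eventually_all _).2 fun l hl => ?_
    have hl' : l ≤ ρ := by have := Finset.mem_range.1 hl; omega
    have hcpt : IsCompact (A.chart j '' tsupport (c.η j)) :=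
      (isClosed_tsupport _).isCompact.image_of_continuousOn
        ((A.chart j).continuousOn.mono (c.tsupport_subset j))
    -- Compactness turns continuity jointly in the point and the parameter into a neighbourhood of
    -- `y₀` that serves all points `z` at once.
    refine hcpt.eventually_forall_of_forall_eventually fun z _ => ?_
    have hD := continuous_iteratedFDeriv_weightedSynthesis hφ hK (hRj j) (hγj j) hl'
    have hcont : Continuous fun q : Y × EuclSp n =>
        ‖iteratedFDeriv ℝ l (weightedSynthesis s φ (γ q.1 j)) q.2 -
          iteratedFDeriv ℝ l (weightedSynthesis s φ (γ y₀ j)) q.2‖ :=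
      ((hD.comp continuous_swap).sub
        (hD.comp (continuous_snd.prodMk continuous_const))).norm
    exact hcont.tendsto (y₀, z) |>.eventually (gt_mem_nhds (by simpa using hδ))
  filter_upwards [hev] with y hy x hx
  have hterm : ∀ (y : Y) (j : Fin A.r), ContDiffAt ℝ i
      (cutoffComp (c.η j) (A.chart j) (weightedSynthesis s φ (γ y j)) ∘ β.symm) x := fun y j =>
    (contDiffAt_comp_chart_symm hβ (contMDiff_cutoffComp (c.contMDiff j) (A.chart_mem j)
      (c.tsupport_subset j) (k := (ρ : ℕ∞)) (hS y j)) (hKβ hx)).of_le (mod_cast hi')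
  have hexp : ∀ y, iteratedFDeriv ℝ i ((synthesisOn hφ hK c (γ y) : Γ → ℂ) ∘ β.symm) x =
      ∑ j, iteratedFDeriv ℝ i
        (cutoffComp (c.η j) (A.chart j) (weightedSynthesis s φ (γ y j)) ∘ β.symm) x := by
    intro y
    have hfun : (synthesisOn hφ hK c (γ y) : Γ → ℂ) ∘ β.symm = fun z => ∑ j,
        (cutoffComp (c.η j) (A.chart j) (weightedSynthesis s φ (γ y j)) ∘ β.symm) z := by
      ext z
      exact synthesisOn_apply hφ hK c (γ y) _
    rw [hfun]
    exact iteratedFDeriv_fun_sum_apply fun j _ => hterm y j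
  rw [dist_comm, dist_eq_norm]
  change ‖iteratedFDeriv ℝ i ((synthesisOn hφ hK c (γ y) : Γ → ℂ) ∘ β.symm) x -
    iteratedFDeriv ℝ i ((synthesisOn hφ hK c (γ y₀) : Γ → ℂ) ∘ β.symm) x‖ < ε
  rw [hexp, hexp, ← Finset.sum_sub_distrib]
  have hle : ∀ j, ‖iteratedFDeriv ℝ i
        (cutoffComp (c.η j) (A.chart j) (weightedSynthesis s φ (γ y j)) ∘ β.symm) x -
      iteratedFDeriv ℝ i
        (cutoffComp (c.η j) (A.chart j) (weightedSynthesis s φ (γ y₀ j)) ∘ β.symm) x‖ ≤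
      C j * δ := by
    intro j
    rw [← iteratedFDeriv_sub_apply (hterm y j) (hterm y₀ j)]
    have hfun : cutoffComp (c.η j) (A.chart j) (weightedSynthesis s φ (γ y j)) ∘ β.symm -
        cutoffComp (c.η j) (A.chart j) (weightedSynthesis s φ (γ y₀ j)) ∘ β.symm =
        cutoffComp (c.η j) (A.chart j)
          (weightedSynthesis s φ (γ y j) - weightedSynthesis s φ (γ y₀ j)) ∘ β.symm := by
      ext z
      simp [cutoffComp, mul_sub]
    rw [hfun]
    refine hC j _ (((hS y j).sub (hS y₀ j)).of_le (mod_cast hi')) δ hδ.le (fun l hl z hz => ?_) x hx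
    change ‖iteratedFDeriv ℝ l
      (weightedSynthesis s φ (γ y j) - weightedSynthesis s φ (γ y₀ j)) z‖ ≤ δ
    rw [iteratedFDeriv_sub_apply ((hS y j).of_le (mod_cast hl.trans hi')).contDiffAt
      ((hS y₀ j).of_le (mod_cast hl.trans hi')).contDiffAt]
    exact (hy j l (Finset.mem_range.2 (by omega)) z hz).le
  calc _ ≤ ∑ j, C j * δ := (norm_sum_le _ _).trans (Finset.sum_le_sum fun j _ => hle j)
    _ = (∑ j, C j) * δ := by rw [Finset.sum_mul]
    _ < (1 + ∑ j, C j) * δ := by nlinarith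
    _ = ε := by simp only [δ]; field_simp

end Inclusion

/-! ### Identification, continuity and compactness of the inclusion -/

section InclusionProperties

theorem hasCompactSupport_comp_chart_symm {n : ℕ} {Γ : Type*} [TopologicalSpace Γ]
    [CompactSpace Γ] {η : Γ → ℝ} {α : OpenPartialHomeomorph Γ (EuclSp n)}
    (hs : tsupport η ⊆ α.source) (hα : α.target = univ) {F : EuclSp n → ℂ}
    (hF : ∀ x, η (α.symm x) = 0 → F x = 0) : HasCompactSupport F := by
  refine HasCompactSupport.intro ((isClosed_tsupport η).isCompact.image_of_continuousOn
    (α.continuousOn.mono hs)) fun x hx => hF x ?_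
  by_contra h
  exact hx ⟨α.symm x, subset_tsupport _ h, α.right_inv (by simp [hα])⟩

variable {n : ℕ} {Γ : Type*} [TopologicalSpace Γ] [ChartedSpace (EuclSp n) Γ]
  [CompactSpace Γ] [MeasurableSpace Γ]
  {A : AdaptedAtlas n Γ} {d : SmoothDensity n Γ} {s : ℝ} {φ : ℝ → ℝ} {ρ : ℕ}

/-- A smooth function is the sum of test functions in the charts of the atlas. -/
theorem exists_sum_chartTest_eq (c : A.Cutoffs) (w : CkSpace n Γ ⊤) :
    ∃ g : Fin A.r → 𝓢(EuclSp n, ℂ), (∀ j x, g j x = (c.η j ((A.chart j).symm x) : ℂ) *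
      conj (w ((A.chart j).symm x)) * (d.dens (A.chart j) x : ℂ)) ∧
      ∑ j, chartTest A d j (g j) = w := by
  have hw : ContMDiff (𝓡 n) 𝓘(ℝ, ℂ) ∞ (w : Γ → ℂ) := w.2
  have hcs : ∀ j, HasCompactSupport fun x => (c.η j ((A.chart j).symm x) : ℂ) *
      conj (w ((A.chart j).symm x)) * (d.dens (A.chart j) x : ℂ) := fun j =>
    hasCompactSupport_comp_chart_symm (c.tsupport_subset j) (A.chart_target j) fun x hx => by
      simp [hx]
  have hcd : ∀ j, ContDiff ℝ ∞ fun x => (c.η j ((A.chart j).symm x) : ℂ) *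
      conj (w ((A.chart j).symm x)) * (d.dens (A.chart j) x : ℂ) := by
    intro j
    refine contDiff_iff_contDiffAt.2 fun x => ?_
    have hx : x ∈ (A.chart j).target := by rw [A.chart_target j]; trivial
    have h1 : ContDiffAt ℝ ∞ (fun x => (c.η j ((A.chart j).symm x) : ℂ)) x :=
      contDiffAt_comp_chart_symm (k := ⊤) (f := fun y => (c.η j y : ℂ)) (A.chart_mem j)
        ((Complex.ofRealCLM.contDiff (n := ∞)).contMDiff.comp (c.contMDiff j)) hx
    have h2 : ContDiffAt ℝ ∞ (fun x => w ((A.chart j).symm x)) x :=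
      contDiffAt_comp_chart_symm (k := ⊤) (A.chart_mem j) hw hx
    have h3 : ContDiffAt ℝ ∞ (fun x => (d.dens (A.chart j) x : ℂ)) x :=
      Complex.ofRealCLM.contDiff.contDiffAt.comp x
        ((d.contDiffOn_dens _ (A.chart_mem j)).contDiffAt
          ((A.chart j).open_target.mem_nhds hx))
    exact (h1.mul (Complex.conjCLE.contDiff.contDiffAt.comp x h2)).mul h3
  refine ⟨fun j => (hcs j).toSchwartzMap (hcd j), fun j x => rfl, Subtype.ext (funext fun y => ?_)⟩
  -- `chartTest` conjugates, multiplies by `χ_j` and divides by the density. The conjugate and the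
  -- density in the Schwartz function undo this, and `η_j = 1` on the support of `χ_j`; summation
  -- over `j` then gives `w`.
  have hterm : ∀ j, chartTest A d j ((hcs j).toSchwartzMap (hcd j)) y = (A.χ j y : ℂ) * w y := by
    intro j
    change ((A.χ j y * (d.dens (A.chart j) (A.chart j y))⁻¹ : ℝ) : ℂ) *
      conj ((c.η j ((A.chart j).symm (A.chart j y)) : ℂ) *
        conj (w ((A.chart j).symm (A.chart j y))) * (d.dens (A.chart j) (A.chart j y) : ℂ)) = _
    by_cases hy : y ∈ tsupport (A.χ j)
    · have hys := A.χ_subordinate j hy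
      have hd := d.dens_pos _ (A.chart_mem j) _ ((A.chart j).map_source hys)
      rw [(A.chart j).left_inv hys, c.eq_one j y hy]
      simp only [Complex.ofReal_one, one_mul, map_mul, Complex.conj_conj, Complex.conj_ofReal,
        Complex.ofReal_mul, Complex.ofReal_inv]
      have : (d.dens (A.chart j) (A.chart j y) : ℂ) ≠ 0 := Complex.ofReal_ne_zero.2 hd.ne'
      field_simp
    · have h0 : A.χ j y = 0 := image_eq_zero_of_notMem_tsupport hy
      simp [h0]
  have hsum : (∑ j, chartTest A d j ((hcs j).toSchwartzMap (hcd j))).1 y =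
      ∑ j, chartTest A d j ((hcs j).toSchwartzMap (hcd j)) y := by
    have h := map_sum (Submodule.subtype (ckSubmodule n Γ ⊤))
      (fun j => chartTest A d j ((hcs j).toSchwartzMap (hcd j))) Finset.univ
    exact (congrFun h y).trans (Finset.sum_apply _ _ _)
  rw [hsum, Finset.sum_congr rfl fun j _ => hterm j, ← Finset.sum_mul]
  have h1 := A.χ.sum_eq_one (mem_univ y)
  rw [finsum_eq_sum_of_fintype] at h1
  rw [← Complex.ofReal_sum, h1, Complex.ofReal_one, one_mul]

variable [T2Space Γ] [IsManifold (𝓡 n) ∞ Γ] [BorelSpace Γ]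

/-- An element of `H^{s,φ}(Γ)` is the function recovered by the synthesis map. -/
theorem toDistribution_eq_integral_synthesisOn (hφ : SlowlyVaryingClass φ)
    (hK : MemLp (fun ξ : EuclSp n => japaneseBracket ξ ^ ρ / refinedWeight s φ ξ) 2 volume)
    (c : A.Cutoffs) (h : RefinedSpaceOn A d s φ) (w : CkSpace n Γ ⊤) :
    h.toDistribution w =
      ∫ x, synthesisOn hφ hK c (RefinedSpaceOn.toL2 A d s φ h) x * conj (w x) ∂d.measure := by
  have := d.isFiniteMeasure
  obtain ⟨g, hg, hgw⟩ := exists_sum_chartTest_eq (d := d) c w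
  have hw : Continuous (w : Γ → ℂ) := ContMDiff.continuous (n := ∞) w.2
  set S : Fin A.r → EuclSp n → ℂ := fun j =>
    weightedSynthesis s φ (RefinedSpaceOn.toL2 A d s φ h j) with hS
  have hcont : ∀ j, Continuous (cutoffComp (c.η j) (A.chart j) (S j)) := fun j =>
    (contMDiff_cutoffComp (c.contMDiff j) (A.chart_mem j) (c.tsupport_subset j) (k := (ρ : ℕ∞))
      (contDiff_weightedSynthesis hφ hK (Lp.memLp _))).continuous
  have hwc : Continuous fun x => conj (w x) := Complex.continuous_conj.comp hw
  have hInt : ∀ j, Integrable (fun x => cutoffComp (c.η j) (A.chart j) (S j) x * conj (w x))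
      d.measure := fun j =>
    ((hcont j).mul hwc).integrable_of_hasCompactSupport (HasCompactSupport.of_compactSpace _)
  simp_rw [synthesisOn_apply, Finset.sum_mul]
  rw [integral_finsetSum _ fun j _ => hInt j]
  conv_lhs => rw [← hgw, map_sum]
  refine Finset.sum_congr rfl fun j _ => ?_
  have h1 : h.toDistribution (chartTest A d j (g j)) = ∫ x, g j x * S j x :=
    apply_eq_integral_weightedSynthesis hφ hK (h.2 j) (g j)
  rw [h1]
  refine Eq.trans ?_ (d.integral_eq_integral_chart (A.chart_mem j)
    ((hcont j).mul hwc).continuousOn ?_).symm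
  · rw [A.chart_target j, setIntegral_univ]
    refine integral_congr_ae (ae_of_all _ fun x => ?_)
    have hx : x ∈ (A.chart j).target := by rw [A.chart_target j]; trivial
    simp only [hg, cutoffComp, Pi.mul_apply, (A.chart j).right_inv hx]
    ring
  · intro y hy
    have h0 : c.η j y = 0 := image_eq_zero_of_notMem_tsupport fun h => hy (c.tsupport_subset j h)
    simp [cutoffComp, h0]

/-- Two continuous functions defining the same distribution coincide, so there is only one candidate
for the inclusion and its properties can be read off from the synthesis map. -/
theorem RefinedSpaceOn.IsInclusion.eq_synthesisOn (hφ : SlowlyVaryingClass φ)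
    (hK : MemLp (fun ξ : EuclSp n => japaneseBracket ξ ^ ρ / refinedWeight s φ ξ) 2 volume)
    (c : A.Cutoffs) {T : RefinedSpaceOn A d s φ → CkSpace n Γ (ρ : ℕ∞)}
    (hT : RefinedSpaceOn.IsInclusion T) (h : RefinedSpaceOn A d s φ) :
    T h = synthesisOn hφ hK c (RefinedSpaceOn.toL2 A d s φ h) :=
  Subtype.ext <| d.eq_of_forall_integral_eq (ContMDiff.continuous (n := (ρ : ℕ∞)) (T h).2)
    (ContMDiff.continuous (n := (ρ : ℕ∞)) (synthesisOn hφ hK c _).2) fun w =>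
    (hT h w).symm.trans (toDistribution_eq_integral_synthesisOn hφ hK c h w)

/-- The inclusion `H^{s,φ}(Γ) → C^ρ(Γ)` exists and is continuous if `⟨ξ⟩^ρ / (⟨ξ⟩^s φ(⟨ξ⟩))` is
square integrable. -/
theorem exists_continuous_inclusion (hφ : SlowlyVaryingClass φ)
    (hK : MemLp (fun ξ : EuclSp n => japaneseBracket ξ ^ ρ / refinedWeight s φ ξ) 2 volume) :
    ∃ T : RefinedSpaceOn A d s φ →L[ℂ] CkSpace n Γ (ρ : ℕ∞), RefinedSpaceOn.IsInclusion T := by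
  obtain ⟨c⟩ := A.nonempty_cutoffs
  refine ⟨⟨synthesisOn hφ hK c ∘ₗ RefinedSpaceOn.toL2 A d s φ, ?_⟩,
    fun h w => toDistribution_eq_integral_synthesisOn hφ hK c h w⟩
  refine continuous_iff_continuousAt.2 fun h₀ => ?_
  have hL2 : Continuous (RefinedSpaceOn.toL2 A d s φ) :=
    AddMonoidHomClass.continuous_of_bound _ 1 fun h => by rw [one_mul]; exact le_rfl
  -- The continuity of the synthesis map is available only along bounded families, hence the
  -- restriction to a ball; norm continuity of `toL2` is more than the weak continuity required.
  have hball : ContinuousOn (fun h => synthesisOn hφ hK c (RefinedSpaceOn.toL2 A d s φ h))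
      (Metric.ball h₀ 1) := by
    rw [continuousOn_iff_continuous_domRestrict]
    refine continuous_synthesisOn_of_weak hφ hK c (R := ‖h₀‖ + 1)
      (γ := fun y : Metric.ball h₀ 1 => RefinedSpaceOn.toL2 A d s φ y) (fun y => ?_) fun a => ?_
    · have h1 := mem_ball_iff_norm.1 y.2
      have h2 := norm_le_norm_add_norm_sub' (y : RefinedSpaceOn A d s φ) h₀
      change ‖(y : RefinedSpaceOn A d s φ)‖ ≤ _
      linarith
    · exact continuous_const.inner (hL2.comp continuous_subtype_val)
  exact hball.continuousAt (Metric.ball_mem_nhds h₀ one_pos)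

/-- Every inclusion `H^{s,φ}(Γ) → C^ρ(Γ)` is compact if `⟨ξ⟩^ρ / (⟨ξ⟩^s φ(⟨ξ⟩))` is square
integrable. -/
theorem RefinedSpaceOn.IsInclusion.isCompactOperator (hφ : SlowlyVaryingClass φ)
    (hK : MemLp (fun ξ : EuclSp n => japaneseBracket ξ ^ ρ / refinedWeight s φ ξ) 2 volume)
    {T : RefinedSpaceOn A d s φ → CkSpace n Γ (ρ : ℕ∞)} (hT : RefinedSpaceOn.IsInclusion T) :
    IsCompactOperator T := by
  obtain ⟨c⟩ := A.nonempty_cutoffs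
  -- By Banach–Alaoglu and the Riesz isomorphism this is the unit ball of the Hilbert sum with its
  -- compact weak topology. Its image under synthesis is a compact set that contains the image of
  -- the unit ball of `H^{s,φ}(Γ)`.
  set B : Set (WeakDual ℂ A.L2Sum) := WeakDual.toStrongDual ⁻¹' Metric.closedBall 0 1
  have hB : IsCompact B := WeakDual.isCompact_closedBall 0 1
  have : CompactSpace B := isCompact_iff_compactSpace.1 hB
  set γ : B → A.L2Sum := fun y =>
    (InnerProductSpace.toDual ℂ A.L2Sum).symm (WeakDual.toStrongDual (y : WeakDual ℂ A.L2Sum))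
    with hγ
  have hcont : Continuous fun y => synthesisOn hφ hK c (γ y) := by
    refine continuous_synthesisOn_of_weak hφ hK c (R := 1) (fun y => ?_) fun a => ?_
    · rw [hγ, LinearIsometryEquiv.norm_map]
      exact mem_closedBall_zero_iff.1 y.2
    · have h1 : ∀ y : B, inner ℂ a (γ y) = conj ((y : WeakDual ℂ A.L2Sum) a) := by
        intro y
        rw [← inner_conj_symm, hγ, InnerProductSpace.toDual_symm_apply]
        rfl
      simp_rw [h1]
      exact Complex.continuous_conj.comp
        ((WeakDual.eval_continuous a).comp continuous_subtype_val)
  refine ⟨range fun y => synthesisOn hφ hK c (γ y), isCompact_range hcont, ?_⟩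
  filter_upwards [Metric.closedBall_mem_nhds (0 : RefinedSpaceOn A d s φ) one_pos] with h hh
  have hh' : ‖RefinedSpaceOn.toL2 A d s φ h‖ ≤ 1 :=
    (mem_closedBall_zero_iff (a := h)).1 hh
  set y : WeakDual ℂ A.L2Sum := StrongDual.toWeakDual
    (InnerProductSpace.toDual ℂ A.L2Sum (RefinedSpaceOn.toL2 A d s φ h)) with hy
  have hyB : y ∈ B := by
    refine mem_closedBall_zero_iff.2 ?_
    have : WeakDual.toStrongDual y =
      InnerProductSpace.toDual ℂ A.L2Sum (RefinedSpaceOn.toL2 A d s φ h) := rfl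
    rw [this, LinearIsometryEquiv.norm_map]
    exact hh'
  refine ⟨⟨y, hyB⟩, ?_⟩
  rw [hT.eq_synthesisOn hφ hK c h]
  have : γ ⟨y, hyB⟩ = RefinedSpaceOn.toL2 A d s φ h :=
    (InnerProductSpace.toDual ℂ A.L2Sum).symm_apply_apply _
  rw [← this]

end InclusionProperties

/-! ### Estimates of weighted norms by integer order Sobolev norms -/

section WeightedEstimates

open LineDeriv

variable {n : ℕ}

theorem norm_fourier_iteratedLineDeriv (N : ℕ) (e : EuclSp n) (G : 𝓢(EuclSp n, ℂ)) (ξ : EuclSp n) :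
    ‖𝓕 (∂^{fun _ : Fin N => e} G) ξ‖ = (2 * Real.pi * |inner ℝ ξ e|) ^ N * ‖𝓕 G ξ‖ := by
  induction N with
  | zero => simp
  | succ N ih =>
    have he : (fun ξ : EuclSp n => inner ℝ ξ e).HasTemperateGrowth := by fun_prop
    rw [iteratedLineDerivOp_succ_left, SchwartzMap.fourier_lineDerivOp_eq, smul_apply,
      SchwartzMap.smulLeftCLM_apply_apply he, norm_smul, norm_smul]
    have ht : Fin.tail (fun _ : Fin (N + 1) => e) = fun _ : Fin N => e := rfl
    rw [ht, ih, pow_succ]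
    simp only [norm_mul, Complex.norm_ofNat, Complex.norm_real, Complex.norm_I, mul_one,
      Real.norm_eq_abs, abs_of_pos Real.pi_pos]
    ring

/-- The power mean inequality for the squares of the coordinates; it makes the pure derivatives
along the axes sufficient. -/
theorem norm_sq_pow_le_sum_coord (hn : 1 ≤ n) (K : ℕ) (ξ : EuclSp n) :
    (‖ξ‖ ^ 2) ^ (K + 1) ≤ (n : ℝ) ^ K * ∑ i, (ξ i ^ 2) ^ (K + 1) := by
  have h := pow_sum_div_card_le_sum_pow (s := Finset.univ) (f := fun i => ξ i ^ 2)
    (fun i _ => sq_nonneg _) K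
  have hn0 : (0 : ℝ) < (n : ℝ) ^ K := by positivity
  rw [Finset.card_univ, Fintype.card_fin, div_le_iff₀ hn0, mul_comm] at h
  rwa [EuclideanSpace.real_norm_sq_eq]

/-- `‖ξ‖^{2N} |Ĝ(ξ)|²` is bounded by the Fourier transforms of the pure derivatives. -/
theorem norm_pow_mul_norm_fourier_sq_le (hn : 1 ≤ n) (K : ℕ) (G : 𝓢(EuclSp n, ℂ)) (ξ : EuclSp n) :
    (‖ξ‖ ^ 2) ^ (K + 1) * ‖𝓕 G ξ‖ ^ 2 ≤ (n : ℝ) ^ K * ∑ i : Fin n,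
      ‖𝓕 (∂^{fun _ : Fin (K + 1) => EuclideanSpace.single i (1 : ℝ)} G) ξ‖ ^ 2 := by
  calc _ ≤ ((n : ℝ) ^ K * ∑ i, (ξ i ^ 2) ^ (K + 1)) * ‖𝓕 G ξ‖ ^ 2 := by
        gcongr
        exact norm_sq_pow_le_sum_coord hn K ξ
    _ = (n : ℝ) ^ K * ∑ i, (ξ i ^ 2) ^ (K + 1) * ‖𝓕 G ξ‖ ^ 2 := by
        rw [mul_assoc, Finset.sum_mul]
    _ ≤ _ := by
        gcongr with i
        rw [norm_fourier_iteratedLineDeriv, mul_pow,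
          pow_right_comm (2 * Real.pi * |_|)]
        refine mul_le_mul_of_nonneg_right (pow_le_pow_left₀ (sq_nonneg _) ?_ _) (sq_nonneg _)
        have h1 : inner ℝ ξ (EuclideanSpace.single i (1 : ℝ)) = ξ i := by
          simp [EuclideanSpace.inner_single_right]
        rw [h1, mul_pow, sq_abs]
        have h2 : (1 : ℝ) ≤ (2 * Real.pi) ^ 2 := by nlinarith [Real.pi_gt_three]
        nlinarith [sq_nonneg (ξ i)]

theorem integrable_norm_sq_schwartz (G : 𝓢(EuclSp n, ℂ)) : Integrable fun ξ => ‖G ξ‖ ^ 2 :=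
  (memLp_two_iff_integrable_sq_norm G.continuous.aestronglyMeasurable).1 (G.memLp 2 volume)

theorem integral_norm_sq_le_of_support {H : EuclSp n → ℂ} {S : Set (EuclSp n)} {B V : ℝ}
    (hV : 0 ≤ V) (hH : ∀ x, ‖H x‖ ≤ B) (hS : ∀ x, x ∉ S → H x = 0)
    (hvol : volume S ≤ ENNReal.ofReal V) : ∫ x, ‖H x‖ ^ 2 ≤ B ^ 2 * V := by
  have hlt : volume S < ⊤ := hvol.trans_lt ENNReal.ofReal_lt_top
  rw [← setIntegral_eq_integral_of_forall_compl_eq_zero (s := S) (μ := volume)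
    (f := fun x => ‖H x‖ ^ 2) fun x hx => by simp [hS x hx]]
  refine (le_abs_self _).trans ?_
  refine (norm_setIntegral_le_of_norm_le_const (f := fun x => ‖H x‖ ^ 2) hlt (C := B ^ 2)
    fun x _ => ?_).trans ?_
  · rw [norm_pow, norm_norm]
    exact pow_le_pow_left₀ (norm_nonneg _) (hH x) 2
  · gcongr
    exact ENNReal.toReal_le_of_le_ofReal hV hvol

/-- The rescaled Sobolev norm of a smooth function with small support. -/
theorem integral_one_add_pow_mul_fourier_le (hn : 1 ≤ n) (K : ℕ) (G : 𝓢(EuclSp n, ℂ))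
    {S : Set (EuclSp n)} {B V q : ℝ} (hV : 0 ≤ V) (hq : 1 ≤ q)
    (hS : tsupport G ⊆ S) (hvol : volume S ≤ ENNReal.ofReal V)
    (h0 : ∀ x, ‖G x‖ ≤ B) (hN : ∀ x, ‖iteratedFDeriv ℝ (K + 1) G x‖ ≤ B * q ^ (K + 1)) :
    Integrable (fun ξ => (1 + (japaneseBracket ξ / q) ^ (2 * (K + 1))) * ‖𝓕 G ξ‖ ^ 2) ∧
    ∫ ξ, (1 + (japaneseBracket ξ / q) ^ (2 * (K + 1))) * ‖𝓕 G ξ‖ ^ 2 ≤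
      (1 + 2 ^ (K + 1) + 2 ^ (K + 1) * (n : ℝ) ^ (K + 1)) * (B ^ 2 * V) := by
  set D : Fin n → 𝓢(EuclSp n, ℂ) := fun i =>
    ∂^{fun _ : Fin (K + 1) => EuclideanSpace.single i (1 : ℝ)} G with hD
  -- By Plancherel each derivative of order `K + 1` costs `q ^ (2 * (K + 1))`, which the denominator
  -- in the second term compensates.
  set E : EuclSp n → ℝ := fun ξ => (1 + 2 ^ (K + 1)) * ‖𝓕 G ξ‖ ^ 2 +
    2 ^ (K + 1) * (n : ℝ) ^ K / q ^ (2 * (K + 1)) * ∑ i, ‖𝓕 (D i) ξ‖ ^ 2 with hE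
  have hq0 : 0 < q := by linarith
  have hle : ∀ ξ, (1 + (japaneseBracket ξ / q) ^ (2 * (K + 1))) * ‖𝓕 G ξ‖ ^ 2 ≤ E ξ := by
    intro ξ
    have h1 : japaneseBracket ξ ^ (2 * (K + 1)) ≤ 2 ^ (K + 1) * (1 + (‖ξ‖ ^ 2) ^ (K + 1)) := by
      rw [pow_mul, japaneseBracket_sq]
      have := add_pow_le (zero_le_one' ℝ) (sq_nonneg ‖ξ‖) (K + 1)
      rw [one_pow] at this
      refine this.trans ?_
      gcongr
      · exact one_le_two
      · omega
    have h2 := norm_pow_mul_norm_fourier_sq_le hn K G ξ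
    have hq1 : 1 ≤ q ^ (2 * (K + 1)) := one_le_pow₀ hq
    rw [div_pow, hE]
    calc (1 + japaneseBracket ξ ^ (2 * (K + 1)) / q ^ (2 * (K + 1))) * ‖𝓕 G ξ‖ ^ 2
        ≤ (1 + 2 ^ (K + 1) * (1 + (‖ξ‖ ^ 2) ^ (K + 1)) / q ^ (2 * (K + 1))) * ‖𝓕 G ξ‖ ^ 2 := by
          gcongr
      _ = (1 + 2 ^ (K + 1) / q ^ (2 * (K + 1))) * ‖𝓕 G ξ‖ ^ 2 +
          2 ^ (K + 1) / q ^ (2 * (K + 1)) * ((‖ξ‖ ^ 2) ^ (K + 1) * ‖𝓕 G ξ‖ ^ 2) := by ring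
      _ ≤ (1 + 2 ^ (K + 1)) * ‖𝓕 G ξ‖ ^ 2 +
          2 ^ (K + 1) / q ^ (2 * (K + 1)) * ((n : ℝ) ^ K * ∑ i, ‖𝓕 (D i) ξ‖ ^ 2) := by
          gcongr
          exact div_le_self (by positivity) hq1
      _ = _ := by ring
  have hEi : Integrable E := ((integrable_norm_sq_schwartz (𝓕 G)).const_mul _).add
    ((integrable_finsetSum _ fun i _ => integrable_norm_sq_schwartz (𝓕 (D i))).const_mul _)
  have hInt : Integrable (fun ξ => (1 + (japaneseBracket ξ / q) ^ (2 * (K + 1))) *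
      ‖𝓕 G ξ‖ ^ 2) := by
    refine hEi.mono' ?_ (ae_of_all _ fun ξ => ?_)
    · have h1 : Continuous fun ξ => 𝓕 G ξ := (𝓕 G).continuous
      have h2 := continuous_japaneseBracket (n := n)
      exact (by fun_prop : Continuous fun ξ => (1 + (japaneseBracket ξ / q) ^ (2 * (K + 1))) *
        ‖𝓕 G ξ‖ ^ 2).aestronglyMeasurable
    · have := (japaneseBracket_pos ξ).le
      rw [Real.norm_of_nonneg (by positivity)]
      exact hle ξ
  refine ⟨hInt, (integral_mono hInt hEi hle).trans ?_⟩
  have hG : ∫ ξ, ‖𝓕 G ξ‖ ^ 2 ≤ B ^ 2 * V := by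
    rw [SchwartzMap.integral_norm_sq_fourier]
    exact integral_norm_sq_le_of_support hV h0
      (fun x hx => image_eq_zero_of_notMem_tsupport fun h => hx (hS h)) hvol
  have hDi : ∀ i, ∫ ξ, ‖𝓕 (D i) ξ‖ ^ 2 ≤ (B * q ^ (K + 1)) ^ 2 * V := by
    intro i
    rw [SchwartzMap.integral_norm_sq_fourier]
    refine integral_norm_sq_le_of_support hV (fun x => ?_) (fun x hx => ?_) hvol
    · rw [hD, SchwartzMap.iteratedLineDerivOp_eq_iteratedFDeriv]
      refine (ContinuousMultilinearMap.le_opNorm _ _).trans ?_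
      simpa using hN x
    · exact image_eq_zero_of_notMem_tsupport fun h =>
        hx (hS (SchwartzMap.tsupport_iteratedLineDerivOp_subset _ G h))
  rw [hE, integral_add ((integrable_norm_sq_schwartz (𝓕 G)).const_mul _)
    ((integrable_finsetSum _ fun i _ => integrable_norm_sq_schwartz (𝓕 (D i))).const_mul _),
    integral_const_mul, integral_const_mul,
    integral_finsetSum _ fun i _ => integrable_norm_sq_schwartz (𝓕 (D i))]
  calc _ ≤ (1 + 2 ^ (K + 1)) * (B ^ 2 * V) + 2 ^ (K + 1) * (n : ℝ) ^ K / q ^ (2 * (K + 1)) *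
        ∑ _i : Fin n, (B * q ^ (K + 1)) ^ 2 * V := by
        gcongr with i
        exact hDi i
    _ = _ := by
        rw [Finset.sum_const, Finset.card_univ, Fintype.card_fin, nsmul_eq_mul]
        field_simp
        ring

end WeightedEstimates

/-! ### Almost orthogonality of dyadic pieces -/

section Dyadic

variable {n : ℕ} {φ : ℝ → ℝ}

/-- The weight on the dyadic piece of order `m`. -/
theorem SlowlyVaryingClass.exists_weight_le (hφ : SlowlyVaryingClass φ) {s : ℝ} (hs : 1 / 2 ≤ s)
    {N : ℕ} (hN : s + 1 / 2 ≤ N) :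
    ∃ C, 0 ≤ C ∧ ∀ (m : ℕ) (ξ : EuclSp n),
      ((japaneseBracket ξ / 2 ^ m) ^ (1 / 4 : ℝ) + (2 ^ m / japaneseBracket ξ) ^ (1 / 4 : ℝ)) *
        refinedWeight s φ ξ ^ 2 ≤
      C * (((2 : ℝ) ^ m) ^ (2 * s) * φ (2 ^ m) ^ 2) *
        (1 + (japaneseBracket ξ / 2 ^ m) ^ (2 * N)) := by
  obtain ⟨C, hC1, hC⟩ := hφ.potter (ε := 1 / 4) (by norm_num)
  refine ⟨8 * C ^ 2, by positivity, fun m ξ => ?_⟩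
  set t := japaneseBracket ξ
  have ht : 1 ≤ t := one_le_japaneseBracket ξ
  have h2m : (1 : ℝ) ≤ 2 ^ m := one_le_pow₀ one_le_two
  have hpot := hC (2 ^ m) t h2m ht
  have pm := hφ.pos _ h2m
  have pt := hφ.pos _ ht
  have h2m0 : (0 : ℝ) < 2 ^ m := by positivity
  set q : ℝ := t / 2 ^ m with hq
  have hq0 : 0 < q := by positivity
  have hqi : 2 ^ m / t = q⁻¹ := by rw [hq, inv_div]
  rw [hqi] at hpot ⊢
  -- Potter's bound reads `φ t ≤ C * θ * φ (2 ^ m)`. Squared, and with the factor `θ` already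
  -- present, it leaves `θ ^ 3` to be absorbed.
  set θ : ℝ := q ^ (1 / 4 : ℝ) + q⁻¹ ^ (1 / 4 : ℝ)
  have hθ : 0 ≤ θ := by positivity
  have ht' : t = q * 2 ^ m := by rw [hq]; field_simp
  have hw : refinedWeight s φ ξ = t ^ s * φ t := rfl
  have hts : (t ^ s) ^ 2 = q ^ (2 * s) * ((2 : ℝ) ^ m) ^ (2 * s) := by
    rw [← Real.rpow_natCast, ← Real.rpow_mul (by positivity), ht',
      Real.mul_rpow hq0.le h2m0.le]
    push_cast
    rw [mul_comm s 2]
  -- The exponent `1 / 4` makes `θ ^ 3` cost only `q ^ (∓3/4)`. For `q ≤ 1` this is beaten by `2 * s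
  -- ≥ 1`, so no cancellation in the bumps is needed at low frequencies; for `q ≥ 1` it is covered
  -- by `2 * N ≥ 2 * s + 1`.
  have hkey : θ ^ 3 * q ^ (2 * s) ≤ 8 * (1 + q ^ (2 * N)) := by
    rcases le_total q 1 with h | h
    · have h1 : θ ≤ 2 * q ^ (-(1 / 4 : ℝ)) := by
        have h2 : q ^ (1 / 4 : ℝ) ≤ q ^ (-(1 / 4 : ℝ)) :=
          Real.rpow_le_rpow_of_exponent_ge hq0 h (by norm_num)
        have h3 : q⁻¹ ^ (1 / 4 : ℝ) = q ^ (-(1 / 4 : ℝ)) := by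
          rw [Real.inv_rpow hq0.le, Real.rpow_neg hq0.le]
        simp only [θ, h3]
        linarith
      calc θ ^ 3 * q ^ (2 * s) ≤ (2 * q ^ (-(1 / 4 : ℝ))) ^ 3 * q ^ (2 * s) := by gcongr
        _ = 8 * q ^ (2 * s - 3 / 4) := by
          rw [mul_pow, ← Real.rpow_natCast (q ^ _), ← Real.rpow_mul hq0.le, mul_assoc,
            ← Real.rpow_add hq0]
          norm_num
          ring_nf
        _ ≤ 8 * 1 := by
          gcongr
          exact Real.rpow_le_one hq0.le h (by linarith)
        _ ≤ _ := by
          gcongr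
          exact le_add_of_nonneg_right (by positivity)
    · have h1 : θ ≤ 2 * q ^ (1 / 4 : ℝ) := by
        have h2 : q⁻¹ ^ (1 / 4 : ℝ) ≤ q ^ (1 / 4 : ℝ) := by
          gcongr
          exact (inv_le_one_of_one_le₀ h).trans h
        simp only [θ]
        linarith
      calc θ ^ 3 * q ^ (2 * s) ≤ (2 * q ^ (1 / 4 : ℝ)) ^ 3 * q ^ (2 * s) := by gcongr
        _ = 8 * q ^ (2 * s + 3 / 4) := by
          rw [mul_pow, ← Real.rpow_natCast (q ^ _), ← Real.rpow_mul hq0.le, mul_assoc,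
            ← Real.rpow_add hq0]
          norm_num
          ring_nf
        _ ≤ 8 * q ^ ((2 * N : ℕ) : ℝ) := by
          gcongr
          push_cast
          linarith
        _ ≤ _ := by
          rw [Real.rpow_natCast]
          gcongr
          exact le_add_of_nonneg_left zero_le_one
  calc θ * refinedWeight s φ ξ ^ 2 = θ * ((t ^ s) ^ 2 * φ t ^ 2) := by rw [hw, mul_pow]
    _ ≤ θ * ((t ^ s) ^ 2 * (C * θ * φ (2 ^ m)) ^ 2) := by gcongr
    _ = C ^ 2 * (((2 : ℝ) ^ m) ^ (2 * s) * φ (2 ^ m) ^ 2) * (θ ^ 3 * q ^ (2 * s)) := by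
      rw [hts]; ring
    _ ≤ C ^ 2 * (((2 : ℝ) ^ m) ^ (2 * s) * φ (2 ^ m) ^ 2) * (8 * (1 + q ^ (2 * N))) := by gcongr
    _ = _ := by ring

/-- The reciprocals of the almost orthogonality weights are uniformly summable. -/
theorem exists_sum_inv_dyadic_le : ∃ C : ℝ, 0 ≤ C ∧ ∀ t : ℝ, 1 ≤ t → ∀ M : ℕ,
    ∑ m ∈ Finset.range M, ((t / 2 ^ m) ^ (1 / 4 : ℝ) + (2 ^ m / t) ^ (1 / 4 : ℝ))⁻¹ ≤ C := by
  set r : ℝ := ((2 : ℝ) ^ (1 / 4 : ℝ))⁻¹ with hr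
  have h2 : (1 : ℝ) < 2 ^ (1 / 4 : ℝ) := Real.one_lt_rpow one_lt_two (by norm_num)
  have hr0 : 0 < r := by positivity
  have hr1 : r < 1 := inv_lt_one_of_one_lt₀ h2
  have hsum : Summable fun k : ℤ => r ^ k.natAbs := by
    refine Summable.of_nat_of_neg ?_ ?_
    · simpa using summable_geometric_of_lt_one hr0.le hr1
    · simpa using summable_geometric_of_lt_one hr0.le hr1
  refine ⟨r⁻¹ * ∑' k : ℤ, r ^ k.natAbs,
    mul_nonneg (by positivity) (tsum_nonneg fun _ => by positivity), fun t ht M => ?_⟩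
  obtain ⟨l, hl1, hl2⟩ := exists_nat_pow_near ht one_lt_two
  have ht0 : 0 < t := by linarith
  have hpow : ∀ k : ℕ, ((2 : ℝ) ^ k) ^ (1 / 4 : ℝ) = (r ^ k)⁻¹ := by
    intro k
    rw [hr, inv_pow, inv_inv, ← Real.rpow_natCast, ← Real.rpow_natCast, ← Real.rpow_mul (by norm_num),
      ← Real.rpow_mul (by norm_num), mul_comm]
  -- With `2 ^ l ≤ t < 2 ^ (l + 1)` the terms decay geometrically in `|l - m|`; the factor `r⁻¹`
  -- pays for rounding `t` to a power of two. Summing over all integers makes the bound independent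
  -- of `t` and `M`.
  have hterm : ∀ m : ℕ, ((t / 2 ^ m) ^ (1 / 4 : ℝ) + (2 ^ m / t) ^ (1 / 4 : ℝ))⁻¹ ≤
      r⁻¹ * r ^ ((l : ℤ) - m).natAbs := by
    intro m
    rcases le_or_gt m l with h | h
    · have h1 : (2 : ℝ) ^ (l - m) ≤ t / 2 ^ m := by
        rw [le_div_iff₀ (by positivity), ← pow_add, Nat.sub_add_cancel h]
        exact hl1
      have h3 : ((l : ℤ) - m).natAbs = l - m := by omega
      calc _ ≤ (((2 : ℝ) ^ (l - m)) ^ (1 / 4 : ℝ))⁻¹ := by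
            gcongr
            exact (Real.rpow_le_rpow (by positivity) h1 (by norm_num)).trans
              (le_add_of_nonneg_right (by positivity))
        _ = 1 * r ^ (l - m) := by rw [hpow, inv_inv, one_mul]
        _ ≤ _ := by
            rw [h3]
            gcongr
            exact (one_lt_inv₀ hr0).2 hr1 |>.le
    · have h1 : (2 : ℝ) ^ (m - l - 1) ≤ 2 ^ m / t := by
        rw [le_div_iff₀ ht0]
        calc (2 : ℝ) ^ (m - l - 1) * t ≤ 2 ^ (m - l - 1) * 2 ^ (l + 1) := by gcongr
          _ = 2 ^ m := by rw [← pow_add]; congr 1; omega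
      have h3 : ((l : ℤ) - m).natAbs = (m - l - 1) + 1 := by omega
      calc _ ≤ (((2 : ℝ) ^ (m - l - 1)) ^ (1 / 4 : ℝ))⁻¹ := by
            gcongr
            exact (Real.rpow_le_rpow (by positivity) h1 (by norm_num)).trans
              (le_add_of_nonneg_left (by positivity))
        _ = _ := by
            rw [hpow, inv_inv, h3, pow_succ, mul_comm _ r, inv_mul_cancel_left₀ hr0.ne']
  calc _ ≤ ∑ m ∈ Finset.range M, r⁻¹ * r ^ ((l : ℤ) - m).natAbs :=
        Finset.sum_le_sum fun m _ => hterm m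
    _ = r⁻¹ * ∑ k ∈ (Finset.range M).image (fun m : ℕ => (l : ℤ) - m), r ^ k.natAbs := by
        rw [← Finset.mul_sum, Finset.sum_image]
        intro a _ b _ hab
        simp only at hab
        omega
    _ ≤ _ := by
        gcongr
        exact hsum.sum_le_tsum _ fun _ _ => by positivity

end Dyadic

/-! ### Weighted norms of sums of dyadic pieces -/

section DyadicSums

variable {n : ℕ} {φ : ℝ → ℝ}

/-- The norm in `H^{ρ+n/2,φ}(ℝⁿ)` of a linear combination of functions `G m` which behave like
`ψ(2^m ·)` is controlled by the `ℓ₂`-norm of the coefficients with the weight `2^{mρ} φ(2^m)`. -/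
theorem SlowlyVaryingClass.exists_dyadic_sum_bound (hφ : SlowlyVaryingClass φ) (hn : 1 ≤ n)
    (ρ K : ℕ) (hK : (ρ : ℝ) + (n : ℝ) / 2 + 1 / 2 ≤ (K + 1 : ℕ)) {G : ℕ → 𝓢(EuclSp n, ℂ)}
    {S : ℕ → Set (EuclSp n)} {B V : ℝ} (hV : 0 ≤ V) (hS : ∀ m, tsupport (G m) ⊆ S m)
    (hvol : ∀ m, volume (S m) ≤ ENNReal.ofReal (V / (2 ^ m) ^ n)) (h0 : ∀ m x, ‖G m x‖ ≤ B)
    (hN : ∀ m x, ‖iteratedFDeriv ℝ (K + 1) (G m) x‖ ≤ B * (2 ^ m) ^ (K + 1)) :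
    ∃ C, 0 ≤ C ∧ ∀ (M : ℕ) (b : ℕ → ℝ),
      MemLp (fun ξ => (refinedWeight ((ρ : ℝ) + (n : ℝ) / 2) φ ξ : ℂ) *
        𝓕 (∑ m ∈ Finset.range M, (b m : ℂ) • G m) ξ) 2 volume ∧
      ∫ ξ, ‖(refinedWeight ((ρ : ℝ) + (n : ℝ) / 2) φ ξ : ℂ) *
        𝓕 (∑ m ∈ Finset.range M, (b m : ℂ) • G m) ξ‖ ^ 2 ≤
        C * ∑ m ∈ Finset.range M, (b m * (2 ^ m) ^ ρ * φ (2 ^ m)) ^ 2 := by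
  set s : ℝ := (ρ : ℝ) + (n : ℝ) / 2 with hs
  have hn1 : (1 : ℝ) ≤ n := mod_cast hn
  have hρ : (0 : ℝ) ≤ ρ := Nat.cast_nonneg _
  obtain ⟨C₁, hC₁, h₁⟩ := exists_sum_inv_dyadic_le
  obtain ⟨C₂, hC₂, h₂⟩ := hφ.exists_weight_le (n := n) (s := s) (by linarith) hK
  set C₃ : ℝ := 1 + 2 ^ (K + 1) + 2 ^ (K + 1) * (n : ℝ) ^ (K + 1) with hC₃
  have h₃ : ∀ m, _ := fun m => integral_one_add_pow_mul_fourier_le hn K (G m)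
    (q := 2 ^ m) (B := B) (div_nonneg hV (by positivity)) (one_le_pow₀ one_le_two)
    (hS m) (hvol m) (h0 m) (hN m)
  refine ⟨C₁ * C₂ * C₃ * (B ^ 2 * V), by positivity, fun M b => ?_⟩
  set F : EuclSp n → ℂ := fun ξ => 𝓕 (∑ m ∈ Finset.range M, (b m : ℂ) • G m) ξ with hF
  set E : EuclSp n → ℝ := fun ξ => ∑ m ∈ Finset.range M,
    (C₁ * C₂ * b m ^ 2 * (((2 : ℝ) ^ m) ^ (2 * s) * φ (2 ^ m) ^ 2)) *
      ((1 + (japaneseBracket ξ / 2 ^ m) ^ (2 * (K + 1))) * ‖𝓕 (G m) ξ‖ ^ 2) with hE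
  have hFs : ∀ ξ, F ξ = ∑ m ∈ Finset.range M, (b m : ℂ) * 𝓕 (G m) ξ := by
    intro ξ
    simp only [hF, FourierTransform.fourier_sum, FourierTransform.fourier_smul]
    simp
  have hle : ∀ ξ, ‖(refinedWeight s φ ξ : ℂ) * F ξ‖ ^ 2 ≤ E ξ := by
    intro ξ
    have ht := one_le_japaneseBracket ξ
    have ht0 := japaneseBracket_pos ξ
    set t := japaneseBracket ξ
    set θ : ℕ → ℝ := fun m => (t / 2 ^ m) ^ (1 / 4 : ℝ) + (2 ^ m / t) ^ (1 / 4 : ℝ)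
    have hθ : ∀ m, 0 < θ m := fun m => by positivity
    -- Cauchy–Schwarz with the weights `θ m` replaces orthogonality: the sum of the `(θ m)⁻¹` is
    -- bounded uniformly in `ξ` and `M`, and the factor `θ m` is absorbed by `exists_weight_le`.
    have hcs : ‖F ξ‖ ^ 2 ≤ C₁ * ∑ m ∈ Finset.range M, θ m * (b m ^ 2 * ‖𝓕 (G m) ξ‖ ^ 2) := by
      calc ‖F ξ‖ ^ 2 ≤ (∑ m ∈ Finset.range M, |b m| * ‖𝓕 (G m) ξ‖) ^ 2 := by
            gcongr
            rw [hFs]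
            refine (norm_sum_le _ _).trans (le_of_eq (Finset.sum_congr rfl fun m _ => ?_))
            rw [norm_mul, Complex.norm_real, Real.norm_eq_abs]
        _ ≤ (∑ m ∈ Finset.range M, (θ m)⁻¹) *
            ∑ m ∈ Finset.range M, θ m * (b m ^ 2 * ‖𝓕 (G m) ξ‖ ^ 2) := by
            refine Finset.sum_sq_le_sum_mul_sum_of_sq_le_mul _
              (fun m _ => (inv_pos.2 (hθ m)).le)
              (fun m _ => mul_nonneg (hθ m).le (by positivity)) fun m _ => ?_
            rw [inv_mul_cancel_left₀ (hθ m).ne', mul_pow, sq_abs]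
        _ ≤ _ := by
            gcongr
            exact h₁ t ht M
    rw [norm_mul, mul_pow, Complex.norm_real, Real.norm_eq_abs, sq_abs]
    calc refinedWeight s φ ξ ^ 2 * ‖F ξ‖ ^ 2 ≤ refinedWeight s φ ξ ^ 2 *
          (C₁ * ∑ m ∈ Finset.range M, θ m * (b m ^ 2 * ‖𝓕 (G m) ξ‖ ^ 2)) := by gcongr
      _ = ∑ m ∈ Finset.range M, C₁ * (b m ^ 2 * ‖𝓕 (G m) ξ‖ ^ 2) *
          (θ m * refinedWeight s φ ξ ^ 2) := by
          rw [Finset.mul_sum, Finset.mul_sum]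
          exact Finset.sum_congr rfl fun m _ => by ring
      _ ≤ ∑ m ∈ Finset.range M, C₁ * (b m ^ 2 * ‖𝓕 (G m) ξ‖ ^ 2) *
          (C₂ * (((2 : ℝ) ^ m) ^ (2 * s) * φ (2 ^ m) ^ 2) * (1 + (t / 2 ^ m) ^ (2 * (K + 1)))) := by
          exact Finset.sum_le_sum fun m _ =>
            mul_le_mul_of_nonneg_left (h₂ m ξ) (by positivity)
      _ = E ξ := Finset.sum_congr rfl fun m _ => by ring
  have hEi : Integrable E := integrable_finsetSum _ fun m _ => (h₃ m).1.const_mul _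
  have hFc : Continuous F := (𝓕 (∑ m ∈ Finset.range M, (b m : ℂ) • G m)).continuous
  have hmeas : AEStronglyMeasurable (fun ξ => (refinedWeight s φ ξ : ℂ) * F ξ) volume :=
    (Complex.measurable_ofReal.comp
      (hφ.measurable_refinedWeight s)).aestronglyMeasurable.mul hFc.aestronglyMeasurable
  have hInt : Integrable fun ξ => ‖(refinedWeight s φ ξ : ℂ) * F ξ‖ ^ 2 :=
    hEi.mono' (hmeas.norm.pow 2) (ae_of_all _ fun ξ => by
      rw [norm_pow, norm_norm]
      exact hle ξ)
  refine ⟨(memLp_two_iff_integrable_sq_norm hmeas).2 hInt, (integral_mono hInt hEi hle).trans ?_⟩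
  rw [hE, integral_finsetSum _ fun m _ => (h₃ m).1.const_mul _, Finset.mul_sum]
  refine Finset.sum_le_sum fun m _ => ?_
  rw [integral_const_mul]
  have h2m : (0 : ℝ) < 2 ^ m := by positivity
  -- The factor `(2 ^ m) ^ n` cancels against the volume of the support of `G m`.
  have hpow : ((2 : ℝ) ^ m) ^ (2 * s) = ((2 ^ m) ^ ρ) ^ 2 * (2 ^ m) ^ n := by
    rw [← pow_mul _ ρ 2, ← pow_add, ← Real.rpow_natCast ((2 : ℝ) ^ m)]
    congr 1
    rw [hs]
    push_cast
    ring
  calc _ ≤ (C₁ * C₂ * b m ^ 2 * (((2 : ℝ) ^ m) ^ (2 * s) * φ (2 ^ m) ^ 2)) *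
        (C₃ * (B ^ 2 * (V / (2 ^ m) ^ n))) := by
        gcongr
        exact (h₃ m).2
    _ = _ := by
        rw [hpow]
        field_simp

end DyadicSums

/-! ### Tempered distributions given by Schwartz functions -/

section SchwartzDistributions

variable {n : ℕ} {φ : ℝ → ℝ} {s : ℝ} {u : 𝓢'(EuclSp n, ℂ)} {G : 𝓢(EuclSp n, ℂ)}

theorem hasFourierFunction_of_schwartz (hu : ∀ g : 𝓢(EuclSp n, ℂ), u g = ∫ x, g x * G x) :
    HasFourierFunction u (fun ξ => 𝓕 G ξ) := by
  refine ⟨(𝓕 G).continuous.locallyIntegrable, fun g _ => ?_⟩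
  rw [TemperedDistribution.fourier_apply, hu, SchwartzMap.integral_fourier_mul_eq]

/-- `weightedFourier` is built from a chosen representative of the Fourier transform; by almost
everywhere uniqueness any other computes the same norm. -/
theorem norm_weightedFourier_sq_of_hasFourierFunction {f : EuclSp n → ℂ}
    (hf : HasFourierFunction u f) (hu : u ∈ refinedSubmodule n s φ) :
    ‖weightedFourier n s φ ⟨u, hu⟩‖ ^ 2 = ∫ ξ, ‖(refinedWeight s φ ξ : ℂ) * f ξ‖ ^ 2 := by
  rw [L2.norm_sq_eq_integral]
  refine integral_congr_ae ?_
  filter_upwards [hu.choose_spec.2.coeFn_toLp, hu.choose_spec.1.ae_eq hf] with ξ h1 h2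
  change ‖(hu.choose_spec.2.toLp _) ξ‖ ^ 2 = _
  rw [h1, h2]

end SchwartzDistributions

/-! ### Rescaled bumps -/

section Profile

variable {n : ℕ}

/-- There are smooth functions with support in the unit ball and a nonzero derivative of given order
at the origin. -/
theorem exists_profile (hn : 1 ≤ n) (ρ : ℕ) : ∃ ψ : EuclSp n → ℂ, ContDiff ℝ ∞ ψ ∧
    tsupport ψ ⊆ Metric.closedBall 0 1 ∧ iteratedFDeriv ℝ ρ ψ 0 ≠ 0 := by
  set e : EuclSp n := EuclideanSpace.single ⟨0, hn⟩ 1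
  have he : inner ℝ e e = (1 : ℝ) := by
    rw [real_inner_self_eq_norm_sq]
    simp [e]
  let f : ContDiffBump (0 : EuclSp n) := ⟨1 / 2, 1, by norm_num, by norm_num⟩
  -- Near the origin, along the line spanned by `e`, this is the exponential function, whose
  -- derivatives of all orders at zero are `1`.
  set ψ₀ : EuclSp n → ℝ := fun x => f x * Real.exp (inner ℝ e x) with hψ₀
  have h0 : ContDiff ℝ ∞ ψ₀ := f.contDiff.mul
    (Real.contDiff_exp.comp (contDiff_const.inner ℝ contDiff_id))
  refine ⟨fun x => (ψ₀ x : ℂ), Complex.ofRealCLM.contDiff.comp h0, ?_, fun h => ?_⟩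
  · refine closure_minimal (fun x hx => ?_) Metric.isClosed_closedBall
    have hx' : f x ≠ 0 := fun h => hx (by simp [hψ₀, h])
    have hx2 : x ∈ Metric.ball (0 : EuclSp n) 1 := f.support_eq ▸ hx'
    exact Metric.ball_subset_closedBall hx2
  · have h1 : ‖iteratedFDeriv ℝ ρ ψ₀ 0‖ = 0 := by
      rw [← Complex.ofRealLI.norm_iteratedFDeriv_comp_left (h0.of_le (mod_cast le_top)).contDiffAt
        le_rfl]
      exact norm_eq_zero.2 h
    set ℓ : ℝ →L[ℝ] EuclSp n := ContinuousLinearMap.toSpanSingleton ℝ e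
    have h2 : iteratedFDeriv ℝ ρ (ψ₀ ∘ ℓ) 0 = 0 := by
      rw [ℓ.iteratedFDeriv_comp_right h0 0 (mod_cast le_top), map_zero, norm_eq_zero.1 h1]
      ext
      simp
    have h3 : ψ₀ ∘ ℓ =ᶠ[𝓝 0] Real.exp := by
      have h4 : ∀ᶠ t in 𝓝 (0 : ℝ), f (ℓ t) = 1 := by
        have h5 : Tendsto ℓ (𝓝 0) (𝓝 0) := by simpa using ℓ.continuous.tendsto 0
        exact h5.eventually f.eventuallyEq_one
      filter_upwards [h4] with t ht
      simp only [Function.comp_apply, hψ₀, ht, one_mul]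
      rw [ContinuousLinearMap.toSpanSingleton_apply, inner_smul_right, he, mul_one]
    have h6 : iteratedDeriv ρ Real.exp 0 = 0 := by
      rw [iteratedDeriv_eq_iteratedFDeriv, ← (h3.iteratedFDeriv ℝ ρ).eq_of_nhds, h2]
      simp
    rw [iteratedDeriv_eq_iterate, Real.iter_deriv_exp, Real.exp_zero] at h6
    exact one_ne_zero h6

theorem iteratedFDeriv_rescale {ψ : EuclSp n → ℂ} (hψ : ContDiff ℝ ∞ ψ) (c : ℝ) (x₀ x : EuclSp n)
    (i : ℕ) : iteratedFDeriv ℝ i (fun y => ψ (c • (y - x₀))) x =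
      c ^ i • iteratedFDeriv ℝ i ψ (c • (x - x₀)) := by
  have h1 := iteratedFDeriv_comp_sub (𝕜 := ℝ) (f := fun y => ψ (c • y)) i x₀ x
  rw [h1, iteratedFDeriv_comp_const_smul c (hψ.of_le (mod_cast le_top))]

theorem contDiff_rescale {ψ : EuclSp n → ℂ} (hψ : ContDiff ℝ ∞ ψ) (c : ℝ) (x₀ : EuclSp n) :
    ContDiff ℝ ∞ fun y => ψ (c • (y - x₀)) :=
  hψ.comp (by fun_prop)

end Profile

/-! ### The topology of `C^k(Γ)` and distributions given by functions -/

section FunctionDistributions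

variable {n : ℕ} {Γ : Type*} [TopologicalSpace Γ] [ChartedSpace (EuclSp n) Γ]

theorem CkSpace.continuous_ofFun_iteratedFDeriv {k : ℕ∞}
    {β : OpenPartialHomeomorph Γ (EuclSp n)} (hβ : β ∈ IsManifold.maximalAtlas (𝓡 n) ∞ Γ)
    {i : ℕ} (hi : (i : ℕ∞) ≤ k) :
    Continuous fun u : CkSpace n Γ k =>
      UniformOnFun.ofFun {K : Set (EuclSp n) | IsCompact K ∧ K ⊆ β.target}
        (iteratedFDeriv ℝ i ((u : Γ → ℂ) ∘ β.symm)) :=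
  continuous_iInf_dom (i := β) <| continuous_iInf_dom (i := hβ) <|
    continuous_iInf_dom (i := i) <| continuous_iInf_dom (i := hi) continuous_induced_dom

theorem CkSpace.continuous_iteratedFDeriv_apply {k : ℕ∞}
    {β : OpenPartialHomeomorph Γ (EuclSp n)} (hβ : β ∈ IsManifold.maximalAtlas (𝓡 n) ∞ Γ)
    {i : ℕ} (hi : (i : ℕ∞) ≤ k) {x : EuclSp n} (hx : x ∈ β.target) :
    Continuous fun u : CkSpace n Γ k => iteratedFDeriv ℝ i ((u : Γ → ℂ) ∘ β.symm) x :=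
  have hK : ({x} : Set (EuclSp n)) ∈ {K : Set (EuclSp n) | IsCompact K ∧ K ⊆ β.target} :=
    ⟨isCompact_singleton, singleton_subset_iff.2 hx⟩
  (UniformOnFun.uniformContinuous_eval_of_mem _ _ (mem_singleton x) hK).continuous.comp
    (CkSpace.continuous_ofFun_iteratedFDeriv hβ hi)

theorem CkSpace.sum_smul_apply {ι : Type*} {k : ℕ∞} (t : Finset ι) (c : ι → ℂ)
    (f : ι → CkSpace n Γ k) (y : Γ) :
    (∑ m ∈ t, c m • f m : CkSpace n Γ k) y = ∑ m ∈ t, c m * f m y := by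
  have h := map_sum (Submodule.subtype (ckSubmodule n Γ k)) (fun m => c m • f m) t
  exact (congrFun h y).trans (Finset.sum_apply _ _ _)

theorem CkSpace.continuous_coe {k : ℕ∞} (w : CkSpace n Γ k) : Continuous (w : Γ → ℂ) :=
  ContMDiff.continuous (n := k) w.2

theorem contDiff_χ_mul_comp_symm (A : AdaptedAtlas n Γ) (j : Fin A.r) (f : CkSpace n Γ ⊤) :
    ContDiff ℝ ∞ fun x => (A.χ j ((A.chart j).symm x) : ℂ) * f ((A.chart j).symm x) := by
  refine contDiff_iff_contDiffAt.2 fun x => ?_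
  have hx : x ∈ (A.chart j).target := by rw [A.chart_target j]; trivial
  have h1 : ContDiffAt ℝ ∞ (fun x => (A.χ j ((A.chart j).symm x) : ℂ)) x :=
    contDiffAt_comp_chart_symm (k := ⊤) (f := fun y => (A.χ j y : ℂ)) (A.chart_mem j)
      ((Complex.ofRealCLM.contDiff (n := ∞)).contMDiff.comp (A.χ j).contMDiff) hx
  have h2 : ContDiffAt ℝ ∞ (fun x => f ((A.chart j).symm x)) x :=
    contDiffAt_comp_chart_symm (k := ⊤) (A.chart_mem j) f.2 hx
  exact h1.mul h2

variable [CompactSpace Γ]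

/-- The function `(χ_j f) ∘ α_j` on `ℝⁿ`. -/
noncomputable def localSchwartz (A : AdaptedAtlas n Γ) (j : Fin A.r) (f : CkSpace n Γ ⊤) :
    𝓢(EuclSp n, ℂ) :=
  (hasCompactSupport_comp_chart_symm (A.χ_subordinate j) (A.chart_target j)
    fun x hx => by simp [hx]).toSchwartzMap (contDiff_χ_mul_comp_symm A j f)

theorem localSchwartz_apply (A : AdaptedAtlas n Γ) (j : Fin A.r) (f : CkSpace n Γ ⊤)
    (x : EuclSp n) : localSchwartz A j f x =
      (A.χ j ((A.chart j).symm x) : ℂ) * f ((A.chart j).symm x) := rfl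

theorem AdaptedAtlas.isCompact_image_tsupport (A : AdaptedAtlas n Γ) (j : Fin A.r) :
    IsCompact (A.chart j '' tsupport (A.χ j)) :=
  (isClosed_tsupport _).isCompact.image_of_continuousOn
    ((A.chart j).continuousOn.mono (A.χ_subordinate j))

/-- The supports of the `χ_j` cover `Γ` and have compact images in their charts, so the order zero
part of the topology already controls the supremum over `Γ`. -/
theorem CkSpace.eventually_forall_norm_sub_lt (A : AdaptedAtlas n Γ) {k : ℕ∞}
    (w₀ : CkSpace n Γ k) {ε : ℝ} (hε : 0 < ε) :
    ∀ᶠ w : CkSpace n Γ k in 𝓝 w₀, ∀ y, ‖w y - w₀ y‖ < ε := by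
  have h : ∀ j, ∀ᶠ w : CkSpace n Γ k in 𝓝 w₀, ∀ y ∈ tsupport (A.χ j), ‖w y - w₀ y‖ < ε := by
    intro j
    have h1 := (CkSpace.continuous_ofFun_iteratedFDeriv (k := k) (A.chart_mem j)
      (i := 0) (by simp)).tendsto w₀
    rw [UniformOnFun.tendsto_iff_tendstoUniformlyOn] at h1
    have h2 := h1 _ ⟨A.isCompact_image_tsupport j, by simp [A.chart_target j]⟩
    rw [Metric.tendstoUniformlyOn_iff] at h2
    filter_upwards [h2 ε hε] with w hw y hy
    have h3 := hw _ (mem_image_of_mem _ hy)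
    simp only [Function.comp_apply, UniformOnFun.toFun_ofFun, iteratedFDeriv_zero_eq_comp,
      LinearIsometryEquiv.dist_map, (A.chart j).left_inv (A.χ_subordinate j hy)] at h3
    rwa [dist_comm, dist_eq_norm] at h3
  filter_upwards [eventually_all.2 h] with w hw y
  obtain ⟨j, hj⟩ := A.χ.exists_pos_of_mem (mem_univ y)
  exact hw j y (subset_tsupport _ hj.ne')

variable [MeasurableSpace Γ] [BorelSpace Γ] [IsManifold (𝓡 n) ∞ Γ]

/-- The distribution given by a continuous function. -/
noncomputable def distributionOfContinuous (A : AdaptedAtlas n Γ) (d : SmoothDensity n Γ)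
    {f : Γ → ℂ} (hf : Continuous f) : DistributionOn n Γ where
  toFun w := ∫ y, f y * conj (w y) ∂d.measure
  map_add' w w' := by
    have := d.isFiniteMeasure
    have hInt : ∀ w : CkSpace n Γ ⊤, Integrable (fun y => f y * conj (w y)) d.measure := fun w =>
      (hf.mul (Complex.continuous_conj.comp w.continuous_coe)).integrable_of_hasCompactSupport
        (HasCompactSupport.of_compactSpace _)
    rw [← integral_add (hInt w) (hInt w')]
    refine integral_congr_ae (ae_of_all _ fun y => ?_)
    change f y * conj (w y + w' y) = _
    rw [map_add, mul_add]
  map_smul' c w := by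
    rw [smul_eq_mul, ← integral_const_mul]
    refine integral_congr_ae (ae_of_all _ fun y => ?_)
    change f y * conj (c * w y) = _
    rw [map_mul, mul_left_comm]
  cont := by
    have := d.isFiniteMeasure
    have hcs : ∀ {g : Γ → ℂ}, Continuous g → Integrable g d.measure := fun hg =>
      hg.integrable_of_hasCompactSupport (HasCompactSupport.of_compactSpace _)
    have hInt : ∀ w : CkSpace n Γ ⊤, Integrable (fun y => f y * conj (w y)) d.measure := fun w =>
      hcs (hf.mul (Complex.continuous_conj.comp w.continuous_coe))
    refine continuous_iff_continuousAt.2 fun w₀ => Metric.tendsto_nhds.2 fun ε hε => ?_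
    set I : ℝ := ∫ y, ‖f y‖ ∂d.measure
    have hI : 0 ≤ I := integral_nonneg fun _ => norm_nonneg _
    filter_upwards [CkSpace.eventually_forall_norm_sub_lt A w₀ (ε := ε / (I + 1)) (by positivity)]
      with w hw
    rw [dist_eq_norm]
    change ‖(∫ y, f y * conj (w y) ∂d.measure) - ∫ y, f y * conj (w₀ y) ∂d.measure‖ < ε
    rw [← integral_sub (hInt w) (hInt w₀)]
    calc _ ≤ ∫ y, ‖f y * conj (w y) - f y * conj (w₀ y)‖ ∂d.measure :=
          norm_integral_le_integral_norm _
      _ ≤ ∫ y, ‖f y‖ * (ε / (I + 1)) ∂d.measure := by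
          refine integral_mono ((hInt w).sub (hInt w₀)).norm ((hcs hf).norm.mul_const _) fun y => ?_
          simp only [← mul_sub, ← map_sub, norm_mul, RCLike.norm_conj]
          gcongr
          exact (hw y).le
      _ = I * (ε / (I + 1)) := integral_mul_const _ _
      _ < ε := by
          rw [mul_div_assoc', div_lt_iff₀ (by positivity)]
          nlinarith

theorem localRep_distributionOfContinuous [T2Space Γ] (A : AdaptedAtlas n Γ)
    (d : SmoothDensity n Γ) (j : Fin A.r) (f : CkSpace n Γ ⊤) (g : 𝓢(EuclSp n, ℂ)) :
    localRep A d j (distributionOfContinuous A d f.continuous_coe) g =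
      ∫ x, g x * localSchwartz A j f x := by
  change ∫ y, f y * conj (chartTest A d j g y) ∂d.measure = _
  refine (d.integral_eq_integral_chart (A.chart_mem j) (f.continuous_coe.mul
    (Complex.continuous_conj.comp (chartTest A d j g).continuous_coe)).continuousOn
    fun y hy => ?_).trans ?_
  · have h0 : A.χ j y = 0 :=
      image_eq_zero_of_notMem_tsupport fun h => hy (A.χ_subordinate j h)
    simp [chartTest, h0]
  · rw [A.chart_target j, setIntegral_univ]
    refine integral_congr_ae (ae_of_all _ fun x => ?_)
    have hx : x ∈ (A.chart j).target := by rw [A.chart_target j]; trivial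
    have hd : (d.dens (A.chart j) x : ℂ) ≠ 0 :=
      Complex.ofReal_ne_zero.2 (d.dens_pos _ (A.chart_mem j) x hx).ne'
    simp only [Pi.mul_apply, Function.comp_apply, chartTest, localSchwartz_apply,
      (A.chart j).right_inv hx, map_mul,
      Complex.conj_conj, Complex.conj_ofReal, Complex.ofReal_mul, Complex.ofReal_inv, map_inv₀]
    field_simp

end FunctionDistributions

/-! ### Necessity of the integral condition -/

section Necessity

variable {n : ℕ} {Γ : Type*} [TopologicalSpace Γ] [ChartedSpace (EuclSp n) Γ]
  [T2Space Γ] [CompactSpace Γ]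

/-- The part of the support of `χ_k` that is covered by the ball of radius `r` around `x₀` in the
`j`-th chart, seen in the `k`-th chart. -/
def chartOverlapBall (A : AdaptedAtlas n Γ) (j k : Fin A.r) (x₀ : EuclSp n) (r : ℝ) :
    Set (EuclSp n) :=
  A.chart k '' tsupport (A.χ k) ∩
    (A.chart k).symm ⁻¹' ((A.chart j).symm '' Metric.closedBall x₀ r)

theorem isClosed_chartOverlapBall (A : AdaptedAtlas n Γ) (j k : Fin A.r) (x₀ : EuclSp n) (r : ℝ) :
    IsClosed (chartOverlapBall A j k x₀ r) := by
  have hc : ∀ k, Continuous (A.chart k).symm := fun k => by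
    rw [← continuousOn_univ, ← A.chart_target k]
    exact (A.chart k).continuousOn_symm
  exact (A.isCompact_image_tsupport k).isClosed.inter
    (((isCompact_closedBall x₀ r).image (hc j)).isClosed.preimage (hc k))

/-- The rescaled bump `ψ(2^m (x - x₀))` in the `j`-th chart, cut off by `η`. -/
noncomputable def dyadicBump (A : AdaptedAtlas n Γ) (j : Fin A.r) {η : Γ → ℝ}
    (hη : ContMDiff (𝓡 n) 𝓘(ℝ, ℝ) ∞ η) (hηs : tsupport η ⊆ (A.chart j).source)
    {ψ : EuclSp n → ℂ} (hψ : ContDiff ℝ ∞ ψ) (x₀ : EuclSp n) (m : ℕ) : CkSpace n Γ ⊤ :=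
  ⟨cutoffComp η (A.chart j) fun x => ψ ((2 : ℝ) ^ m • (x - x₀)),
    contMDiff_cutoffComp hη (A.chart_mem j) hηs (k := ⊤) (contDiff_rescale hψ _ _)⟩

variable {A : AdaptedAtlas n Γ} {j : Fin A.r} {η : Γ → ℝ} {ψ : EuclSp n → ℂ}

theorem tsupport_localSchwartz_dyadicBump_subset (hη : ContMDiff (𝓡 n) 𝓘(ℝ, ℝ) ∞ η)
    (hηs : tsupport η ⊆ (A.chart j).source) (hψ : ContDiff ℝ ∞ ψ)
    (hψs : tsupport ψ ⊆ Metric.closedBall 0 1) (x₀ : EuclSp n) (k : Fin A.r) (m : ℕ) :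
    tsupport (localSchwartz A k (dyadicBump A j hη hηs hψ x₀ m)) ⊆
      chartOverlapBall A j k x₀ ((2 ^ m)⁻¹) := by
  refine closure_minimal (fun x hx => ?_) (isClosed_chartOverlapBall A j k x₀ _)
  have hx' : (A.χ k ((A.chart k).symm x) : ℂ) * ((η ((A.chart k).symm x) : ℂ) *
    ψ ((2 : ℝ) ^ m • (A.chart j ((A.chart k).symm x) - x₀))) ≠ 0 := hx
  have h1 := left_ne_zero_of_mul hx'
  have h2 := left_ne_zero_of_mul (right_ne_zero_of_mul hx')
  have h3 := right_ne_zero_of_mul (right_ne_zero_of_mul hx')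
  have hxt : x ∈ (A.chart k).target := by simp [A.chart_target k]
  have hys : (A.chart k).symm x ∈ (A.chart j).source :=
    hηs (subset_tsupport _ (Complex.ofReal_ne_zero.1 h2))
  refine ⟨⟨(A.chart k).symm x, subset_tsupport _ (Complex.ofReal_ne_zero.1 h1),
    (A.chart k).right_inv hxt⟩, A.chart j ((A.chart k).symm x), ?_, (A.chart j).left_inv hys⟩
  have h4 := mem_closedBall_zero_iff.1 (hψs (subset_tsupport _ h3))
  rw [norm_smul, norm_pow, Real.norm_ofNat] at h4
  rwa [mem_closedBall_iff_norm, ← one_div, le_div_iff₀' (by positivity)]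

/-- The derivatives of order `i` of the rescaled bumps grow like `2^{mi}`. -/
theorem exists_iteratedFDeriv_localSchwartz_dyadicBump_le (hη : ContMDiff (𝓡 n) 𝓘(ℝ, ℝ) ∞ η)
    (hηs : tsupport η ⊆ (A.chart j).source) (hψ : ContDiff ℝ ∞ ψ)
    (hψs : tsupport ψ ⊆ Metric.closedBall 0 1) (x₀ : EuclSp n) (k : Fin A.r) (i : ℕ) :
    ∃ B, 0 ≤ B ∧ ∀ m x, ‖iteratedFDeriv ℝ i
      (localSchwartz A k (dyadicBump A j hη hηs hψ x₀ m)) x‖ ≤ B * (2 ^ m) ^ i := by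
  -- Merging the two cutoffs presents the piece in the `k`-th chart as a function transported from
  -- the `j`-th chart, so that `exists_cutoffComp_bound` applies with a constant independent of `m`.
  set η' : Γ → ℝ := fun y => A.χ k y * η y
  have hη' : ContMDiff (𝓡 n) 𝓘(ℝ, ℝ) ∞ η' := (A.χ k).contMDiff.mul hη
  have hη's : tsupport η' ⊆ (A.chart j).source :=
    (closure_mono (Function.support_mul_subset_right _ _)).trans hηs
  obtain ⟨C, hC0, hC⟩ := exists_cutoffComp_bound hη' (A.chart_mem j) hη's (A.chart_mem k)
    (A.isCompact_image_tsupport k) (by simp [A.chart_target k]) i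
  have hcs : HasCompactSupport ψ :=
    (isCompact_closedBall (0 : EuclSp n) 1).of_isClosed_subset (isClosed_tsupport ψ) hψs
  obtain ⟨B, hB0, hB⟩ := exists_norm_iteratedFDeriv_le_of_hasCompactSupport hψ hcs i
  refine ⟨C * B, by positivity, fun m x => ?_⟩
  have h2m : (1 : ℝ) ≤ 2 ^ m := one_le_pow₀ one_le_two
  by_cases hx : x ∈ A.chart k '' tsupport (A.χ k)
  · have h1 := hC (fun x => ψ ((2 : ℝ) ^ m • (x - x₀)))
      ((contDiff_rescale hψ _ _).of_le (mod_cast le_top)) (B * (2 ^ m) ^ i) (by positivity)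
      (fun l hl z _ => by
        rw [iteratedFDeriv_rescale hψ, norm_smul, norm_pow, norm_pow, Real.norm_ofNat, mul_comm]
        exact mul_le_mul (hB l hl _) (pow_le_pow_right₀ h2m hl) (by positivity) hB0) x hx
    have h2 : (localSchwartz A k (dyadicBump A j hη hηs hψ x₀ m) : EuclSp n → ℂ) =
        cutoffComp η' (A.chart j) (fun x => ψ ((2 : ℝ) ^ m • (x - x₀))) ∘ (A.chart k).symm := by
      ext z
      simp only [cutoffComp, Function.comp_apply, η', Complex.ofReal_mul, mul_assoc]
      rfl
    rw [h2, mul_assoc]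
    exact h1
  · have h0 : iteratedFDeriv ℝ i (localSchwartz A k (dyadicBump A j hη hηs hψ x₀ m)) x = 0 := by
      refine image_eq_zero_of_notMem_tsupport fun h => hx ?_
      exact (tsupport_localSchwartz_dyadicBump_subset hη hηs hψ hψs x₀ k m
        (tsupport_iteratedFDeriv_subset i h)).1
    rw [h0, norm_zero]
    positivity

variable [MeasurableSpace Γ] [BorelSpace Γ]

/-- Lebesgue measure in the `k`-th chart is compared with Lebesgue measure in the `j`-th through the
measure `dx`, whose density is bounded below on one compact set and above on the other. No Jacobian
of the change of charts is needed. -/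
theorem exists_volume_chartOverlapBall_le (A : AdaptedAtlas n Γ) (d : SmoothDensity n Γ)
    (j k : Fin A.r) (x₀ : EuclSp n) : ∃ V, 0 ≤ V ∧ ∀ r, 0 ≤ r → r ≤ 1 →
      volume (chartOverlapBall A j k x₀ r) ≤ ENNReal.ofReal (V * r ^ n) := by
  obtain ⟨c, hc, hcd⟩ := d.exists_le_dens (A.chart_mem k) (A.isCompact_image_tsupport k)
    (by simp [A.chart_target k])
  obtain ⟨C, hC⟩ := d.exists_dens_le (A.chart_mem j) (isCompact_closedBall x₀ 1)
    (by simp [A.chart_target j])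
  have hC0 : 0 ≤ C := (d.dens_pos _ (A.chart_mem j) x₀ (by simp [A.chart_target j])).le.trans
    (hC x₀ (Metric.mem_closedBall_self zero_le_one))
  set v : ℝ := (volume (Metric.ball (0 : EuclSp n) 1)).toReal with hv
  have hv' : volume (Metric.ball (0 : EuclSp n) 1) = ENNReal.ofReal v :=
    (ENNReal.ofReal_toReal measure_ball_lt_top.ne).symm
  have hv0 : 0 ≤ v := ENNReal.toReal_nonneg
  refine ⟨c⁻¹ * (C * v), by positivity, fun r hr hr1 => ?_⟩
  set S := chartOverlapBall A j k x₀ r with hS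
  have hSm : MeasurableSet S := (isClosed_chartOverlapBall A j k x₀ r).measurableSet
  have h1 : ENNReal.ofReal c * volume S ≤ ENNReal.ofReal (C * (r ^ n * v)) := by
    calc ENNReal.ofReal c * volume S = ∫⁻ _ in S, ENNReal.ofReal c := by rw [setLIntegral_const]
      _ ≤ ∫⁻ x in S, ENNReal.ofReal (d.dens (A.chart k) x) :=
          setLIntegral_mono' hSm fun x hx => ENNReal.ofReal_le_ofReal (hcd x hx.1)
      _ = d.measure ((A.chart k).source ∩ A.chart k ⁻¹' S) := by
          rw [d.measure_source_inter_preimage (A.chart_mem k) hSm, A.chart_target k, inter_univ]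
      _ ≤ d.measure ((A.chart j).source ∩ A.chart j ⁻¹' Metric.closedBall x₀ r) := by
          refine measure_mono ?_
          rintro y ⟨hy, -, z, hz, hzy⟩
          have hzt : z ∈ (A.chart j).target := by simp [A.chart_target j]
          rw [(A.chart k).left_inv hy] at hzy
          rw [← hzy]
          refine ⟨(A.chart j).map_target hzt, ?_⟩
          rw [mem_preimage, (A.chart j).right_inv hzt]
          exact hz
      _ = ∫⁻ x in Metric.closedBall x₀ r, ENNReal.ofReal (d.dens (A.chart j) x) := by
          rw [d.measure_source_inter_preimage (A.chart_mem j) measurableSet_closedBall,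
            A.chart_target j, inter_univ]
      _ ≤ ∫⁻ _ in Metric.closedBall x₀ r, ENNReal.ofReal C :=
          setLIntegral_mono' measurableSet_closedBall fun x hx =>
            ENNReal.ofReal_le_ofReal (hC x (Metric.closedBall_subset_closedBall hr1 hx))
      _ = _ := by
          rw [setLIntegral_const, Measure.addHaar_closedBall _ _ hr, hv',
            finrank_euclideanSpace_fin, ← ENNReal.ofReal_mul (by positivity),
            ← ENNReal.ofReal_mul hC0]
  have hc' : ENNReal.ofReal c ≠ 0 := by simpa using hc
  calc volume S = ENNReal.ofReal c⁻¹ * (ENNReal.ofReal c * volume S) := by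
        rw [← mul_assoc, ← ENNReal.ofReal_mul (by positivity), inv_mul_cancel₀ hc.ne',
          ENNReal.ofReal_one, one_mul]
    _ ≤ ENNReal.ofReal c⁻¹ * ENNReal.ofReal (C * (r ^ n * v)) := mul_le_mul_right h1 _
    _ = _ := by
        rw [← ENNReal.ofReal_mul (by positivity)]
        congr 1
        ring

variable [IsManifold (𝓡 n) ∞ Γ] {d : SmoothDensity n Γ} {φ : ℝ → ℝ} {ρ : ℕ}

/-- The norm in `H^{ρ+n/2,φ}(Γ)` of linear combinations of rescaled bumps. -/
theorem exists_refinedSpaceOn_dyadic (hn : 1 ≤ n) (hφ : SlowlyVaryingClass φ)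
    (hη : ContMDiff (𝓡 n) 𝓘(ℝ, ℝ) ∞ η) (hηs : tsupport η ⊆ (A.chart j).source)
    (hψ : ContDiff ℝ ∞ ψ) (hψs : tsupport ψ ⊆ Metric.closedBall 0 1) (x₀ : EuclSp n) :
    ∃ C, 0 ≤ C ∧ ∀ (M : ℕ) (b : ℕ → ℝ),
      ∃ h : RefinedSpaceOn A d ((ρ : ℝ) + (n : ℝ) / 2) φ,
      (∀ w : CkSpace n Γ ⊤, h.toDistribution w =
        ∫ y, (∑ m ∈ Finset.range M, (b m : ℂ) • dyadicBump A j hη hηs hψ x₀ m : CkSpace n Γ ⊤) y *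
          conj (w y) ∂d.measure) ∧
      ‖h‖ ^ 2 ≤ C * ∑ m ∈ Finset.range M, (b m * (2 ^ m) ^ ρ * φ (2 ^ m)) ^ 2 := by
  have hK : (ρ : ℝ) + (n : ℝ) / 2 + 1 / 2 ≤ ((ρ + n + 1 : ℕ) : ℝ) := by
    push_cast
    have : (1 : ℝ) ≤ n := mod_cast hn
    linarith
  have hex : ∀ k : Fin A.r, ∃ C, 0 ≤ C ∧ ∀ (M : ℕ) (b : ℕ → ℝ),
      MemLp (fun ξ => (refinedWeight ((ρ : ℝ) + (n : ℝ) / 2) φ ξ : ℂ) *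
        𝓕 (∑ m ∈ Finset.range M,
          (b m : ℂ) • localSchwartz A k (dyadicBump A j hη hηs hψ x₀ m)) ξ) 2 volume ∧
      ∫ ξ, ‖(refinedWeight ((ρ : ℝ) + (n : ℝ) / 2) φ ξ : ℂ) *
        𝓕 (∑ m ∈ Finset.range M,
          (b m : ℂ) • localSchwartz A k (dyadicBump A j hη hηs hψ x₀ m)) ξ‖ ^ 2 ≤
        C * ∑ m ∈ Finset.range M, (b m * (2 ^ m) ^ ρ * φ (2 ^ m)) ^ 2 := by
    intro k
    obtain ⟨V, hV0, hV⟩ := exists_volume_chartOverlapBall_le A d j k x₀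
    obtain ⟨B₁, hB₁, h₁⟩ := exists_iteratedFDeriv_localSchwartz_dyadicBump_le hη hηs hψ hψs x₀ k 0
    obtain ⟨B₂, hB₂, h₂⟩ :=
      exists_iteratedFDeriv_localSchwartz_dyadicBump_le hη hηs hψ hψs x₀ k (ρ + n + 1)
    exact hφ.exists_dyadic_sum_bound hn ρ (ρ + n) hK (B := max B₁ B₂) hV0
      (fun m => tsupport_localSchwartz_dyadicBump_subset hη hηs hψ hψs x₀ k m)
      (fun m => by
        have h3 := hV ((2 ^ m)⁻¹) (by positivity) (inv_le_one_of_one_le₀ (one_le_pow₀ one_le_two))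
        rwa [inv_pow, ← div_eq_mul_inv] at h3)
      (fun m x => by
        have h3 := h₁ m x
        rw [norm_iteratedFDeriv_zero, pow_zero, mul_one] at h3
        exact h3.trans (le_max_left _ _))
      (fun m x => (h₂ m x).trans (by gcongr; exact le_max_right _ _))
  choose C hC0 hC using hex
  refine ⟨∑ k, C k, Finset.sum_nonneg fun k _ => hC0 k, fun M b => ?_⟩
  set f : CkSpace n Γ ⊤ := ∑ m ∈ Finset.range M, (b m : ℂ) • dyadicBump A j hη hηs hψ x₀ m with hf
  have hls : ∀ k, localSchwartz A k f = ∑ m ∈ Finset.range M,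
      (b m : ℂ) • localSchwartz A k (dyadicBump A j hη hηs hψ x₀ m) := by
    intro k
    ext x
    rw [localSchwartz_apply, hf, CkSpace.sum_smul_apply, Finset.mul_sum, sum_apply]
    refine Finset.sum_congr rfl fun m _ => ?_
    rw [smul_apply, localSchwartz_apply, smul_eq_mul, mul_left_comm]
  have hFF : ∀ k, HasFourierFunction
      (localRep A d k (distributionOfContinuous A d f.continuous_coe))
      (fun ξ => 𝓕 (localSchwartz A k f) ξ) := fun k =>
    hasFourierFunction_of_schwartz (localRep_distributionOfContinuous A d k f)
  refine ⟨⟨distributionOfContinuous A d f.continuous_coe, fun k => ⟨_, hFF k, ?_⟩⟩,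
    fun w => rfl, ?_⟩
  · rw [hls]
    exact (hC k M b).1
  · change ‖RefinedSpaceOn.toL2 A d ((ρ : ℝ) + (n : ℝ) / 2) φ _‖ ^ 2 ≤ _
    rw [PiLp.norm_sq_eq_of_L2, Finset.sum_mul]
    refine Finset.sum_le_sum fun k _ => ?_
    refine (norm_weightedFourier_sq_of_hasFourierFunction (hFF k) _).trans_le ?_
    rw [hls]
    exact (hC k M b).2

/-- If the inclusion `H^{ρ+n/2,φ}(Γ) → C^ρ(Γ)` is continuous, the series of the `φ(2^m)^{-2}`
converges. -/
theorem RefinedSpaceOn.IsInclusion.summable [Nonempty Γ] (hn : 1 ≤ n) (hφ : SlowlyVaryingClass φ)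
    {T : RefinedSpaceOn A d ((ρ : ℝ) + (n : ℝ) / 2) φ →L[ℂ] CkSpace n Γ (ρ : ℕ∞)}
    (hT : RefinedSpaceOn.IsInclusion T) : Summable fun m : ℕ => 1 / φ (2 ^ m) ^ 2 := by
  by_contra hdiv
  rw [not_summable_iff_tendsto_nat_atTop_of_nonneg fun m => by positivity] at hdiv
  obtain ⟨p⟩ := ‹Nonempty Γ›
  obtain ⟨j, hj⟩ : ∃ j, p ∈ (A.chart j).source := by
    have := A.chart_cover.symm ▸ mem_univ p
    exact mem_iUnion.1 this
  obtain ⟨η, hη, hηs, hη1⟩ := exists_smooth_cutoff (n := n) isClosed_singleton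
    (A.chart j).open_source (singleton_subset_iff.2 hj)
  rw [nhdsSet_singleton] at hη1
  obtain ⟨ψ, hψ, hψs, hψ0⟩ := exists_profile hn ρ
  set x₀ := A.chart j p
  have hx₀ : x₀ ∈ (A.chart j).target := (A.chart j).map_source hj
  obtain ⟨C, hC0, hC⟩ := exists_refinedSpaceOn_dyadic (d := d) (ρ := ρ) hn hφ hη hηs hψ hψs x₀
  set σ : ℕ → ℝ := fun M => ∑ m ∈ Finset.range M, 1 / φ (2 ^ m) ^ 2 with hσ
  -- The case of equality in Cauchy–Schwarz: for `σ M ≠ 0` these coefficients minimise `∑ (b_m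
  -- 2^(mρ) φ(2^m))^2` subject to `∑ b_m 2^(mρ) = 1`, and the minimum is `1 / σ M`.
  set b : ℕ → ℕ → ℝ := fun M m => 1 / φ (2 ^ m) ^ 2 / σ M / (2 ^ m) ^ ρ with hb
  choose h hh hhn using fun M => hC M (b M)
  have hpos : ∀ m : ℕ, 0 < φ (2 ^ m) := fun m => hφ.pos _ (one_le_pow₀ one_le_two)
  have hsq : ∀ M, ‖h M‖ ^ 2 ≤ C * (σ M)⁻¹ := by
    intro M
    refine (hhn M).trans (le_of_eq ?_)
    congr 1
    have h1 : ∀ m ∈ Finset.range M, (b M m * (2 ^ m) ^ ρ * φ (2 ^ m)) ^ 2 =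
        1 / φ (2 ^ m) ^ 2 * ((σ M)⁻¹) ^ 2 := by
      intro m _
      have := (hpos m).ne'
      simp only [hb]
      field_simp
    rw [Finset.sum_congr rfl h1, ← Finset.sum_mul]
    change σ M * _ = _
    rw [sq, ← mul_assoc]
    -- The empty sum `σ 0` vanishes; there the identity holds by the convention `0⁻¹ = 0`.
    rcases eq_or_ne (σ M) 0 with h0 | h0
    · simp [h0]
    · rw [mul_inv_cancel₀ h0, one_mul]
  have hlim : Tendsto h atTop (𝓝 0) := by
    rw [tendsto_zero_iff_norm_tendsto_zero]
    have h1 : Tendsto (fun M => ‖h M‖ ^ 2) atTop (𝓝 0) := by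
      refine squeeze_zero (fun M => sq_nonneg _) hsq ?_
      simpa using hdiv.inv_tendsto_atTop.const_mul C
    simpa using h1.sqrt
  have hD : Tendsto (fun M => iteratedFDeriv ℝ ρ ((T (h M) : Γ → ℂ) ∘ (A.chart j).symm) x₀) atTop
      (𝓝 (iteratedFDeriv ℝ ρ ((T 0 : Γ → ℂ) ∘ (A.chart j).symm) x₀)) :=
    ((CkSpace.continuous_iteratedFDeriv_apply (A.chart_mem j) (k := (ρ : ℕ∞)) le_rfl
      hx₀).comp T.continuous).tendsto 0 |>.comp hlim
  have hD0 : iteratedFDeriv ℝ ρ ((T 0 : Γ → ℂ) ∘ (A.chart j).symm) x₀ = 0 := by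
    rw [map_zero]
    exact congrFun (iteratedFDeriv_fun_zero (n := ρ)) x₀
  -- Near `x₀` the cutoff is one, and the `m`-th bump contributes `b M m * (2 ^ m) ^ ρ` times the
  -- derivative of `ψ`; these factors add up to one.
  have hD1 : ∀ M, σ M ≠ 0 → iteratedFDeriv ℝ ρ ((T (h M) : Γ → ℂ) ∘ (A.chart j).symm) x₀ =
      iteratedFDeriv ℝ ρ ψ 0 := by
    intro M hM
    have hTh : (T (h M) : Γ → ℂ) = (∑ m ∈ Finset.range M,
        (b M m : ℂ) • dyadicBump A j hη hηs hψ x₀ m : CkSpace n Γ ⊤) :=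
      d.eq_of_forall_integral_eq (T (h M)).continuous_coe (CkSpace.continuous_coe _)
        fun w => (hT (h M) w).symm.trans (hh M w)
    have hev : (T (h M) : Γ → ℂ) ∘ (A.chart j).symm =ᶠ[𝓝 x₀] fun x =>
        ∑ m ∈ Finset.range M, b M m • ψ ((2 : ℝ) ^ m • (x - x₀)) := by
      have h1 : ∀ᶠ x in 𝓝 x₀, η ((A.chart j).symm x) = 1 := by
        have h2 := (A.chart j).continuousAt_symm hx₀
        rw [ContinuousAt, (A.chart j).left_inv hj] at h2
        exact h2.eventually hη1
      filter_upwards [h1, (A.chart j).open_target.mem_nhds hx₀] with x hx hxt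
      rw [hTh, Function.comp_apply, CkSpace.sum_smul_apply]
      refine Finset.sum_congr rfl fun m _ => ?_
      change _ * ((η _ : ℂ) * ψ ((2 : ℝ) ^ m • (A.chart j _ - x₀))) = _
      rw [hx, (A.chart j).right_inv hxt, Complex.ofReal_one, one_mul, Complex.real_smul]
    have hcd : ∀ m : ℕ, ContDiffAt ℝ ρ (fun x => ψ ((2 : ℝ) ^ m • (x - x₀))) x₀ := fun m =>
      ((contDiff_rescale hψ _ x₀).of_le (mod_cast le_top)).contDiffAt
    rw [(hev.iteratedFDeriv ℝ ρ).eq_of_nhds,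
      iteratedFDeriv_fun_sum_apply fun m _ => (hcd m).const_smul (b M m)]
    have hterm : ∀ m, iteratedFDeriv ℝ ρ (fun x => b M m • ψ ((2 : ℝ) ^ m • (x - x₀))) x₀ =
        (1 / φ (2 ^ m) ^ 2 / σ M) • iteratedFDeriv ℝ ρ ψ 0 := by
      intro m
      rw [iteratedFDeriv_const_smul_apply' (hcd m), iteratedFDeriv_rescale hψ, sub_self, smul_zero,
        smul_smul, hb, div_mul_cancel₀ _ (by positivity)]
    rw [Finset.sum_congr rfl fun m _ => hterm m, ← Finset.sum_smul, ← Finset.sum_div]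
    change (σ M / σ M) • _ = _
    rw [div_self hM, one_smul]
  rw [hD0] at hD
  refine hψ0 (tendsto_nhds_unique (tendsto_const_nhds.congr' ?_) hD)
  filter_upwards [hdiv.eventually_gt_atTop 0] with M hM
  exact (hD1 M hM.ne').symm

end Necessity

/-! ### The criterion and the compactness of the inclusion -/

theorem proposition2 {n : ℕ} (hn : 1 ≤ n)
    {Γ : Type*} [TopologicalSpace Γ] [T2Space Γ] [CompactSpace Γ] [Nonempty Γ]
    [ChartedSpace (EuclSp n) Γ] [IsManifold (𝓡 n) ∞ Γ]
    [MeasurableSpace Γ] [BorelSpace Γ]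
    (A : AdaptedAtlas n Γ) (d : SmoothDensity n Γ)
    (φ : ℝ → ℝ) (hφ : SlowlyVaryingClass φ) (ρ : ℕ) :
    ((∫⁻ t in Ici (1 : ℝ), ENNReal.ofReal (1 / (t * φ t ^ 2)) < ⊤) ↔
      ∃ T : RefinedSpaceOn A d ((ρ : ℝ) + (n : ℝ) / 2) φ →L[ℂ] CkSpace n Γ (ρ : ℕ∞),
        RefinedSpaceOn.IsInclusion T) ∧
    ∀ T : RefinedSpaceOn A d ((ρ : ℝ) + (n : ℝ) / 2) φ →L[ℂ] CkSpace n Γ (ρ : ℕ∞),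
      RefinedSpaceOn.IsInclusion T → IsCompactOperator T := by
  -- Used twice: for the converse implication, and for compactness, where it supplies the
  -- convergence of the series that is not assumed there.
  have hnec : ∀ T : RefinedSpaceOn A d ((ρ : ℝ) + (n : ℝ) / 2) φ →L[ℂ] CkSpace n Γ (ρ : ℕ∞),
      RefinedSpaceOn.IsInclusion T → ∑' m : ℕ, ENNReal.ofReal (1 / φ (2 ^ m) ^ 2) < ⊤ :=
    fun T hT => (hT.summable hn hφ).tsum_ofReal_lt_top
  rw [hφ.lintegral_lt_top_iff_tsum]
  exact ⟨⟨fun h => exists_continuous_inclusion hφ (hφ.memLp_pow_div_refinedWeight h ρ),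
    fun ⟨T, hT⟩ => hnec T hT⟩,
    fun T hT => hT.isCompactOperator hφ (hφ.memLp_pow_div_refinedWeight (hnec T hT) ρ)⟩
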